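/- **Setting.** Let $\gamma>0$, let $\bar\tau:[0,\infty)\to\mathbb R$ be of class $C^2$, let $\tau_0:[0,1]\to\mathbb R$ be of class $C^1$ with $\tau_0(1)=\bar\tau(0)$, and let $\beta_0:[0,1]\to(0,\infty)$ be continuous. For $n\ge 1$ consider the harmonic chain of $n$ particles with stretches $\mathbf r=(r_1,\dots,r_n)$ and momenta $\mathbf p=(p_1,\dots,p_n)$, put $p_0:=0$, and let $\mathcal E_i=\frac{p_i^2}{2}+\frac{r_i^2}{2}$ be the energy of particle $i$. The chain evolves as the Markov process on $(\mathbb R\times\mathbb R)^n$ with the time-dependent generator $\mathcal L_n^{\bar\tau(t)}=n^2A_n^{\bar\tau(t)}+n^2\gamma S_n$, where $$A_n^{\tau}=\sum_{i=1}^n (p_i-p_{i-1})\frac{\partial}{\partial r_i}+\sum_{i=1}^{n-1}(r_{i+1}-r_i)\frac{\partial}{\partial p_i}+(\tau-r_n)\frac{\partial}{\partial p_n},\qquad S_nf(\mathbf r,\mathbf p)=\sum_{i=1}^n\big(f(\mathbf r,\mathbf p^i)-f(\mathbf r,\mathbf p)\big),$$ and $\mathbf p^i$ is $\mathbf p$ with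 the sign of $p_i$ changed (the process is understood as a solution of the martingale problem of this generator on $C^1$ functions with compact support). Its initial law is the local Gibbs measure $$\prod_{i=1}^n \exp\Big(-\beta_0(\tfrac in)\big(\mathcal E_i-\tau_0(\tfrac in)r_i\big)-\mathcal G_{\tau_0(i/n),\beta_0(i/n)}\Big)\,dr_i\,dp_i,\qquad \mathcal G_{\tau,\beta}=\log\Big[\sqrt{2\pi/\beta}\int_{\mathbb R}e^{-\beta(r^2/2-\tau r)}\,dr\Big].$$ Let $\mu_t^n$ be the law of the configuration at time $t\ge 0$. **Theorem (moment bounds).** Let $k\ge 1$ be an integer. 1. For every $T\ge 0$ there is a constant $C>0$, independent of $n$ and $t$, such that $\sum_{i=1}^n\mathcal E_i^k$ is $\mu^n_t$-integrable and $$\mu_t^n\Big[\sum_{i=1}^n\mathcal E_i^k\Big]\le C\,n\qquad\text{for all } n\ge 1 \text{ and all } t\in[0,T].$$ 2. If moreover $\int_0^\infty|\bar\tau'(t)|\,dt<\infty$ and $\int_0^\infty|\bar\tau''(t)|\,dt<\infty$ (for example if $\bar\tau$ is constant after some time), then one constant $C>0$, independent of $n$ and $t$, has this property for all $n\ge1$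 and all $t\ge 0$. -/

import Mathlib

open MeasureTheory ProbabilityTheory
open scoped NNReal

namespace VelocityFlip

noncomputable section

/-- Configurations `(r, p)` of the chain: `r i` is the stretch of the spring to the left of
particle `i`, `p i` its momentum.  Particle `i ∈ {1, …, n}` is the element `i - 1` of `Fin n`. -/
abbrev Phase (n : ℕ) : Type := (Fin n → ℝ) × (Fin n → ℝ)

/-- The harmonic potential `V(r) = r² / 2`; its derivative is `V'(r) = r`. -/
def potential (r : ℝ) : ℝ := r ^ 2 / 2

/-- The energy `𝓔ᵢ = pᵢ² / 2 + V(rᵢ)` of particle `i`. -/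
def energy {n : ℕ} (x : Phase n) (i : Fin n) : ℝ := x.2 i ^ 2 / 2 + potential (x.1 i)

/-- The momentum `pᵢ₋₁` of the left neighbour of particle `i`; particle `0` does not move. -/
def prevMomentum {n : ℕ} (x : Phase n) (i : Fin n) : ℝ :=
  if h : (i : ℕ) = 0 then 0 else x.2 ⟨(i : ℕ) - 1, by omega⟩

/-- The force that pulls particle `i` to the right: `V'(rᵢ₊₁) = rᵢ₊₁` for `i < n`, and the applied
tension `τ` for `i = n`. -/
def rightForce {n : ℕ} (τ : ℝ) (x : Phase n) (i : Fin n) : ℝ :=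
  if h : (i : ℕ) + 1 < n then x.1 ⟨(i : ℕ) + 1, h⟩ else τ

/-- The partial derivative `∂f / ∂rᵢ`. -/
def partialR {n : ℕ} (f : Phase n → ℝ) (i : Fin n) (x : Phase n) : ℝ :=
  fderiv ℝ f x (Pi.single i 1, 0)

/-- The partial derivative `∂f / ∂pᵢ`. -/
def partialP {n : ℕ} (f : Phase n → ℝ) (i : Fin n) (x : Phase n) : ℝ :=
  fderiv ℝ f x (0, Pi.single i 1)

/-- The Liouville operator `A_n^τ` of the harmonic chain with tension `τ` at its right end. -/
def liouville {n : ℕ} (τ : ℝ) (f : Phase n → ℝ) (x : Phase n) : ℝ :=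
  ∑ i : Fin n, ((x.2 i - prevMomentum x i) * partialR f i x
    + (rightForce τ x i - x.1 i) * partialP f i x)

/-- The configuration `(r, pⁱ)`: the sign of the momentum of particle `i` is changed. -/
def flip {n : ℕ} (i : Fin n) (x : Phase n) : Phase n :=
  (x.1, Function.update x.2 i (-(x.2 i)))

/-- The velocity flip operator `S_n f (r, p) = ∑ᵢ (f (r, pⁱ) - f (r, p))`. -/
def flipOp {n : ℕ} (f : Phase n → ℝ) (x : Phase n) : ℝ :=
  ∑ i : Fin n, (f (flip i x) - f x)

/-- The generator `n² A_n^τ + n² γ S_n` in the diffusive time scale. -/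
def generator (n : ℕ) (γ τ : ℝ) (f : Phase n → ℝ) (x : Phase n) : ℝ :=
  (n : ℝ) ^ 2 * liouville τ f x + (n : ℝ) ^ 2 * γ * flipOp f x

/-- The logarithm of the one-site partition function,
`log (√(2π / β) ∫ exp (-β (V(r) - τ r)) dr)`. -/
def logPartition (τ β : ℝ) : ℝ :=
  Real.log (√(2 * Real.pi / β) * ∫ r : ℝ, Real.exp (-β * (potential r - τ * r)))

/-- The local Gibbs measure with tension profile `τ` and inverse temperature profile `β`. -/
def localGibbs (n : ℕ) (τ β : ℝ → ℝ) : Measure (Phase n) :=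
  (volume : Measure (Phase n)).withDensity fun x =>
    ENNReal.ofReal (∏ i : Fin n,
      Real.exp (-β (((i : ℕ) + 1 : ℝ) / n) *
          (energy x i - τ (((i : ℕ) + 1 : ℝ) / n) * x.1 i)
        - logPartition (τ (((i : ℕ) + 1 : ℝ) / n)) (β (((i : ℕ) + 1 : ℝ) / n))))

/-- `X` is the harmonic chain of `n` particles with velocity flips at rate `γ`, in the diffusive
time scale, with the applied tension `τbar t` at time `t` and started from the local Gibbs measure
with profiles `τ₀`, `β₀`.  That is, `X` is a measurable adapted process with this initial law that
solves the martingale problem of the time-dependent generator `n² A_n^{τbar t} + n² γ S_n` on the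
continuously differentiable functions with compact support (the problem is well posed: the flow is
affine with continuous coefficients and the flips come at a bounded rate). -/
structure IsChain (n : ℕ) (γ : ℝ) (τbar τ₀ β₀ : ℝ → ℝ) {Ω : Type*} [MeasurableSpace Ω]
    (P : Measure Ω) (ℱ : Filtration ℝ≥0 ‹MeasurableSpace Ω›) (X : ℝ≥0 → Ω → Phase n) : Prop where
  measurable : Measurable (fun q : ℝ≥0 × Ω => X q.1 q.2)
  adapted : ∀ t, Measurable[ℱ t] (X t)
  initial : P.map (X 0) = localGibbs n τ₀ β₀
  martingale : ∀ f : Phase n → ℝ, ContDiff ℝ 1 f → HasCompactSupport f →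
    Martingale (fun (t : ℝ≥0) (ω : Ω) =>
      f (X t ω) - ∫ s in (0 : ℝ)..(t : ℝ), generator n γ (τbar s) f (X s.toNNReal ω)) ℱ P

end

end VelocityFlip

namespace VelocityFlip

open Filter Topology

noncomputable section

variable {n : ℕ}

/-! ### The Euclidean structure of the phase space -/

/-! The proof works with the moment generating function `φ_t(z) = E exp ⟨z, x⟩` of the law at time
`t`. The Hamiltonian drift without tension is antisymmetric and the flips are symmetric for the
Euclidean product, so both can be moved from `x` to `z`: `φ` solves a linear equation consisting of
transport along a rotation field in `z`, a term from the tension, and jumps `z ↦ flip i z` at rate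
`n²γ` (`IsLawFlow.hasDerivAt_phaseMGF`). Rotations and flips preserve the unit ball, so a maximum
principle holds there without boundary conditions.

The comparison function is the Gaussian `exp (⟨z, m_t⟩ + q_t |z|²/2)`, where `m_t` is the true mean.
The linear part absorbs the tension and the first order of the flips; what is left is `n²γ ∑ (exp
(-vᵢ) - 1 + vᵢ)` with `vᵢ = 2 zᵢ · (mean of pᵢ)`, of size `n² maxᵢ (mean of pᵢ)² |z|²`. Hence it
suffices that `q` grows at this rate (`IsLawFlow.no_interior_max`, `IsLawFlow.phaseMGF_le`), and `q`
stays bounded if `n² ∫ maxᵢ (mean of pᵢ)² dt` is bounded.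

Linear functions are closed under the generator, so the means solve a discrete damped wave equation.
Let `D` be the squared norm of its increments and `H ≤ D` the part coming from momenta. The energy
identity dissipates `4γn²H`; the boundary forcing is handled by integration by parts in time. This
yields `D = O(1/n)` and `∫ H = O(1/n³)`, with constants depending on the tension only through `sup
|τ'|`, `∫ τ'²` and `∫ |τ''|` (`normSq_drift_le_of_hasDerivAt`). Telescoping gives `(mean of pᵢ)² ≤ n
H` and `(τ - mean of rᵢ)² ≤ n D`, so the means and `q` are bounded uniformly in `n`, and uniformly
in time when `τ'` and `τ''` are integrable.

Evaluating at plus and minus the coordinate vectors bounds `E exp (±rᵢ)` and `E exp (±pᵢ)` uniformly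
in the site, hence every moment of each energy; summing over sites gives `C n`. The remaining work
is to extend Dynkin's formula from compactly supported functions to exponentials, by a radial cutoff
and by the propagation of exponential moments (`IsLawFlow.exists_integral_weight_le`), where the
constants may depend on `n`. -/

/-- The Euclidean inner product of two configurations. -/
def pair (z x : Phase n) : ℝ := ∑ i, (z.1 i * x.1 i + z.2 i * x.2 i)

/-- The squared Euclidean norm of a configuration. -/
def normSq (x : Phase n) : ℝ := pair x x

lemma pair_comm (z x : Phase n) : pair z x = pair x z := by
  unfold pair
  exact Finset.sum_congr rfl fun i _ => by ring

lemma pair_add_right (z x y : Phase n) : pair z (x + y) = pair z x + pair z y := by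
  simp only [pair, ← Finset.sum_add_distrib, Prod.fst_add, Prod.snd_add, Pi.add_apply]
  exact Finset.sum_congr rfl fun i _ => by ring

lemma pair_smul_right (c : ℝ) (z x : Phase n) : pair z (c • x) = c * pair z x := by
  simp only [pair, Finset.mul_sum, Prod.smul_fst, Prod.smul_snd, Pi.smul_apply, smul_eq_mul]
  exact Finset.sum_congr rfl fun i _ => by ring

lemma pair_add_left (z y x : Phase n) : pair (z + y) x = pair z x + pair y x := by
  rw [pair_comm, pair_add_right, pair_comm x, pair_comm x]

lemma pair_smul_left (c : ℝ) (z x : Phase n) : pair (c • z) x = c * pair z x := by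
  rw [pair_comm, pair_smul_right, pair_comm x]

lemma pair_zero_left (x : Phase n) : pair 0 x = 0 := by simp [pair]

/-- The Euclidean inner product with `z`, as a continuous linear form. -/
def pairL (z : Phase n) : Phase n →L[ℝ] ℝ :=
  LinearMap.toContinuousLinearMap
    { toFun := pair z
      map_add' := pair_add_right z
      map_smul' := fun c x => by simp [pair_smul_right] }

@[simp] lemma pairL_apply (z x : Phase n) : pairL z x = pair z x := rfl

lemma contDiff_pair (z : Phase n) {m : WithTop ℕ∞} : ContDiff ℝ m (pair z) :=
  (pairL z).contDiff

lemma hasFDerivAt_pair (z x : Phase n) : HasFDerivAt (pair z) (pairL z) x :=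
  (pairL z).hasFDerivAt

lemma continuous_pair : Continuous fun q : Phase n × Phase n => pair q.1 q.2 := by
  unfold pair; fun_prop

lemma normSq_eq (x : Phase n) : normSq x = ∑ i, (x.1 i ^ 2 + x.2 i ^ 2) := by
  unfold normSq pair
  exact Finset.sum_congr rfl fun i _ => by ring

lemma normSq_nonneg (x : Phase n) : 0 ≤ normSq x := by
  rw [normSq_eq]
  exact Finset.sum_nonneg fun i _ => by positivity

lemma sq_fst_le_normSq (x : Phase n) (i : Fin n) : x.1 i ^ 2 ≤ normSq x := by
  rw [normSq_eq]
  refine le_trans (le_add_of_nonneg_right (sq_nonneg (x.2 i))) ?_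
  exact Finset.single_le_sum (f := fun i => x.1 i ^ 2 + x.2 i ^ 2)
    (fun i _ => by positivity) (Finset.mem_univ i)

lemma sq_snd_le_normSq (x : Phase n) (i : Fin n) : x.2 i ^ 2 ≤ normSq x := by
  rw [normSq_eq]
  refine le_trans (le_add_of_nonneg_left (sq_nonneg (x.1 i))) ?_
  exact Finset.single_le_sum (f := fun i => x.1 i ^ 2 + x.2 i ^ 2)
    (fun i _ => by positivity) (Finset.mem_univ i)

lemma norm_sq_le_normSq (x : Phase n) : ‖x‖ ^ 2 ≤ normSq x := by
  have h : ‖x‖ ≤ √(normSq x) := by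
    refine norm_prod_le_iff.2 ⟨?_, ?_⟩ <;>
      refine (pi_norm_le_iff_of_nonneg (Real.sqrt_nonneg _)).2 fun i => ?_ <;>
      rw [Real.norm_eq_abs] <;> apply Real.abs_le_sqrt
    · exact sq_fst_le_normSq x i
    · exact sq_snd_le_normSq x i
  calc ‖x‖ ^ 2 ≤ √(normSq x) ^ 2 := by gcongr
    _ = normSq x := Real.sq_sqrt (normSq_nonneg x)

lemma contDiff_normSq {m : WithTop ℕ∞} : ContDiff ℝ m (normSq (n := n)) := by
  have : (normSq (n := n)) = fun x => ∑ i, (x.1 i ^ 2 + x.2 i ^ 2) := funext normSq_eq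
  rw [this]; fun_prop

lemma normSq_add (x y : Phase n) : normSq (x + y) = normSq x + 2 * pair x y + normSq y := by
  simp only [normSq, pair_add_right, pair_add_left, pair_comm y x]; ring

lemma normSq_smul (c : ℝ) (x : Phase n) : normSq (c • x) = c ^ 2 * normSq x := by
  simp only [normSq, pair_smul_right, pair_smul_left]; ring

lemma hasFDerivAt_normSq (x : Phase n) : HasFDerivAt normSq ((2 : ℝ) • pairL x) x := by
  have h : ∀ v, fderiv ℝ normSq x v = 2 * pair x v := by
    intro v
    have hd : DifferentiableAt ℝ (normSq (n := n)) x :=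
      (contDiff_normSq (m := 1)).differentiable one_ne_zero x
    have h1 : HasDerivAt (fun s : ℝ => normSq (x + s • v)) (fderiv ℝ normSq x v) 0 := by
      have hl : HasDerivAt (fun s : ℝ => x + s • v) v 0 := by
        simpa using ((hasDerivAt_id (0 : ℝ)).smul_const v).const_add x
      have hd' : HasFDerivAt (normSq (n := n)) (fderiv ℝ normSq x) (x + (0 : ℝ) • v) := by
        simpa using hd.hasFDerivAt
      exact hd'.comp_hasDerivAt (0 : ℝ) hl
    have h2 : HasDerivAt (fun s : ℝ => normSq (x + s • v)) (2 * pair x v) 0 := by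
      have : (fun s : ℝ => normSq (x + s • v)) =
          fun s => normSq x + 2 * (s * pair x v) + s ^ 2 * normSq v := by
        funext s
        rw [normSq_add, normSq_smul, pair_smul_right]
      rw [this]
      have h3 := ((((hasDerivAt_id (0 : ℝ)).mul_const (pair x v)).const_mul 2).const_add
        (normSq x)).add (((hasDerivAt_id (0 : ℝ)).pow 2).mul_const (normSq v))
      exact h3.congr_deriv (by simp)
    exact h1.unique h2
  have hd : DifferentiableAt ℝ (normSq (n := n)) x :=
      (contDiff_normSq (m := 1)).differentiable one_ne_zero x
  convert hd.hasFDerivAt using 1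
  ext v <;> simp [h]

/-! ### The drift of the chain -/

/-- The vector field of the Hamiltonian part of the dynamics. -/
def drift (τ : ℝ) (x : Phase n) : Phase n :=
  (fun i => x.2 i - prevMomentum x i, fun i => rightForce τ x i - x.1 i)

/-- The unit vector in the direction of the momentum of the last particle. -/
def endUnit : Phase n := (0, fun i => if (i : ℕ) + 1 < n then 0 else 1)

lemma drift_eq (τ : ℝ) (x : Phase n) : drift τ x = drift 0 x + τ • endUnit := by
  refine Prod.ext ?_ ?_
  · simp [drift, endUnit]
  · funext i
    simp only [drift, endUnit, rightForce]
    by_cases h : (i : ℕ) + 1 < n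
    · simp [h]
    · simp [h]; ring

lemma drift_zero_add (x y : Phase n) : drift 0 (x + y) = drift 0 x + drift 0 y := by
  refine Prod.ext ?_ ?_
  · funext i
    simp only [drift, prevMomentum]
    by_cases h : (i : ℕ) = 0
    · simp [h]
    · simp [h]; ring
  · funext i
    simp only [drift, rightForce]
    by_cases h : (i : ℕ) + 1 < n
    · simp [h]; ring
    · simp [h]; ring

lemma drift_zero_smul (c : ℝ) (x : Phase n) : drift 0 (c • x) = c • drift 0 x := by
  refine Prod.ext ?_ ?_
  · funext i
    simp only [drift, prevMomentum]
    by_cases h : (i : ℕ) = 0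
    · simp [h]
    · simp [h]; ring
  · funext i
    simp only [drift, rightForce]
    by_cases h : (i : ℕ) + 1 < n
    · simp [h]; ring
    · simp [h]

/-- Discrete summation by parts: the right and left shifts with zero boundary values are adjoint to
each other. -/
lemma sum_mul_prev (a b : Fin n → ℝ) :
    ∑ i : Fin n, a i * (if h : (i : ℕ) = 0 then 0 else b ⟨(i : ℕ) - 1, by omega⟩) =
      ∑ i : Fin n, (if h : (i : ℕ) + 1 < n then a ⟨(i : ℕ) + 1, h⟩ else 0) * b i := by
  cases n with
  | zero => simp
  | succ m =>
    rw [Fin.sum_univ_succ, Fin.sum_univ_castSucc (n := m)]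
    simp [Fin.succ, Fin.castSucc, Fin.castAdd, Fin.castLE]

/-- The momentum differences and the stretch differences are minus adjoint, thanks to the boundary
values `p₀ = 0` and zero tension. This antisymmetry makes the free flow a rotation; the cutoff, the
exponential weights, the energy identity and the maximum principle all rest on it. -/
lemma pair_drift_zero (z x : Phase n) : pair z (drift 0 x) = -pair (drift 0 z) x := by
  have h1 := sum_mul_prev z.1 x.2
  have h2 := sum_mul_prev x.1 z.2
  simp only [pair, drift, prevMomentum, rightForce, mul_sub, sub_mul, Finset.sum_add_distrib,
    Finset.sum_sub_distrib] at *
  have h3 : ∀ a b : Fin n → ℝ, ∑ i, a i * b i = ∑ i, b i * a i := fun a b =>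
    Finset.sum_congr rfl fun i _ => mul_comm _ _
  rw [h1]
  rw [h3 x.1] at h2
  rw [h2, h3 z.2 x.1, h3 z.2]
  ring_nf

lemma pair_drift_zero_self (x : Phase n) : pair x (drift 0 x) = 0 := by
  have := pair_drift_zero x x
  rw [pair_comm (drift 0 x)] at this
  linarith

lemma liouville_eq (τ : ℝ) (f : Phase n → ℝ) (x : Phase n) :
    liouville τ f x = fderiv ℝ f x (drift τ x) := by
  have h : drift τ x = ∑ i, ((x.2 i - prevMomentum x i) • ((Pi.single i 1, 0) : Phase n)
      + (rightForce τ x i - x.1 i) • ((0, Pi.single i 1) : Phase n)) := by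
    refine Prod.ext ?_ ?_
    · funext j
      simp [drift, Prod.fst_sum, Finset.sum_apply, Pi.single_apply]
    · funext j
      simp [drift, Prod.snd_sum, Finset.sum_apply, Pi.single_apply]
  rw [h, map_sum]
  simp only [map_add, map_smul, smul_eq_mul]
  rfl

lemma pair_sq_le (z x : Phase n) : pair z x ^ 2 ≤ normSq z * normSq x := by
  -- Up to the factor `normSq x`, this is the component of `z` orthogonal to `x`; its squared norm
  -- is `normSq x` times the Cauchy–Schwarz deficit.
  have h0 := normSq_nonneg (normSq x • z + (-pair z x) • x)
  rw [normSq_add, normSq_smul, normSq_smul, pair_smul_left, pair_smul_right] at h0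
  rcases (normSq_nonneg x).eq_or_lt with hx | hx
  · have hn : ‖x‖ ^ 2 ≤ 0 := hx ▸ norm_sq_le_normSq x
    have : x = 0 := by
      rw [← norm_eq_zero]
      nlinarith [norm_nonneg x]
    subst this
    rw [pair_comm, pair_zero_left, ← hx]; simp
  · have : 0 ≤ normSq x * (normSq z * normSq x - pair z x ^ 2) := by nlinarith
    nlinarith [(mul_nonneg_iff_of_pos_left hx).1 this]

lemma pair_endUnit_succ {m : ℕ} (x : Phase (m + 1)) : pair endUnit x = x.2 (Fin.last m) := by
  simp [pair, endUnit, Fin.sum_univ_castSucc]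

lemma normSq_endUnit_le : normSq (endUnit (n := n)) ≤ 1 := by
  cases n with
  | zero => simp [normSq, pair]
  | succ m => rw [normSq, pair_endUnit_succ]; simp [endUnit]

lemma abs_pair_endUnit_le (x : Phase n) : |pair endUnit x| ≤ √(normSq x) := by
  apply Real.abs_le_sqrt
  refine (pair_sq_le _ _).trans ?_
  nlinarith [normSq_endUnit_le (n := n), normSq_nonneg x]

lemma pair_drift_self (τ : ℝ) (x : Phase n) : pair x (drift τ x) = τ * pair endUnit x := by
  rw [drift_eq, pair_add_right, pair_drift_zero_self, pair_smul_right, pair_comm x]; ring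

lemma continuous_drift : Continuous fun q : ℝ × Phase n => drift q.1 q.2 := by
  have h0 : Continuous (drift 0 : Phase n → Phase n) :=
    (LinearMap.toContinuousLinearMap
      { toFun := drift 0, map_add' := drift_zero_add, map_smul' := drift_zero_smul }).continuous
  have : (fun q : ℝ × Phase n => drift q.1 q.2) =
      fun q => drift 0 q.2 + q.1 • endUnit := funext fun q => drift_eq _ _
  rw [this]
  exact (h0.comp continuous_snd).add (continuous_fst.smul continuous_const)

/-! ### Flips -/

lemma pair_flip (z : Phase n) (i : Fin n) (x : Phase n) :
    pair z (flip i x) = pair z x - 2 * (z.2 i * x.2 i) := by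
  have h : ∀ j, z.1 j * (flip i x).1 j + z.2 j * (flip i x).2 j =
      (z.1 j * x.1 j + z.2 j * x.2 j) - if j = i then 2 * (z.2 i * x.2 i) else 0 := by
    intro j
    by_cases hj : j = i
    · subst hj; simp [flip]; ring
    · simp [flip, hj]
  simp [pair, h, Finset.sum_add_distrib]

/-- Flips are symmetric, so a flip of the configuration can be read as a flip of the argument of the
moment generating function. -/
lemma pair_flip_left (z : Phase n) (i : Fin n) (x : Phase n) :
    pair (flip i z) x = pair z (flip i x) := by
  rw [pair_comm, pair_flip, pair_flip, pair_comm x]; ring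

lemma normSq_flip (i : Fin n) (x : Phase n) : normSq (flip i x) = normSq x := by
  rw [normSq, pair_flip_left, pair_flip, pair_flip]
  simp only [flip, Function.update_self, normSq]
  ring

lemma continuous_flip (i : Fin n) : Continuous (flip i : Phase n → Phase n) := by
  unfold flip
  fun_prop

/-! ### The generator -/

lemma generator_eq (γ τ : ℝ) (f : Phase n → ℝ) (x : Phase n) :
    generator n γ τ f x = (n : ℝ) ^ 2 * fderiv ℝ f x (drift τ x)
      + (n : ℝ) ^ 2 * γ * ∑ i : Fin n, (f (flip i x) - f x) := by
  rw [generator, liouville_eq, flipOp]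

lemma continuous_generator (γ : ℝ) {f : Phase n → ℝ} (hf : ContDiff ℝ 1 f) :
    Continuous fun q : ℝ × Phase n => generator n γ q.1 f q.2 := by
  simp only [generator_eq]
  have h1 : Continuous fun q : ℝ × Phase n => fderiv ℝ f q.2 (drift q.1 q.2) :=
    ((hf.continuous_fderiv one_ne_zero).comp continuous_snd).clm_apply continuous_drift
  have h2 : ∀ i : Fin n, Continuous fun q : ℝ × Phase n => f (flip i q.2) - f q.2 := fun i =>
    (hf.continuous.comp ((continuous_flip i).comp continuous_snd)).sub
      (hf.continuous.comp continuous_snd)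
  exact (continuous_const.mul h1).add (continuous_const.mul
    (continuous_finsetSum _ fun i _ => h2 i))

/-- On products with a flip invariant factor the generator acts as a derivation. -/
lemma generator_mul_of_flip_invariant (γ τ : ℝ) {f g : Phase n → ℝ} {x : Phase n}
    (hf : DifferentiableAt ℝ f x) (hg : DifferentiableAt ℝ g x)
    (hflip : ∀ i, g (flip i x) = g x) :
    generator n γ τ (fun y => f y * g y) x =
      g x * generator n γ τ f x + (n : ℝ) ^ 2 * f x * fderiv ℝ g x (drift τ x) := by
  have h : fderiv ℝ (fun y => f y * g y) x = f x • fderiv ℝ g x + g x • fderiv ℝ f x :=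
    fderiv_fun_mul hf hg
  simp only [generator_eq, h, hflip, ← sub_mul, ← Finset.sum_mul]
  simp only [_root_.add_apply, _root_.smul_apply, smul_eq_mul]
  ring

/-! ### A radial cutoff -/

lemma hasDerivAt_sq_max_zero (y : ℝ) :
    HasDerivAt (fun y : ℝ => max 0 y ^ 2) (2 * max 0 y) y := by
  rcases lt_trichotomy y 0 with h | h | h
  · rw [max_eq_left h.le, mul_zero]
    refine (hasDerivAt_const y (0 : ℝ)).congr_of_eventuallyEq ?_
    filter_upwards [Iio_mem_nhds h] with z hz
    rw [max_eq_left (le_of_lt hz)]; norm_num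
  · subst h
    rw [max_self, mul_zero, hasDerivAt_iff_isLittleO_nhds_zero]
    refine Asymptotics.IsBigO.trans_isLittleO (g := fun h : ℝ => h ^ 2) ?_ ?_
    · refine Asymptotics.IsBigO.of_bound 1 (Eventually.of_forall fun z => ?_)
      rcases le_total z 0 with hz | hz
      · simp [hz]; positivity
      · simp [hz]
    · simpa using Asymptotics.isLittleO_pow_id (𝕜 := ℝ) (one_lt_two)
  · rw [max_eq_right h.le]
    refine HasDerivAt.congr_of_eventuallyEq (f := fun z : ℝ => z ^ 2) ?_ ?_
    · simpa using hasDerivAt_pow 2 y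
    · filter_upwards [Ioi_mem_nhds h] with z hz
      rw [max_eq_right (le_of_lt hz)]

/-- The martingale problem only needs `C¹` test functions, so the square of the positive part is
smooth enough for a cutoff. -/
lemma contDiff_sq_max_zero : ContDiff ℝ 1 (fun y : ℝ => max 0 y ^ 2) := by
  rw [contDiff_one_iff_deriv]
  refine ⟨fun y => (hasDerivAt_sq_max_zero y).differentiableAt, ?_⟩
  rw [funext fun y => (hasDerivAt_sq_max_zero y).deriv]
  fun_prop

/-- A continuously differentiable cutoff at Euclidean radius `√R`. -/
def cutoff (R : ℝ) (x : Phase n) : ℝ := max 0 (1 - normSq x / R) ^ 2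

lemma contDiff_cutoff (R : ℝ) : ContDiff ℝ 1 (cutoff R : Phase n → ℝ) :=
  contDiff_sq_max_zero.comp (contDiff_const.sub (contDiff_normSq.div_const R))

lemma cutoff_nonneg (R : ℝ) (x : Phase n) : 0 ≤ cutoff R x := sq_nonneg _

lemma cutoff_le_one {R : ℝ} (hR : 0 < R) (x : Phase n) : cutoff R x ≤ 1 := by
  have h1 : 0 ≤ normSq x / R := div_nonneg (normSq_nonneg x) hR.le
  have h2 : max 0 (1 - normSq x / R) ≤ 1 := max_le zero_le_one (by linarith)
  exact pow_le_one₀ (le_max_left _ _) h2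

lemma hasCompactSupport_cutoff {R : ℝ} (hR : 0 < R) :
    HasCompactSupport (cutoff R : Phase n → ℝ) := by
  refine HasCompactSupport.intro (isCompact_closedBall (0 : Phase n) √R) fun x hx => ?_
  have hx' : √R < ‖x‖ := by simpa using hx
  have h1 : R < normSq x := by
    refine lt_of_lt_of_le ?_ (norm_sq_le_normSq x)
    exact (Real.sqrt_lt' (lt_of_le_of_lt (Real.sqrt_nonneg _) hx')).1 hx'
  have h2 : 1 - normSq x / R ≤ 0 := by
    rw [sub_nonpos, le_div_iff₀ hR]; linarith
  simp [cutoff, max_eq_left h2]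

lemma cutoff_flip (R : ℝ) (i : Fin n) (x : Phase n) : cutoff R (flip i x) = cutoff R x := by
  simp [cutoff, normSq_flip]

lemma fderiv_cutoff (R : ℝ) (x v : Phase n) :
    fderiv ℝ (cutoff R) x v = -(4 * max 0 (1 - normSq x / R) * (pair x v / R)) := by
  have h1 : HasFDerivAt (fun x : Phase n => 1 - normSq x / R)
      (-(R⁻¹ • ((2 : ℝ) • pairL x))) x := by
    have := ((hasFDerivAt_normSq x).mul_const R⁻¹).const_sub 1
    simpa [div_eq_mul_inv] using this
  have h2 := (hasDerivAt_sq_max_zero (1 - normSq x / R)).comp_hasFDerivAt x h1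
  rw [HasFDerivAt.fderiv (f := cutoff R) h2]
  simp
  ring

/-- The antisymmetric part of the drift is tangent to spheres, so only the applied tension crosses
them. Within radius `√R` the radial gradient is at most of order `√R / R`, and the linear growth of
the full drift never enters. The bound vanishes as `R → ∞`. -/
lemma abs_fderiv_cutoff_drift_le {R : ℝ} (hR : 0 < R) (τ : ℝ) (x : Phase n) :
    |fderiv ℝ (cutoff R) x (drift τ x)| ≤ 4 * |τ| / √R := by
  rw [fderiv_cutoff, pair_drift_self]
  by_cases hS : R ≤ normSq x
  · have h2 : 1 - normSq x / R ≤ 0 := by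
      rw [sub_nonpos, le_div_iff₀ hR]; linarith
    rw [max_eq_left h2]
    simp; positivity
  · push Not at hS
    have h1 : 0 ≤ normSq x / R := div_nonneg (normSq_nonneg x) hR.le
    have h2 : max 0 (1 - normSq x / R) ≤ 1 := max_le zero_le_one (by linarith)
    have h3 : |pair endUnit x| ≤ √R :=
      (abs_pair_endUnit_le x).trans (Real.sqrt_le_sqrt hS.le)
    have h4 : √R / R = 1 / √R := by
      rw [Real.sqrt_div_self']
    rw [abs_neg, abs_mul, abs_mul, abs_div, abs_mul, abs_of_pos hR,
      abs_of_nonneg (le_max_left 0 (1 - normSq x / R)), abs_of_pos (by norm_num : (0 : ℝ) < 4)]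
    calc 4 * max 0 (1 - normSq x / R) * (|τ| * |pair endUnit x| / R)
        ≤ 4 * 1 * (|τ| * √R / R) := by gcongr
      _ = 4 * |τ| * (√R / R) := by ring
      _ = 4 * |τ| / √R := by rw [h4]; ring

lemma tendsto_cutoff (x : Phase n) :
    Tendsto (fun m : ℕ => cutoff ((m : ℝ) + 1) x) atTop (𝓝 1) := by
  have h : Tendsto (fun m : ℕ => normSq x / ((m : ℝ) + 1)) atTop (𝓝 0) :=
    tendsto_const_nhds.div_atTop
      (tendsto_atTop_add_const_right _ _ tendsto_natCast_atTop_atTop)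
  have h2 : Continuous fun u : ℝ => max 0 (1 - u) ^ 2 := by fun_prop
  have h3 := (h2.tendsto 0).comp h
  norm_num at h3
  exact h3

/-! ### Families of laws that satisfy Dynkin's formula -/

/-- The laws `μ s`, `s ≥ 0`, of a process that satisfies Dynkin's formula for the generator
`n² A_n^{τ s} + n² γ S_n` on continuously differentiable functions with compact support. -/
structure IsLawFlow (n : ℕ) (γ : ℝ) (τ : ℝ → ℝ) (μ : ℝ → Measure (Phase n)) : Prop where
  prob : ∀ s, IsProbabilityMeasure (μ s)
  measurable : Measurable μ
  dynkin : ∀ f : Phase n → ℝ, ContDiff ℝ 1 f → HasCompactSupport f → ∀ t : ℝ, 0 ≤ t →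
    ∫ x, f x ∂μ t = ∫ x, f x ∂μ 0 + ∫ s in (0 : ℝ)..t, ∫ x, generator n γ (τ s) f x ∂μ s

variable {γ : ℝ} {τ : ℝ → ℝ} {μ : ℝ → Measure (Phase n)}

lemma IsLawFlow.stronglyMeasurable_integral (h : IsLawFlow n γ τ μ) {g : ℝ × Phase n → ℝ}
    (hg : StronglyMeasurable g) : StronglyMeasurable fun s => ∫ x, g (s, x) ∂μ s := by
  let κ : Kernel ℝ (Phase n) := ⟨μ, h.measurable⟩
  have : IsMarkovKernel κ := ⟨h.prob⟩
  exact MeasureTheory.StronglyMeasurable.integral_kernel_prod_right' (κ := κ) hg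

/-- Dynkin's formula for functions dominated by a uniformly integrable weight. -/
theorem IsLawFlow.dynkin_of_dominated (h : IsLawFlow n γ τ μ) (hτ : Continuous τ)
    {f W : Phase n → ℝ} (hf : ContDiff ℝ 1 f) {t C : ℝ} (ht : 0 ≤ t)
    (hWint : ∀ s ∈ Set.Icc 0 t, Integrable W (μ s))
    (hWC : ∀ s ∈ Set.Icc 0 t, ∫ x, W x ∂μ s ≤ C) (hfW : ∀ x, |f x| ≤ W x)
    (hgW : ∀ s ∈ Set.Icc 0 t, ∀ x, |generator n γ (τ s) f x| ≤ W x) :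
    ∫ x, f x ∂μ t = ∫ x, f x ∂μ 0 + ∫ s in (0 : ℝ)..t, ∫ x, generator n γ (τ s) f x ∂μ s := by
  have hR : ∀ m : ℕ, (0 : ℝ) < (m : ℝ) + 1 := fun m => by positivity
  have hW0 : ∀ x, 0 ≤ W x := fun x => (abs_nonneg _).trans (hfW x)
  obtain ⟨K, hK⟩ : ∃ K, ∀ s ∈ Set.Icc 0 t, |τ s| ≤ K :=
    isCompact_Icc.exists_bound_of_continuousOn hτ.continuousOn
  have hK0 : 0 ≤ K := (abs_nonneg _).trans (hK 0 ⟨le_rfl, ht⟩)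
  -- The cutoff is flip invariant, so the generator of the product is the truncated generator plus
  -- one error term carrying the derivative of the cutoff along the drift.
  set F : ℕ → Phase n → ℝ := fun m y => f y * cutoff ((m : ℝ) + 1) y with hF
  have hFc : ∀ m, ContDiff ℝ 1 (F m) := fun m => hf.mul (contDiff_cutoff _)
  have hgen : ∀ m s x, generator n γ (τ s) (F m) x =
      cutoff ((m : ℝ) + 1) x * generator n γ (τ s) f x
        + (n : ℝ) ^ 2 * f x * fderiv ℝ (cutoff ((m : ℝ) + 1)) x (drift (τ s) x) := fun m s x =>
    generator_mul_of_flip_invariant γ (τ s) (hf.differentiable one_ne_zero x)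
      ((contDiff_cutoff _).differentiable one_ne_zero x) fun i => cutoff_flip _ i x
  have hdyn : ∀ m : ℕ, ∫ x, F m x ∂μ t = ∫ x, F m x ∂μ 0
      + ∫ s in (0 : ℝ)..t, ∫ x, generator n γ (τ s) (F m) x ∂μ s := fun m =>
    h.dynkin _ (hFc m) ((hasCompactSupport_cutoff (hR m)).mul_left) t ht
  have hFle : ∀ m x, |F m x| ≤ W x := fun m x => by
    rw [hF, abs_mul, abs_of_nonneg (cutoff_nonneg _ _)]
    exact (mul_le_of_le_one_right (abs_nonneg _) (cutoff_le_one (hR m) x)).trans (hfW x)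
  have hsqrt : ∀ m : ℕ, 1 ≤ √((m : ℝ) + 1) := fun m => by
    rw [Real.one_le_sqrt]; linarith [(Nat.cast_nonneg m : (0 : ℝ) ≤ m)]
  have hder : ∀ m : ℕ, ∀ s ∈ Set.Icc 0 t, ∀ x : Phase n,
      |fderiv ℝ (cutoff ((m : ℝ) + 1)) x (drift (τ s) x)| ≤ 4 * K / √((m : ℝ) + 1) :=
    fun m s hs x => (abs_fderiv_cutoff_drift_le (hR m) _ x).trans (by
      gcongr; exact hK s hs)
  -- The `1` accounts for the truncated generator and `n² · 4K` for the cutoff error, using `√(m +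
  -- 1) ≥ 1`; the domination is thus uniform in `m`.
  set K' : ℝ := 1 + (n : ℝ) ^ 2 * (4 * K) with hK'
  have hgle : ∀ m : ℕ, ∀ s ∈ Set.Icc 0 t, ∀ x, |generator n γ (τ s) (F m) x| ≤ K' * W x := by
    intro m s hs x
    rw [hgen]
    have h1 : |cutoff ((m : ℝ) + 1) x * generator n γ (τ s) f x| ≤ W x := by
      rw [abs_mul, abs_of_nonneg (cutoff_nonneg _ _)]
      exact (mul_le_of_le_one_left (abs_nonneg _) (cutoff_le_one (hR m) x)).trans (hgW s hs x)
    have h2 : |(n : ℝ) ^ 2 * f x * fderiv ℝ (cutoff ((m : ℝ) + 1)) x (drift (τ s) x)|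
        ≤ (n : ℝ) ^ 2 * W x * (4 * K) := by
      rw [abs_mul, abs_mul, abs_of_nonneg (by positivity : (0 : ℝ) ≤ (n : ℝ) ^ 2)]
      have h3 : 4 * K / √((m : ℝ) + 1) ≤ 4 * K := div_le_self (by positivity) (hsqrt m)
      gcongr
      · exact mul_nonneg (by positivity) (hW0 x)
      · exact hfW x
      · exact (hder m s hs x).trans h3
    calc _ ≤ _ := abs_add_le _ _
      _ ≤ W x + (n : ℝ) ^ 2 * W x * (4 * K) := add_le_add h1 h2
      _ = K' * W x := by rw [hK']; ring
  have hFlim : ∀ s ∈ Set.Icc 0 t,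
      Tendsto (fun m => ∫ x, F m x ∂μ s) atTop (𝓝 (∫ x, f x ∂μ s)) := by
    intro s hs
    refine tendsto_integral_of_dominated_convergence W
      (fun m => (hFc m).continuous.aestronglyMeasurable) (hWint s hs)
      (fun m => Eventually.of_forall (hFle m)) (Eventually.of_forall fun x => ?_)
    simpa using (tendsto_cutoff x).const_mul (f x)
  have hglim : ∀ s ∈ Set.Icc 0 t, Tendsto (fun m => ∫ x, generator n γ (τ s) (F m) x ∂μ s) atTop
      (𝓝 (∫ x, generator n γ (τ s) f x ∂μ s)) := by
    intro s hs
    refine tendsto_integral_of_dominated_convergence (fun x => K' * W x)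
      (fun m => ((continuous_generator γ (hFc m)).comp
        (Continuous.prodMk continuous_const continuous_id)).aestronglyMeasurable)
      ((hWint s hs).const_mul K') (fun m => Eventually.of_forall (hgle m s hs))
      (Eventually.of_forall fun x => ?_)
    simp only [hgen]
    have h1 : Tendsto (fun m : ℕ => fderiv ℝ (cutoff ((m : ℝ) + 1)) x (drift (τ s) x)) atTop
        (𝓝 0) := by
      refine squeeze_zero_norm (fun m => hder m s hs x) ?_
      refine tendsto_const_nhds.div_atTop (Real.tendsto_sqrt_atTop.comp ?_)
      exact tendsto_atTop_add_const_right _ _ tendsto_natCast_atTop_atTop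
    simpa using ((tendsto_cutoff x).mul_const (generator n γ (τ s) f x)).add
      (h1.const_mul ((n : ℝ) ^ 2 * f x))
  have hlim : Tendsto (fun m => ∫ s in (0 : ℝ)..t, ∫ x, generator n γ (τ s) (F m) x ∂μ s) atTop
      (𝓝 (∫ s in (0 : ℝ)..t, ∫ x, generator n γ (τ s) f x ∂μ s)) := by
    refine intervalIntegral.tendsto_integral_filter_of_dominated_convergence
      (fun _ => K' * C) (Eventually.of_forall fun m => ?_) (Eventually.of_forall fun m => ?_)
      (by simp) ?_
    · refine (h.stronglyMeasurable_integral
        (g := fun q => generator n γ (τ q.1) (F m) q.2) ?_).aestronglyMeasurable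
      exact ((continuous_generator γ (hFc m)).comp
        ((hτ.comp continuous_fst).prodMk continuous_snd)).stronglyMeasurable
    · refine Eventually.of_forall fun s hs => ?_
      rw [Set.uIoc_of_le ht] at hs
      have hs' : s ∈ Set.Icc 0 t := ⟨hs.1.le, hs.2⟩
      calc ‖∫ x, generator n γ (τ s) (F m) x ∂μ s‖ ≤ ∫ x, K' * W x ∂μ s :=
            norm_integral_le_of_norm_le ((hWint s hs').const_mul K')
              (Eventually.of_forall (hgle m s hs'))
        _ = K' * ∫ x, W x ∂μ s := integral_const_mul _ _
        _ ≤ K' * C := by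
          have := hWC s hs'
          gcongr
    · refine Eventually.of_forall fun s hs => ?_
      rw [Set.uIoc_of_le ht] at hs
      exact hglim s ⟨hs.1.le, hs.2⟩
  refine tendsto_nhds_unique (hFlim t ⟨ht, le_rfl⟩) ?_
  simp only [hdyn]
  exact (hFlim 0 ⟨le_rfl, ht⟩).add hlim

/-! ### An integral form of Gronwall's inequality -/

lemma continuousOn_of_eq_integral {y g : ℝ → ℝ} {T : ℝ} (hT : 0 ≤ T)
    (hg : IntervalIntegrable g volume 0 T)
    (hy : ∀ t ∈ Set.Icc 0 T, y t = y 0 + ∫ s in (0 : ℝ)..t, g s) :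
    ContinuousOn y (Set.Icc 0 T) := by
  have h1 : ContinuousOn (fun t => y 0 + ∫ s in (0 : ℝ)..t, g s) (Set.Icc 0 T) := by
    refine continuousOn_const.add ?_
    have := intervalIntegral.continuousOn_primitive_interval (μ := volume) (f := g) (a := 0)
      (b := T) ?_
    · rwa [Set.uIcc_of_le hT] at this
    · rw [Set.uIcc_of_le hT, integrableOn_Icc_iff_integrableOn_Ioc]
      exact (intervalIntegrable_iff_integrableOn_Ioc_of_le hT).1 hg
  exact h1.congr hy

lemma hasDerivAt_integral_of_continuousOn_Icc {y : ℝ → ℝ} {T t : ℝ}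
    (hy : ContinuousOn y (Set.Icc 0 T)) (ht : t ∈ Set.Ioo 0 T) :
    HasDerivAt (fun u => ∫ s in (0 : ℝ)..u, y s) (y t) t := by
  have hsub : Set.uIcc 0 t ⊆ Set.Icc 0 T := by
    rw [Set.uIcc_of_le ht.1.le]; exact Set.Icc_subset_Icc le_rfl ht.2.le
  refine intervalIntegral.integral_hasDerivAt_right (hy.mono hsub).intervalIntegrable ?_
    (hy.continuousAt (Icc_mem_nhds ht.1 ht.2))
  exact ContinuousOn.stronglyMeasurableAtFilter isOpen_Ioo
    (hy.mono Set.Ioo_subset_Icc_self) t ht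

/-- The integrand `g` is merely integrable, so `y` need not be differentiable. The argument runs on
the majorant `y 0 + κ ∫ y`, which is differentiable in the interior because `y` is continuous. -/
lemma le_exp_of_eq_integral {y g : ℝ → ℝ} {κ T : ℝ} (hT : 0 ≤ T) (hκ : 0 ≤ κ)
    (hg : IntervalIntegrable g volume 0 T)
    (hy : ∀ t ∈ Set.Icc 0 T, y t = y 0 + ∫ s in (0 : ℝ)..t, g s)
    (hgy : ∀ s ∈ Set.Icc 0 T, |g s| ≤ κ * y s) :
    ∀ t ∈ Set.Icc 0 T, y t ≤ y 0 * Real.exp (κ * t) := by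
  have hc := continuousOn_of_eq_integral hT hg hy
  have hyint : IntervalIntegrable y volume 0 T :=
    ContinuousOn.intervalIntegrable (by rwa [Set.uIcc_of_le hT])
  set G : ℝ → ℝ := fun t => y 0 + κ * ∫ s in (0 : ℝ)..t, y s with hG
  have hyG : ∀ t ∈ Set.Icc 0 T, y t ≤ G t := by
    intro t ht
    have hsub : Set.uIcc 0 t ⊆ Set.uIcc 0 T := by
      rw [Set.uIcc_of_le ht.1, Set.uIcc_of_le hT]; exact Set.Icc_subset_Icc le_rfl ht.2
    simp only [hy t ht, hG, ← intervalIntegral.integral_const_mul]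
    refine add_le_add le_rfl ?_
    refine intervalIntegral.integral_mono_on ht.1 (hg.mono_set hsub)
      ((hyint.mono_set hsub).const_mul κ) fun s hs => ?_
    exact (le_abs_self _).trans (hgy s ⟨hs.1, hs.2.trans ht.2⟩)
  have hGc : ContinuousOn G (Set.Icc 0 T) := by
    refine continuousOn_const.add (continuousOn_const.mul ?_)
    have := intervalIntegral.continuousOn_primitive_interval (μ := volume) (f := y) (a := 0)
      (b := T) (by rw [Set.uIcc_of_le hT]; exact hc.integrableOn_Icc)
    rwa [Set.uIcc_of_le hT] at this
  have hGd : ∀ t ∈ Set.Ioo 0 T, HasDerivAt G (κ * y t) t := fun t ht =>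
    ((hasDerivAt_integral_of_continuousOn_Icc hc ht).const_mul κ).const_add (y 0)
  have hE : ∀ t, HasDerivAt (fun t => Real.exp (-(κ * t))) (Real.exp (-(κ * t)) * (-κ)) t := by
    intro t
    have := (((hasDerivAt_id t).const_mul κ).neg).exp
    simpa using this
  have hanti : AntitoneOn (fun t => G t * Real.exp (-(κ * t))) (Set.Icc 0 T) := by
    refine antitoneOn_of_hasDerivWithinAt_nonpos (convex_Icc 0 T)
      (hGc.mul (by fun_prop)) (fun t ht => ?_) (f' := fun t => κ * y t * Real.exp (-(κ * t))
        + G t * (Real.exp (-(κ * t)) * (-κ))) (fun t ht => ?_)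
    · rw [interior_Icc] at ht
      exact ((hGd t ht).mul (hE t)).hasDerivWithinAt
    · rw [interior_Icc] at ht
      have h1 := hyG t ⟨ht.1.le, ht.2.le⟩
      have h2 : κ * y t * Real.exp (-(κ * t)) + G t * (Real.exp (-(κ * t)) * (-κ)) =
          -(κ * Real.exp (-(κ * t)) * (G t - y t)) := by ring
      rw [h2, neg_nonpos]
      exact mul_nonneg (mul_nonneg hκ (Real.exp_pos _).le) (by linarith)
  intro t ht
  have h1 := hanti ⟨le_rfl, hT⟩ ht ht.1
  simp only [hG, intervalIntegral.integral_same, mul_zero, add_zero, neg_zero, Real.exp_zero,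
    mul_one] at h1
  calc y t ≤ G t := hyG t ht
    _ = G t * Real.exp (-(κ * t)) * Real.exp (κ * t) := by
      rw [mul_assoc, ← Real.exp_add]; simp
    _ ≤ y 0 * Real.exp (κ * t) := by gcongr

/-! ### Exponential weights -/

/-- The Japanese bracket `√(1 + |x|²)`. -/
def bracket (x : Phase n) : ℝ := √(1 + normSq x)

lemma one_le_bracket (x : Phase n) : 1 ≤ bracket x := by
  rw [bracket, Real.one_le_sqrt]; linarith [normSq_nonneg x]

lemma bracket_pos (x : Phase n) : 0 < bracket x := one_pos.trans_le (one_le_bracket x)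

lemma sqrt_normSq_le_bracket (x : Phase n) : √(normSq x) ≤ bracket x :=
  Real.sqrt_le_sqrt (by linarith)

lemma norm_le_bracket (x : Phase n) : ‖x‖ ≤ bracket x :=
  (Real.le_sqrt (norm_nonneg _) (normSq_nonneg _) |>.2 (norm_sq_le_normSq x)).trans
    (sqrt_normSq_le_bracket x)

lemma bracket_flip (i : Fin n) (x : Phase n) : bracket (flip i x) = bracket x := by
  simp [bracket, normSq_flip]

lemma abs_pair_le (z x : Phase n) : |pair z x| ≤ √(normSq z) * √(normSq x) := by
  rw [← Real.sqrt_mul (normSq_nonneg z)]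
  exact Real.abs_le_sqrt (pair_sq_le z x)

lemma abs_pair_le_bracket (z x : Phase n) : |pair z x| ≤ √(normSq z) * bracket x :=
  (abs_pair_le z x).trans (by gcongr; exact sqrt_normSq_le_bracket x)

lemma contDiff_bracket {m : WithTop ℕ∞} : ContDiff ℝ m (bracket : Phase n → ℝ) :=
  (contDiff_const.add contDiff_normSq).sqrt fun x => by linarith [normSq_nonneg x]

lemma hasFDerivAt_bracket (x : Phase n) :
    HasFDerivAt (bracket : Phase n → ℝ) ((bracket x)⁻¹ • pairL x) x := by
  have h := ((hasFDerivAt_normSq x).const_add 1).sqrt (by linarith [normSq_nonneg x])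
  refine h.congr_fderiv ?_
  ext v <;> simp [bracket] <;> ring

/-- The exponential weight `exp (c √(1 + |x|²))`. -/
def weight (c : ℝ) (x : Phase n) : ℝ := Real.exp (c * bracket x)

lemma weight_pos (c : ℝ) (x : Phase n) : 0 < weight c x := Real.exp_pos _

lemma continuous_weight (c : ℝ) : Continuous (weight c : Phase n → ℝ) :=
  Real.continuous_exp.comp (continuous_const.mul (contDiff_bracket (m := 0)).continuous)

lemma weight_mono {c d : ℝ} (h : c ≤ d) (x : Phase n) : weight c x ≤ weight d x := by
  unfold weight
  have := (bracket_pos x).le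
  gcongr

lemma weight_mul (c d : ℝ) (x : Phase n) : weight c x * weight d x = weight (c + d) x := by
  rw [weight, weight, weight, ← Real.exp_add, add_mul]

lemma weight_mul_bracket_le (c : ℝ) (x : Phase n) : weight c x * bracket x ≤ weight (c + 1) x := by
  rw [← weight_mul]
  have h : bracket x ≤ weight 1 x := by
    rw [weight, one_mul]; linarith [Real.add_one_le_exp (bracket x)]
  have := (weight_pos c x).le
  gcongr

lemma one_le_weight {c : ℝ} (hc : 0 ≤ c) (x : Phase n) : 1 ≤ weight c x :=
  Real.one_le_exp (mul_nonneg hc (bracket_pos x).le)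

/-- A bounded regularization of the exponential weight. -/
def tamedWeight (c ε : ℝ) (x : Phase n) : ℝ := (ε + Real.exp (-(c * bracket x)))⁻¹

lemma tamedWeight_pos (c : ℝ) {ε : ℝ} (hε : 0 < ε) (x : Phase n) : 0 < tamedWeight c ε x := by
  unfold tamedWeight; positivity

lemma tamedWeight_le_inv (c : ℝ) {ε : ℝ} (hε : 0 < ε) (x : Phase n) :
    tamedWeight c ε x ≤ ε⁻¹ := by
  unfold tamedWeight
  gcongr
  linarith [Real.exp_pos (-(c * bracket x))]

lemma tamedWeight_le_weight (c : ℝ) {ε : ℝ} (hε : 0 < ε) (x : Phase n) :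
    tamedWeight c ε x ≤ weight c x := by
  unfold tamedWeight weight
  calc (ε + Real.exp (-(c * bracket x)))⁻¹ ≤ (Real.exp (-(c * bracket x)))⁻¹ := by
        gcongr; linarith
    _ = _ := by rw [Real.exp_neg, inv_inv]

lemma contDiff_tamedWeight (c : ℝ) {ε : ℝ} (hε : 0 < ε) :
    ContDiff ℝ 1 (tamedWeight c ε : Phase n → ℝ) := by
  refine ContDiff.inv (contDiff_const.add (contDiff_const.mul contDiff_bracket).neg.exp)
    fun x => ?_
  positivity

/-- The function is radial, so flips do not see it and the drift acts only through the tension, with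
`|⟨endUnit, x⟩| ≤ bracket x`. The taming is chosen so that its logarithmic derivative in `bracket x`
is `c` times a factor at most `1`: the growth rate is that of the untamed weight, for every `ε`. -/
lemma abs_generator_tamedWeight_le (γ τ : ℝ) {c ε : ℝ} (hc : 0 ≤ c) (hε : 0 < ε) (x : Phase n) :
    |generator n γ τ (tamedWeight c ε) x| ≤ (n : ℝ) ^ 2 * c * |τ| * tamedWeight c ε x := by
  set E := Real.exp (-(c * bracket x)) with hE
  have hEpos : 0 < E := Real.exp_pos _
  have hflip : ∀ i : Fin n, tamedWeight c ε (flip i x) = tamedWeight c ε x := fun i => by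
    simp [tamedWeight, bracket_flip]
  have hd : fderiv ℝ (tamedWeight c ε) x (drift τ x) =
      tamedWeight c ε x * (c * (tamedWeight c ε x * E) * (τ * (pair endUnit x / bracket x))) := by
    have h1 : HasFDerivAt (fun x : Phase n => ε + Real.exp (-(c * bracket x)))
        (E • -(c • ((bracket x)⁻¹ • pairL x))) x :=
      (((hasFDerivAt_bracket x).const_mul c).neg.exp).const_add ε
    have h2 := (hasDerivAt_inv (ne_of_gt (by positivity : 0 < ε + E))).comp_hasFDerivAt x h1
    rw [HasFDerivAt.fderiv (f := tamedWeight c ε) h2]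
    simp only [tamedWeight, ← hE, _root_.smul_apply, _root_.neg_apply, smul_eq_mul, pairL_apply,
      pair_drift_self]
    field_simp
  rw [generator_eq, hd]
  simp only [hflip, sub_self, Finset.sum_const_zero, mul_zero, add_zero]
  have hp := (tamedWeight_pos c hε x).le
  have h3 : tamedWeight c ε x * E ≤ 1 := by
    rw [tamedWeight, ← hE, inv_mul_le_iff₀ (by positivity)]; linarith
  have h4 : |pair endUnit x / bracket x| ≤ 1 := by
    rw [abs_div, abs_of_pos (bracket_pos x), div_le_one (bracket_pos x)]
    exact (abs_pair_endUnit_le x).trans (sqrt_normSq_le_bracket x)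
  rw [abs_mul, abs_mul, abs_mul, abs_mul, abs_mul τ, abs_of_nonneg hp, abs_of_nonneg hc,
    abs_of_nonneg (mul_nonneg hp hEpos.le), abs_of_nonneg (by positivity : (0 : ℝ) ≤ (n : ℝ) ^ 2)]
  calc (n : ℝ) ^ 2 * (tamedWeight c ε x * (c * (tamedWeight c ε x * E) *
        (|τ| * |pair endUnit x / bracket x|)))
      ≤ (n : ℝ) ^ 2 * (tamedWeight c ε x * (c * 1 * (|τ| * 1))) := by gcongr
    _ = _ := by ring

/-- Exponential moments propagate, locally uniformly in time. -/
theorem IsLawFlow.exists_integral_weight_le (h : IsLawFlow n γ τ μ) (hτ : Continuous τ)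
    {c : ℝ} (hc : 0 ≤ c) (h0 : Integrable (weight c) (μ 0)) {T : ℝ} (hT : 0 ≤ T) :
    ∃ C, ∀ s ∈ Set.Icc 0 T, Integrable (weight c) (μ s) ∧ ∫ x, weight c x ∂μ s ≤ C := by
  have := h.prob
  obtain ⟨K, hK⟩ : ∃ K, ∀ s ∈ Set.Icc 0 T, |τ s| ≤ K :=
    isCompact_Icc.exists_bound_of_continuousOn hτ.continuousOn
  have hK0 : 0 ≤ K := (abs_nonneg _).trans (hK 0 ⟨le_rfl, hT⟩)
  set κ : ℝ := (n : ℝ) ^ 2 * c * K with hκ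
  have hκ0 : 0 ≤ κ := by positivity
  have hint : ∀ ε > 0, ∀ s, Integrable (tamedWeight c ε) (μ s) := fun ε hε s =>
    Integrable.of_bound (contDiff_tamedWeight c hε).continuous.aestronglyMeasurable ε⁻¹
      (Eventually.of_forall fun x => by
        rw [Real.norm_eq_abs, abs_of_pos (tamedWeight_pos c hε x)]
        exact tamedWeight_le_inv c hε x)
  have hgen : ∀ ε > 0, ∀ s ∈ Set.Icc 0 T, ∀ x,
      |generator n γ (τ s) (tamedWeight c ε) x| ≤ κ * tamedWeight c ε x := by
    intro ε hε s hs x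
    refine (abs_generator_tamedWeight_le γ (τ s) hc hε x).trans ?_
    have := (tamedWeight_pos c hε x).le
    rw [hκ]
    gcongr
    exact hK s hs
  -- For fixed `ε` everything is bounded, so Dynkin's formula applies with a constant dominating
  -- function. The resulting Gronwall bound no longer contains `ε`.
  have hbound : ∀ ε > 0, ∀ t ∈ Set.Icc 0 T, ∫ x, tamedWeight c ε x ∂μ t ≤
      (∫ x, weight c x ∂μ 0) * Real.exp (κ * T) := by
    intro ε hε t ht
    have hgs : ∀ s ∈ Set.Icc 0 T, |∫ x, generator n γ (τ s) (tamedWeight c ε) x ∂μ s| ≤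
        κ * ∫ x, tamedWeight c ε x ∂μ s := by
      intro s hs
      rw [← integral_const_mul, ← Real.norm_eq_abs]
      exact norm_integral_le_of_norm_le ((hint ε hε s).const_mul κ)
        (Eventually.of_forall (hgen ε hε s hs))
    have hle : ∀ s, ∫ x, tamedWeight c ε x ∂μ s ≤ ε⁻¹ := by
      intro s
      have := integral_mono (hint ε hε s) (integrable_const ε⁻¹) (tamedWeight_le_inv c hε)
      simpa using this
    have hy := le_exp_of_eq_integral (y := fun s => ∫ x, tamedWeight c ε x ∂μ s)
      (g := fun s => ∫ x, generator n γ (τ s) (tamedWeight c ε) x ∂μ s) hT hκ0 ?_ ?_ hgs t ht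
    · refine hy.trans ?_
      have h1 := integral_mono (hint ε hε 0) h0 (tamedWeight_le_weight c hε)
      have h2 : 0 ≤ ∫ x, weight c x ∂μ 0 := integral_nonneg fun x => (weight_pos c x).le
      have := ht.2
      gcongr
    · rw [intervalIntegrable_iff_integrableOn_Ioc_of_le hT]
      refine Measure.integrableOn_of_bounded (M := κ * ε⁻¹) (by simp) ?_ ?_
      · refine (h.stronglyMeasurable_integral
          (g := fun q => generator n γ (τ q.1) (tamedWeight c ε) q.2) ?_).aestronglyMeasurable
        exact ((continuous_generator γ (contDiff_tamedWeight c hε)).comp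
          ((hτ.comp continuous_fst).prodMk continuous_snd)).stronglyMeasurable
      · refine (ae_restrict_iff' measurableSet_Ioc).2 (Eventually.of_forall fun s hs => ?_)
        exact (hgs s ⟨hs.1.le, hs.2⟩).trans (by gcongr; exact hle s)
    · intro t ht
      refine h.dynkin_of_dominated hτ (W := fun _ => (1 + κ) * ε⁻¹) (C := (1 + κ) * ε⁻¹)
        (contDiff_tamedWeight c hε) ht.1 (fun s _ => integrable_const _) (fun s _ => by simp)
        (fun x => ?_) (fun s hs x => ?_)
      · rw [abs_of_pos (tamedWeight_pos c hε x)]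
        have := tamedWeight_le_inv c hε x
        have := mul_nonneg hκ0 (inv_pos.2 hε).le
        linarith
      · refine (hgen ε hε s ⟨hs.1, hs.2.trans ht.2⟩ x).trans ?_
        have h1 := mul_le_mul_of_nonneg_left (tamedWeight_le_inv c hε x) hκ0
        have := (inv_pos.2 hε).le
        linarith
  have hlim : ∀ x : Phase n, Tendsto (fun m : ℕ => tamedWeight c (1 / ((m : ℝ) + 1)) x) atTop
      (𝓝 (weight c x)) := by
    intro x
    have h1 : weight c x = (0 + Real.exp (-(c * bracket x)))⁻¹ := by
      rw [zero_add, Real.exp_neg, inv_inv, weight]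
    rw [h1]
    refine Tendsto.inv₀ (tendsto_one_div_add_atTop_nhds_zero_nat.add_const _) ?_
    rw [zero_add]; exact Real.exp_ne_zero _
  refine ⟨(∫ x, weight c x ∂μ 0) * Real.exp (κ * T), fun s hs => ?_⟩
  have hpos : ∀ m : ℕ, (0 : ℝ) < 1 / ((m : ℝ) + 1) := fun m => by positivity
  -- Fatou's lemma first gives integrability of the weight; the weight then serves as its own
  -- dominating function when the bound passes to the limit `ε → 0`.
  have hI : Integrable (weight c) (μ s) := by
    refine ⟨(continuous_weight c).aestronglyMeasurable, ?_⟩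
    have hle : ∫⁻ x, ‖weight c x‖ₑ ∂μ s ≤
        liminf (fun m : ℕ => ∫⁻ x, ‖tamedWeight c (1 / ((m : ℝ) + 1)) x‖ₑ ∂μ s) atTop := by
      refine le_of_eq_of_le (lintegral_congr fun x => (hlim x).enorm.liminf_eq.symm)
        (lintegral_liminf_le' fun m => ?_)
      exact (contDiff_tamedWeight c (hpos m)).continuous.enorm.measurable.aemeasurable
    refine lt_of_le_of_lt hle (Ne.lt_top ?_)
    refine ne_top_of_le_ne_top (ENNReal.ofReal_ne_top
      (r := (∫ x, weight c x ∂μ 0) * Real.exp (κ * T))) ?_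
    refine liminf_le_of_le ?_ fun b hb => ?_
    · isBoundedDefault
    · obtain ⟨m, hm⟩ := hb.exists
      refine hm.trans ?_
      simp only [← ofReal_norm]
      rw [← ofReal_integral_eq_lintegral_ofReal (hint _ (hpos m) s).norm
        (Eventually.of_forall fun x => norm_nonneg _)]
      refine ENNReal.ofReal_le_ofReal (le_of_eq_of_le ?_ (hbound _ (hpos m) s hs))
      exact integral_congr_ae (Eventually.of_forall fun x => by
        simpa using (tamedWeight_pos c (hpos m) x).le)
  refine ⟨hI, le_of_tendsto (tendsto_integral_of_dominated_convergence (weight c)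
    (fun m => (contDiff_tamedWeight c (hpos m)).continuous.aestronglyMeasurable) hI
    (fun m => Eventually.of_forall fun x => ?_) (Eventually.of_forall hlim))
    (Eventually.of_forall fun m => hbound _ (hpos m) s hs)⟩
  rw [Real.norm_eq_abs, abs_of_pos (tamedWeight_pos c (hpos m) x)]
  exact tamedWeight_le_weight c (hpos m) x

/-! ### Functions of exponential growth -/

/-- Continuously differentiable functions which, together with their derivative, grow at most
exponentially. -/
def IsTame (f : Phase n → ℝ) : Prop :=
  ContDiff ℝ 1 f ∧ ∃ K c : ℝ, 0 ≤ c ∧ ∀ x, |f x| ≤ K * weight c x ∧ ‖fderiv ℝ f x‖ ≤ K * weight c x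

namespace IsTame

lemma differentiableAt {f : Phase n → ℝ} (hf : IsTame f) (x : Phase n) : DifferentiableAt ℝ f x :=
  hf.1.differentiable one_ne_zero x

lemma continuous {f : Phase n → ℝ} (hf : IsTame f) : Continuous f := hf.1.continuous

lemma mul {f g : Phase n → ℝ} (hf : IsTame f) (hg : IsTame g) : IsTame fun x => f x * g x := by
  have hfd := hf.differentiableAt
  have hgd := hg.differentiableAt
  obtain ⟨hf, K, c, hc, hfK⟩ := hf
  obtain ⟨hg, L, d, hd, hgL⟩ := hg
  refine ⟨hf.mul hg, 2 * (K * L), c + d, by positivity, fun x => ?_⟩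
  have h0 : 2 * (K * L) * weight (c + d) x = 2 * (K * weight c x * (L * weight d x)) := by
    rw [← weight_mul]; ring
  have hK : 0 ≤ K * weight c x := (abs_nonneg _).trans (hfK x).1
  have hL : 0 ≤ L * weight d x := (abs_nonneg _).trans (hgL x).1
  have hKL := mul_nonneg hK hL
  rw [h0, fderiv_fun_mul (hfd x) (hgd x)]
  constructor
  · rw [abs_mul]
    have := mul_le_mul (hfK x).1 (hgL x).1 (abs_nonneg _) hK
    linarith
  · refine (norm_add_le _ _).trans ?_
    rw [norm_smul, norm_smul, Real.norm_eq_abs, Real.norm_eq_abs]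
    have h1 := mul_le_mul (hfK x).1 (hgL x).2 (norm_nonneg _) hK
    have h2 := mul_le_mul (hgL x).1 (hfK x).2 (norm_nonneg _) hL
    linarith

lemma pair (z : Phase n) : IsTame (pair z) := by
  refine ⟨contDiff_pair z, √(normSq z) + ‖pairL z‖, 1, zero_le_one, fun x => ?_⟩
  have h0 : bracket x ≤ weight 1 x := by
    have := weight_mul_bracket_le 0 x
    simpa [weight] using this
  have h1 := one_le_weight zero_le_one x
  have h2 := Real.sqrt_nonneg (normSq z)
  have h3 := norm_nonneg (pairL z)
  rw [(hasFDerivAt_pair z x).fderiv, add_mul]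
  constructor
  · have := abs_pair_le_bracket z x
    nlinarith [mul_le_mul_of_nonneg_left h0 h2]
  · nlinarith

lemma exp_pair (z : Phase n) : IsTame fun x => Real.exp (VelocityFlip.pair z x) := by
  refine ⟨(contDiff_pair z).exp, 1 + ‖pairL z‖, √(normSq z), Real.sqrt_nonneg _, fun x => ?_⟩
  have h1 : Real.exp (VelocityFlip.pair z x) ≤ weight √(normSq z) x :=
    Real.exp_le_exp.2 ((le_abs_self _).trans (abs_pair_le_bracket z x))
  have h2 := norm_nonneg (pairL z)
  have h3 := weight_pos √(normSq z) x
  rw [(hasFDerivAt_pair z x).exp.fderiv, norm_smul, Real.norm_eq_abs, abs_of_pos (Real.exp_pos _)]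
  constructor <;> nlinarith

end IsTame

/-- The Hamiltonian vector field without applied tension, as a continuous linear map. -/
def driftL : Phase n →L[ℝ] Phase n :=
  LinearMap.toContinuousLinearMap
    { toFun := drift 0, map_add' := drift_zero_add, map_smul' := drift_zero_smul }

lemma norm_drift_le (τ : ℝ) (x : Phase n) :
    ‖drift τ x‖ ≤ (‖(driftL : Phase n →L[ℝ] Phase n)‖ + |τ| * ‖(endUnit : Phase n)‖) * bracket x := by
  rw [drift_eq, add_mul]
  refine (norm_add_le _ _).trans (add_le_add ?_ ?_)
  · refine (driftL.le_opNorm x).trans ?_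
    gcongr
    exact norm_le_bracket x
  · rw [norm_smul, Real.norm_eq_abs]
    exact le_mul_of_one_le_right (by positivity) (one_le_bracket x)

/-- The drift grows linearly, and raising the exponent from `c` to `c + 1` absorbs the extra factor
`bracket x`. Flips leave the weight unchanged. -/
lemma IsTame.exists_generator_le {f : Phase n → ℝ} (hf : IsTame f) (γ T : ℝ) :
    ∃ K c : ℝ, 0 ≤ c ∧ (∀ x, |f x| ≤ K * weight c x) ∧
      ∀ τ : ℝ, |τ| ≤ T → ∀ x, |generator n γ τ f x| ≤ K * weight c x := by
  obtain ⟨-, K, c, hc, hfK⟩ := hf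
  have hK : 0 ≤ K := by
    have h1 := (abs_nonneg _).trans (hfK 0).1
    exact (mul_nonneg_iff_of_pos_right (weight_pos c 0)).1 h1
  set L : ℝ := ‖(driftL : Phase n →L[ℝ] Phase n)‖ + |T| * ‖(endUnit : Phase n)‖ with hL
  have hL0 : 0 ≤ L := by positivity
  set M : ℝ := (n : ℝ) ^ 2 * (K * L) + (n : ℝ) ^ 2 * |γ| * (n * (2 * K)) with hM
  have hM0 : 0 ≤ M := by positivity
  refine ⟨K + M, c + 1, by positivity, fun x => ?_, fun τ hτ x => ?_⟩
  · refine (hfK x).1.trans ?_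
    have h1 := weight_mono (by linarith : c ≤ c + 1) x
    have h2 := weight_pos (c + 1) x
    nlinarith
  · have h1 : |fderiv ℝ f x (drift τ x)| ≤ K * L * weight (c + 1) x := by
      calc |fderiv ℝ f x (drift τ x)| ≤ ‖fderiv ℝ f x‖ * ‖drift τ x‖ :=
            (fderiv ℝ f x).le_opNorm _
        _ ≤ (K * weight c x) * (L * bracket x) := by
          gcongr
          · exact mul_nonneg hK (weight_pos c x).le
          · exact (hfK x).2
          · refine (norm_drift_le τ x).trans ?_
            have := (bracket_pos x).le
            exact mul_le_mul_of_nonneg_right (add_le_add le_rfl (mul_le_mul_of_nonneg_right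
              (hτ.trans (le_abs_self T)) (norm_nonneg _))) this
        _ = K * L * (weight c x * bracket x) := by ring
        _ ≤ K * L * weight (c + 1) x := by gcongr; exact weight_mul_bracket_le c x
    have h2 : |∑ i : Fin n, (f (flip i x) - f x)| ≤ n * (2 * K) * weight (c + 1) x := by
      refine (Finset.abs_sum_le_sum_abs _ _).trans ?_
      refine (Finset.sum_le_card_nsmul _ _ (2 * K * weight (c + 1) x) fun i _ => ?_).trans ?_
      · have h3 := (hfK (flip i x)).1
        have h4 : weight c (flip i x) = weight c x := by simp [weight, bracket_flip]
        rw [h4] at h3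
        have h5 : K * weight c x ≤ K * weight (c + 1) x := by
          gcongr; exact weight_mono (by linarith) x
        have := abs_sub (f (flip i x)) (f x)
        have := (hfK x).1
        linarith
      · simp [mul_assoc]
    rw [generator_eq]
    refine (abs_add_le _ _).trans ?_
    rw [abs_mul, abs_mul, abs_mul, abs_of_nonneg (by positivity : (0 : ℝ) ≤ (n : ℝ) ^ 2)]
    have h3 := (weight_pos (c + 1) x).le
    calc _ ≤ (n : ℝ) ^ 2 * (K * L * weight (c + 1) x)
          + (n : ℝ) ^ 2 * |γ| * (n * (2 * K) * weight (c + 1) x) := by gcongr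
      _ = M * weight (c + 1) x := by rw [hM]; ring
      _ ≤ (K + M) * weight (c + 1) x := by gcongr; linarith

/-- All exponential moments of the initial law are finite. -/
def HasExpMoments (ν : Measure (Phase n)) : Prop := ∀ c : ℝ, 0 ≤ c → Integrable (weight c) ν

lemma IsTame.integrable (h : IsLawFlow n γ τ μ) (hτ : Continuous τ)
    (h0 : HasExpMoments (μ 0)) {f : Phase n → ℝ} (hf : IsTame f) {s : ℝ} (hs : 0 ≤ s) :
    Integrable f (μ s) := by
  have hcont := hf.continuous
  obtain ⟨-, K, c, hc, hfK⟩ := hf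
  obtain ⟨C, hC⟩ := h.exists_integral_weight_le hτ hc (h0 c hc) hs
  exact ((hC s ⟨hs, le_rfl⟩).1.const_mul K).mono' hcont.aestronglyMeasurable
    (Eventually.of_forall fun x => (hfK x).1)

/-- A single exponential weight dominates both the function and its generator for all tensions
attained on `[0, T]`, and its expectation is bounded there. -/
lemma IsTame.dynkin_aux (h : IsLawFlow n γ τ μ) (hτ : Continuous τ)
    (h0 : HasExpMoments (μ 0)) {f : Phase n → ℝ} (hf : IsTame f) {T : ℝ} (hT : 0 ≤ T) :
    (IntervalIntegrable (fun s => ∫ x, generator n γ (τ s) f x ∂μ s) volume 0 T) ∧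
    ∀ t ∈ Set.Icc 0 T, ∫ x, f x ∂μ t =
      ∫ x, f x ∂μ 0 + ∫ s in (0 : ℝ)..t, ∫ x, generator n γ (τ s) f x ∂μ s := by
  obtain ⟨B, hB⟩ : ∃ B, ∀ s ∈ Set.Icc 0 T, |τ s| ≤ B :=
    isCompact_Icc.exists_bound_of_continuousOn hτ.continuousOn
  obtain ⟨K, c, hc, hK, hgK⟩ := hf.exists_generator_le γ B
  obtain ⟨C, hC⟩ := h.exists_integral_weight_le hτ hc (h0 c hc) hT
  have hK0 : 0 ≤ K := by
    have h1 := (abs_nonneg _).trans (hK 0)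
    exact (mul_nonneg_iff_of_pos_right (weight_pos c 0)).1 h1
  have hWC : ∀ s ∈ Set.Icc 0 T, ∫ x, K * weight c x ∂μ s ≤ K * C := fun s hs => by
    rw [integral_const_mul]; exact mul_le_mul_of_nonneg_left (hC s hs).2 hK0
  constructor
  · rw [intervalIntegrable_iff_integrableOn_Ioc_of_le hT]
    refine Measure.integrableOn_of_bounded (M := K * C) (by simp) ?_ ?_
    · refine (h.stronglyMeasurable_integral
        (g := fun q => generator n γ (τ q.1) f q.2) ?_).aestronglyMeasurable
      exact ((continuous_generator γ hf.1).comp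
        ((hτ.comp continuous_fst).prodMk continuous_snd)).stronglyMeasurable
    · refine (ae_restrict_iff' measurableSet_Ioc).2 (Eventually.of_forall fun s hs => ?_)
      have hs' : s ∈ Set.Icc 0 T := ⟨hs.1.le, hs.2⟩
      exact (norm_integral_le_of_norm_le ((hC s hs').1.const_mul K)
        (Eventually.of_forall (hgK _ (hB s hs')))).trans (hWC s hs')
  · intro t ht
    have hsub : Set.Icc 0 t ⊆ Set.Icc 0 T := Set.Icc_subset_Icc le_rfl ht.2
    exact h.dynkin_of_dominated hτ hf.1 ht.1 (fun s hs => (hC s (hsub hs)).1.const_mul K)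
      (fun s hs => hWC s (hsub hs)) hK (fun s hs => hgK _ (hB s (hsub hs)))

lemma IsTame.continuousOn_integral (h : IsLawFlow n γ τ μ) (hτ : Continuous τ)
    (h0 : HasExpMoments (μ 0)) {f : Phase n → ℝ} (hf : IsTame f) {T : ℝ} (hT : 0 ≤ T) :
    ContinuousOn (fun s => ∫ x, f x ∂μ s) (Set.Icc 0 T) :=
  continuousOn_of_eq_integral hT (hf.dynkin_aux h hτ h0 hT).1 (hf.dynkin_aux h hτ h0 hT).2

/-- Dynkin's formula in differential form. -/
theorem IsTame.hasDerivAt_integral (h : IsLawFlow n γ τ μ) (hτ : Continuous τ)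
    (h0 : HasExpMoments (μ 0)) {f : Phase n → ℝ} (hf : IsTame f) {u : ℝ → ℝ} {T t : ℝ}
    (ht : t ∈ Set.Ioo 0 T) (hu : ContinuousOn u (Set.Icc 0 T))
    (hfu : ∀ s ∈ Set.Icc 0 T, ∫ x, generator n γ (τ s) f x ∂μ s = u s) :
    HasDerivAt (fun s => ∫ x, f x ∂μ s) (u t) t := by
  have hT : 0 ≤ T := (ht.1.trans ht.2).le
  -- The expected generator must be identified with a continuous function of time before the
  -- integral formula can be differentiated pointwise.
  have h1 := (hasDerivAt_integral_of_continuousOn_Icc hu ht).const_add (∫ x, f x ∂μ 0)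
  refine h1.congr_of_eventuallyEq ?_
  filter_upwards [Icc_mem_nhds ht.1 ht.2] with s hs
  rw [(hf.dynkin_aux h hτ h0 hT).2 s hs]
  congr 1
  refine intervalIntegral.integral_congr fun r hr => hfu r ?_
  rw [Set.uIcc_of_le hs.1] at hr
  exact ⟨hr.1, hr.2.trans hs.2⟩

/-! ### Discrete Sobolev bounds -/

/-- The squared Euclidean norm of the stretch components. -/
def normSqFst (x : Phase n) : ℝ := ∑ i, x.1 i ^ 2

lemma normSqFst_nonneg (x : Phase n) : 0 ≤ normSqFst x := Finset.sum_nonneg fun _ _ => sq_nonneg _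

lemma normSqFst_le (x : Phase n) : normSqFst x ≤ normSq x := by
  rw [normSq_eq]
  exact Finset.sum_le_sum fun i _ => by nlinarith [sq_nonneg (x.2 i)]

lemma continuous_normSqFst : Continuous (normSqFst : Phase n → ℝ) := by
  unfold normSqFst; fun_prop

lemma pair_drift (τ : ℝ) (z x : Phase n) :
    pair z (drift τ x) = -pair (drift 0 z) x + τ * pair endUnit z := by
  rw [drift_eq, pair_add_right, pair_drift_zero, pair_smul_right, pair_comm z]

lemma sum_indicator_sq_le (p : Fin n → Prop) [DecidablePred p] :
    ∑ j : Fin n, (if p j then (1 : ℝ) else 0) ^ 2 ≤ n := by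
  calc ∑ j : Fin n, (if p j then (1 : ℝ) else 0) ^ 2 ≤ ∑ _j : Fin n, (1 : ℝ) :=
        Finset.sum_le_sum fun j _ => by split_ifs <;> norm_num
    _ = n := by simp

/-- Momenta are controlled by their increments. -/
lemma sq_snd_le_normSqFst_drift (τ : ℝ) (x : Phase n) (i : Fin n) :
    x.2 i ^ 2 ≤ n * normSqFst (drift τ x) := by
  -- Pairing the drift with this indicator telescopes: `∑_{j ≤ i} (pⱼ - pⱼ₋₁) = pᵢ`, because `p₀ =
  -- 0`. Its squared norm is at most `n`, which is the factor lost.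
  set z : Phase n := (fun j => if (j : ℕ) ≤ i then 1 else 0, 0) with hz
  have hdz : drift 0 z = (0, fun j => if j = i then -1 else 0) := by
    refine Prod.ext ?_ ?_
    · funext j
      simp [drift, prevMomentum, hz]
    · funext j
      simp only [drift, rightForce, hz, Fin.ext_iff]
      have hj := j.2
      have hi := i.2
      split_ifs <;> first | omega | norm_num
  have h1 : pair z (drift τ x) = x.2 i := by
    rw [pair_drift, hdz]
    have : pair endUnit z = 0 := by simp [pair, endUnit, hz]
    rw [this]
    simp [pair]
  have h2 : pair z (drift τ x) = pair z ((drift τ x).1, 0) := by simp [pair, hz]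
  rw [← h1, h2]
  refine (pair_sq_le _ _).trans ?_
  have h3 : normSq z ≤ n := by
    rw [normSq_eq]
    simpa [hz] using sum_indicator_sq_le (fun j : Fin n => (j : ℕ) ≤ i)
  have h4 : normSq (((drift τ x).1, 0) : Phase n) = normSqFst (drift τ x) := by
    simp [normSq_eq, normSqFst]
  rw [h4]
  exact mul_le_mul_of_nonneg_right h3 (normSqFst_nonneg _)

/-- Stretches are controlled by their increments and the applied tension. -/
lemma sq_sub_fst_le_normSq_drift (τ : ℝ) (x : Phase n) (i : Fin n) :
    (τ - x.1 i) ^ 2 ≤ n * normSq (drift τ x) := by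
  -- The sum now telescopes towards the right end: `∑_{j ≥ i} (rⱼ₊₁ - rⱼ) = τ - rᵢ`, with the
  -- applied tension as last value.
  set z : Phase n := (0, fun j => if (i : ℕ) ≤ j then 1 else 0) with hz
  have hdz : drift 0 z = (fun j => if j = i then 1 else 0, 0) := by
    refine Prod.ext ?_ ?_
    · funext j
      simp only [drift, prevMomentum, hz, Fin.ext_iff]
      have hj := j.2
      have hi := i.2
      split_ifs <;> first | omega | norm_num
    · funext j
      simp [drift, rightForce, hz]
  have h0 : pair endUnit z = 1 := by
    have hi := i.2
    cases n with
    | zero => exact absurd hi (by simp)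
    | succ m =>
      rw [pair_endUnit_succ]
      simp only [hz, Fin.val_last]
      rw [if_pos (by omega)]
  have h1 : pair z (drift τ x) = τ - x.1 i := by
    rw [pair_drift, hdz, h0]
    simp [pair]
    ring
  rw [← h1]
  refine (pair_sq_le _ _).trans ?_
  have h3 : normSq z ≤ n := by
    rw [normSq_eq]
    simpa [hz] using sum_indicator_sq_le (fun j : Fin n => (i : ℕ) ≤ j)
  exact mul_le_mul_of_nonneg_right h3 (normSq_nonneg _)

lemma sq_pair_endUnit_le (τ : ℝ) (x : Phase n) :
    pair endUnit x ^ 2 ≤ n * normSqFst (drift τ x) := by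
  cases n with
  | zero => simp [pair]
  | succ m =>
    rw [pair_endUnit_succ]
    exact sq_snd_le_normSqFst_drift τ x (Fin.last m)

/-! ### The damped wave equation solved by the means -/

/-- The right-hand side of the equation for the means of the chain. -/
def meanDrift (γ τ : ℝ) (x : Phase n) : Phase n :=
  ((n : ℝ) ^ 2) • drift τ x + (-(2 * γ * (n : ℝ) ^ 2)) • ((0, x.2) : Phase n)

/-- The friction acts on momenta only, and the free drift turns it into the momentum increments.
This is why the energy of the increments is dissipated through `normSqFst` alone. -/
lemma drift_zero_zero_snd (τ : ℝ) (x : Phase n) :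
    drift 0 ((0, x.2) : Phase n) = ((drift τ x).1, 0) := by
  refine Prod.ext ?_ ?_
  · funext i; simp [drift, prevMomentum]
  · funext i; simp [drift, rightForce]

lemma hasDerivAt_normSq {w : ℝ → Phase n} {w' : Phase n} {t : ℝ} (hw : HasDerivAt w w' t) :
    HasDerivAt (fun s => normSq (w s)) (2 * pair (w t) w') t := by
  refine ((hasFDerivAt_normSq (w t)).comp_hasDerivAt t hw).congr_deriv ?_
  simp

lemma hasDerivAt_pair {w : ℝ → Phase n} {w' z : Phase n} {t : ℝ} (hw : HasDerivAt w w' t) :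
    HasDerivAt (fun s => pair z (w s)) (pair z w') t :=
  (hasFDerivAt_pair z (w t)).comp_hasDerivAt t hw

lemma hasDerivAt_drift {τ : ℝ → ℝ} {m : ℝ → Phase n} {τ' t : ℝ} {m' : Phase n}
    (hτ : HasDerivAt τ τ' t) (hm : HasDerivAt m m' t) :
    HasDerivAt (fun s => drift (τ s) (m s)) (drift 0 m' + τ' • endUnit) t := by
  have h1 : HasDerivAt (fun s => driftL (m s)) (driftL m') t :=
    (driftL (n := n)).hasFDerivAt.comp_hasDerivAt t hm
  exact (h1.add (hτ.smul_const endUnit)).congr_of_eventuallyEq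
    (Eventually.of_forall fun s => drift_eq _ _)

/-- Energy identity for the increments of the means. -/
lemma hasDerivAt_normSq_drift {γ : ℝ} {τ : ℝ → ℝ} {m : ℝ → Phase n} {τ' t : ℝ}
    (hτ : HasDerivAt τ τ' t) (hm : HasDerivAt m (meanDrift γ (τ t) (m t)) t) :
    HasDerivAt (fun s => normSq (drift (τ s) (m s)))
      (-(4 * γ * (n : ℝ) ^ 2 * normSqFst (drift (τ t) (m t)))
        + 2 * τ' * pair endUnit (drift (τ t) (m t))) t := by
  refine (hasDerivAt_normSq (hasDerivAt_drift hτ hm)).congr_deriv ?_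
  set w := drift (τ t) (m t) with hw
  have h1 : pair w ((w.1, 0) : Phase n) = normSqFst w := by
    simp [pair, normSqFst, sq]
  rw [meanDrift, drift_zero_add, drift_zero_smul, drift_zero_smul, drift_zero_zero_snd (τ t),
    ← hw, pair_add_right, pair_add_right, pair_smul_right, pair_smul_right, pair_smul_right,
    pair_drift_zero_self, h1, pair_comm w]
  ring

/-- The quantity `⟨endUnit, drift⟩`, which multiplies `τ'` in the energy identity, is up to friction
`n⁻²` times a time derivative. This permits the integration by parts in time that trades it for
`τ''`. -/
lemma hasDerivAt_pair_endUnit {γ τ : ℝ} {m : ℝ → Phase n} {t : ℝ}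
    (hm : HasDerivAt m (meanDrift γ τ (m t)) t) :
    HasDerivAt (fun s => pair endUnit (m s))
      ((n : ℝ) ^ 2 * pair endUnit (drift τ (m t))
        - 2 * γ * (n : ℝ) ^ 2 * pair endUnit (m t)) t := by
  refine (hasDerivAt_pair hm).congr_deriv ?_
  have h1 : pair endUnit ((0, (m t).2) : Phase n) = pair endUnit (m t) := by
    simp [pair, endUnit]
  rw [meanDrift, pair_add_right, pair_smul_right, pair_smul_right, h1]
  ring

/-- Bounds for the increments of solutions of the damped wave equation, uniform in `n`. -/
theorem normSq_drift_le_of_hasDerivAt {γ K : ℝ} (hγ : 0 < γ) (hn : 1 ≤ n) (hK : 1 ≤ K)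
    {τ τ₁ τ₂ : ℝ → ℝ} {m : ℝ → Phase n} {T : ℝ} (hT : 0 ≤ T)
    (hτc : ContinuousOn τ (Set.Icc 0 T)) (hτ₁c : ContinuousOn τ₁ (Set.Icc 0 T))
    (hτ₂c : ContinuousOn τ₂ (Set.Icc 0 T))
    (hτ : ∀ t ∈ Set.Ioo 0 T, HasDerivAt τ (τ₁ t) t)
    (hτ₁ : ∀ t ∈ Set.Ioo 0 T, HasDerivAt τ₁ (τ₂ t) t)
    (hmc : ContinuousOn m (Set.Icc 0 T))
    (hm : ∀ t ∈ Set.Ioo 0 T, HasDerivAt m (meanDrift γ (τ t) (m t)) t)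
    (hb : ∀ t ∈ Set.Icc 0 T, |τ₁ t| ≤ K)
    (hi1 : ∫ s in (0 : ℝ)..T, τ₁ s ^ 2 ≤ K) (hi2 : ∫ s in (0 : ℝ)..T, |τ₂ s| ≤ K)
    (hm0 : (m 0).2 = 0) (hD0 : normSq (drift (τ 0) (m 0)) ≤ K / n) :
    (∀ t ∈ Set.Icc 0 T, normSq (drift (τ t) (m t)) ≤
      2 * (Real.exp (2 * K) * (K + (2 * K ^ 2 + 1) + 2 * γ * K)) / n) ∧
    ∫ s in (0 : ℝ)..T, normSqFst (drift (τ s) (m s)) ≤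
      Real.exp (2 * K) * (K + (2 * K ^ 2 + 1) + 2 * γ * K) / (2 * γ) / n ^ 3 := by
  have hn' : (1 : ℝ) ≤ n := by exact_mod_cast hn
  have hn0 : (0 : ℝ) < n := by linarith
  set A : ℝ := K + (2 * K ^ 2 + 1) + 2 * γ * K with hA
  set B : ℝ := 2 * K ^ 2 + 1 with hB
  set D : ℝ → ℝ := fun t => normSq (drift (τ t) (m t)) with hD
  set H : ℝ → ℝ := fun t => normSqFst (drift (τ t) (m t)) with hH
  set P : ℝ → ℝ := fun t => pair endUnit (m t) with hP
  set θ : ℝ → ℝ := fun t => ∫ s in (0 : ℝ)..t, |τ₂ s| with hθ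
  -- The middle term cancels the forcing `2 τ' ⟨endUnit, drift⟩` in the derivative of `D`, leaving
  -- only terms in the last momentum `P`, which `H` controls. The constant `B / n` keeps `Y` above
  -- `D / 2 + 1 / n`.
  set Y : ℝ → ℝ := fun t => D t - 2 / (n : ℝ) ^ 2 * (P t * τ₁ t) + B / n with hY
  set J : ℝ → ℝ := fun s => 2 * γ * (n : ℝ) ^ 2 * (Real.exp (-(2 * θ s)) * H s)
    - 2 * γ / n * τ₁ s ^ 2 with hJ
  have hH0 : ∀ t, 0 ≤ H t := fun t => normSqFst_nonneg _
  have hHD : ∀ t, H t ≤ D t := fun t => normSqFst_le _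
  have hPH : ∀ t, P t ^ 2 ≤ n * H t := fun t => sq_pair_endUnit_le (τ t) (m t)
  have hwc : ContinuousOn (fun t => drift (τ t) (m t)) (Set.Icc 0 T) :=
    continuous_drift.comp_continuousOn (hτc.prodMk hmc)
  have hDc : ContinuousOn D (Set.Icc 0 T) :=
    (contDiff_normSq (m := 0)).continuous.comp_continuousOn hwc
  have hHc : ContinuousOn H (Set.Icc 0 T) := continuous_normSqFst.comp_continuousOn hwc
  have hPc : ContinuousOn P (Set.Icc 0 T) :=
    (contDiff_pair endUnit (m := 0)).continuous.comp_continuousOn hmc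
  have hprim : ∀ g : ℝ → ℝ, ContinuousOn g (Set.Icc 0 T) →
      ContinuousOn (fun t => ∫ s in (0 : ℝ)..t, g s) (Set.Icc 0 T) := by
    intro g hg
    have := intervalIntegral.continuousOn_primitive_interval (μ := volume) (f := g) (a := 0)
      (b := T) (by rw [Set.uIcc_of_le hT]; exact hg.integrableOn_Icc)
    rwa [Set.uIcc_of_le hT] at this
  have hθc : ContinuousOn θ (Set.Icc 0 T) := hprim _ hτ₂c.abs
  have hEc : ContinuousOn (fun s => Real.exp (-(2 * θ s))) (Set.Icc 0 T) :=
    (continuousOn_const.mul hθc).neg.rexp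
  have hJc : ContinuousOn J (Set.Icc 0 T) :=
    (continuousOn_const.mul (hEc.mul hHc)).sub (continuousOn_const.mul (hτ₁c.pow 2))
  have hYc : ContinuousOn Y (Set.Icc 0 T) :=
    (hDc.sub (continuousOn_const.mul (hPc.mul hτ₁c))).add continuousOn_const
  have hYD : ∀ t ∈ Set.Icc 0 T, D t / 2 + 1 / n ≤ Y t := by
    intro t ht
    have h1 : 2 / (n : ℝ) ^ 2 * (P t * τ₁ t) ≤ D t / 2 + 2 * K ^ 2 / n := by
      have h2 : P t ^ 2 / n ≤ D t := by
        rw [div_le_iff₀ hn0]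
        have := hPH t
        nlinarith [mul_le_mul_of_nonneg_left (hHD t) hn0.le]
      have h3 : τ₁ t ^ 2 ≤ K ^ 2 := sq_le_sq' (by linarith [(abs_le.1 (hb t ht)).1])
        ((le_abs_self _).trans (hb t ht))
      have h4 : 2 / (n : ℝ) ^ 2 * (P t * τ₁ t) ≤
          P t ^ 2 / n / 2 + 2 * τ₁ t ^ 2 / (n : ℝ) ^ 3 := by
        rw [← sub_nonneg]
        have : P t ^ 2 / n / 2 + 2 * τ₁ t ^ 2 / (n : ℝ) ^ 3 - 2 / (n : ℝ) ^ 2 * (P t * τ₁ t) =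
            (P t * n - 2 * τ₁ t) ^ 2 / (2 * (n : ℝ) ^ 3) := by
          field_simp; ring
        rw [this]; positivity
      have h5 : 2 * τ₁ t ^ 2 / (n : ℝ) ^ 3 ≤ 2 * K ^ 2 / n := by
        gcongr
        exact le_self_pow₀ hn' (by norm_num)
      linarith
    have h6 : B / n = 2 * K ^ 2 / n + 1 / n := by rw [hB, add_div]
    simp only [hY]
    linarith
  have hYd : ∀ t ∈ Set.Ioo 0 T, HasDerivAt Y (-(4 * γ * (n : ℝ) ^ 2 * H t)
      + 4 * γ * (P t * τ₁ t) - 2 / (n : ℝ) ^ 2 * (P t * τ₂ t)) t := by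
    intro t ht
    have h1 := hasDerivAt_normSq_drift (hτ t ht) (hm t ht)
    have h2 := (hasDerivAt_pair_endUnit (hm t ht)).mul (hτ₁ t ht)
    refine ((h1.sub (h2.const_mul (2 / (n : ℝ) ^ 2))).add_const (B / n)).congr_deriv ?_
    simp only [hH, hP]
    field_simp
    ring
  have hYd' : ∀ t ∈ Set.Ioo 0 T, -(4 * γ * (n : ℝ) ^ 2 * H t)
      + 4 * γ * (P t * τ₁ t) - 2 / (n : ℝ) ^ 2 * (P t * τ₂ t) ≤
      -(2 * γ * (n : ℝ) ^ 2 * H t) + 2 * γ / n * τ₁ t ^ 2 + 2 * |τ₂ t| * Y t := by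
    intro t ht
    -- Young's inequality with weight `n`, followed by `P² ≤ n H`: half of the dissipation `4γn²H`
    -- is spent and the other half survives.
    have h1 : 4 * γ * (P t * τ₁ t) ≤ 2 * γ * (n : ℝ) ^ 2 * H t + 2 * γ / n * τ₁ t ^ 2 := by
      have h2 : 2 * (P t * τ₁ t) ≤ n * P t ^ 2 + τ₁ t ^ 2 / n := by
        rw [← sub_nonneg]
        have : n * P t ^ 2 + τ₁ t ^ 2 / n - 2 * (P t * τ₁ t) = (n * P t - τ₁ t) ^ 2 / n := by
          field_simp; ring
        rw [this]; positivity
      have h3 : n * P t ^ 2 ≤ (n : ℝ) ^ 2 * H t := by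
        have := mul_le_mul_of_nonneg_left (hPH t) hn0.le
        nlinarith
      have h4 : 2 * γ / n * τ₁ t ^ 2 = 2 * γ * (τ₁ t ^ 2 / n) := by ring
      rw [h4]
      nlinarith
    have h5 : -(2 / (n : ℝ) ^ 2 * (P t * τ₂ t)) ≤ |τ₂ t| * (2 * Y t) := by
      -- A factor linear in `P` is bounded by `Y` itself, so that the `τ''` term enters as a
      -- Gronwall coefficient. This needs the slack `1 / n` in the lower bound for `Y`.
      have h6 : 2 / (n : ℝ) ^ 2 * |P t| ≤ 2 * Y t := by
        have h7 : 2 / (n : ℝ) ^ 2 * |P t| ≤ P t ^ 2 / n + 1 / (n : ℝ) ^ 3 := by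
          rw [← sub_nonneg, ← sq_abs (P t)]
          have : |P t| ^ 2 / n + 1 / (n : ℝ) ^ 3 - 2 / (n : ℝ) ^ 2 * |P t| =
              (|P t| * n - 1) ^ 2 / (n : ℝ) ^ 3 := by
            field_simp; ring
          rw [this]; positivity
        have h8 : P t ^ 2 / n ≤ D t := by
          rw [div_le_iff₀ hn0]
          have := hPH t
          nlinarith [mul_le_mul_of_nonneg_left (hHD t) hn0.le]
        have h9 : 1 / (n : ℝ) ^ 3 ≤ 1 / n := by
          gcongr
          exact le_self_pow₀ hn' (by norm_num)
        have h10 := hYD t ⟨ht.1.le, ht.2.le⟩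
        have h11 : (0 : ℝ) < 1 / n := by positivity
        linarith
      calc -(2 / (n : ℝ) ^ 2 * (P t * τ₂ t)) ≤ |2 / (n : ℝ) ^ 2 * (P t * τ₂ t)| := neg_le_abs _
        _ = |τ₂ t| * (2 / (n : ℝ) ^ 2 * |P t|) := by
          rw [abs_mul, abs_mul, abs_of_pos (by positivity : 0 < 2 / (n : ℝ) ^ 2)]; ring
        _ ≤ _ := by gcongr
    linarith
  -- The integrating factor `exp (-2θ)` removes the `2|τ''| Y` term. It lies between `exp (-2K)` and
  -- `1`, so no bound here deteriorates with the length of the time interval.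
  have hanti : AntitoneOn (fun t => Real.exp (-(2 * θ t)) * Y t + ∫ s in (0 : ℝ)..t, J s)
      (Set.Icc 0 T) := by
    refine antitoneOn_of_hasDerivWithinAt_nonpos (convex_Icc 0 T)
      ((hEc.mul hYc).add (hprim _ hJc)) (fun t ht => ?_)
      (f' := fun t => (Real.exp (-(2 * θ t)) * -(2 * |τ₂ t|)) * Y t + Real.exp (-(2 * θ t)) *
        (-(4 * γ * (n : ℝ) ^ 2 * H t) + 4 * γ * (P t * τ₁ t) - 2 / (n : ℝ) ^ 2 * (P t * τ₂ t))
        + J t) (fun t ht => ?_)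
    · rw [interior_Icc] at ht
      have h1 : HasDerivAt θ |τ₂ t| t := hasDerivAt_integral_of_continuousOn_Icc hτ₂c.abs ht
      exact ((((h1.const_mul 2).neg.exp).mul (hYd t ht)).add
        (hasDerivAt_integral_of_continuousOn_Icc hJc ht)).hasDerivWithinAt
    · rw [interior_Icc] at ht
      have hE := Real.exp_pos (-(2 * θ t))
      have hE1 : Real.exp (-(2 * θ t)) ≤ 1 := by
        rw [Real.exp_le_one_iff]
        have : 0 ≤ θ t := intervalIntegral.integral_nonneg ht.1.le fun s _ => abs_nonneg _
        linarith
      have h1 := mul_le_mul_of_nonneg_left (hYd' t ht) hE.le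
      have h2 : Real.exp (-(2 * θ t)) * (2 * γ / n * τ₁ t ^ 2) ≤ 2 * γ / n * τ₁ t ^ 2 :=
        mul_le_of_le_one_left (by positivity) hE1
      simp only [hJ]
      nlinarith
  -- The initial mean momenta vanish, so the correction term is absent at time zero.
  have hY0 : Y 0 ≤ (K + B) / n := by
    have hP0 : P 0 = 0 := by simp [hP, pair, endUnit, hm0]
    simp only [hY, hP0, zero_mul, mul_zero, sub_zero, add_div]
    linarith
  have hθK : ∀ t ∈ Set.Icc 0 T, θ t ≤ K := by
    intro t ht
    refine le_trans ?_ hi2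
    refine intervalIntegral.integral_mono_interval le_rfl ht.1 ht.2
      (Eventually.of_forall fun s => abs_nonneg _) ?_
    exact ContinuousOn.intervalIntegrable (by rw [Set.uIcc_of_le hT]; exact hτ₂c.abs)
  have hElow : ∀ t ∈ Set.Icc 0 T, Real.exp (-(2 * K)) ≤ Real.exp (-(2 * θ t)) := fun t ht => by
    have := hθK t ht
    gcongr
  have hmain : ∀ t ∈ Set.Icc 0 T, Real.exp (-(2 * θ t)) * Y t + 2 * γ * (n : ℝ) ^ 2 *
      (Real.exp (-(2 * K)) * ∫ s in (0 : ℝ)..t, H s) ≤ A / n := by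
    intro t ht
    have hsub : Set.uIcc 0 t ⊆ Set.Icc 0 T := by
      rw [Set.uIcc_of_le ht.1]; exact Set.Icc_subset_Icc le_rfl ht.2
    have h1 := hanti ⟨le_rfl, hT⟩ ht ht.1
    have hθ0 : θ 0 = 0 := by simp [hθ]
    simp only [intervalIntegral.integral_same, add_zero, hθ0, mul_zero, neg_zero, Real.exp_zero,
      one_mul] at h1
    have hiE : IntervalIntegrable (fun s => Real.exp (-(2 * θ s)) * H s) volume 0 t :=
      ((hEc.mul hHc).mono hsub).intervalIntegrable
    have hiT : IntervalIntegrable (fun s => τ₁ s ^ 2) volume 0 t :=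
      ((hτ₁c.pow 2).mono hsub).intervalIntegrable
    have hiH : IntervalIntegrable H volume 0 t := (hHc.mono hsub).intervalIntegrable
    have h2 : ∫ s in (0 : ℝ)..t, J s = 2 * γ * (n : ℝ) ^ 2 *
        (∫ s in (0 : ℝ)..t, Real.exp (-(2 * θ s)) * H s)
        - 2 * γ / n * ∫ s in (0 : ℝ)..t, τ₁ s ^ 2 := by
      simp only [hJ]
      rw [intervalIntegral.integral_sub (hiE.const_mul _) (hiT.const_mul _),
        intervalIntegral.integral_const_mul, intervalIntegral.integral_const_mul]
    have h3 : Real.exp (-(2 * K)) * ∫ s in (0 : ℝ)..t, H s ≤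
        ∫ s in (0 : ℝ)..t, Real.exp (-(2 * θ s)) * H s := by
      rw [← intervalIntegral.integral_const_mul]
      refine intervalIntegral.integral_mono_on ht.1 (hiH.const_mul _) hiE fun s hs => ?_
      exact mul_le_mul_of_nonneg_right (hElow s ⟨hs.1, hs.2.trans ht.2⟩) (hH0 s)
    have h4 : ∫ s in (0 : ℝ)..t, τ₁ s ^ 2 ≤ K := by
      refine le_trans (intervalIntegral.integral_mono_interval le_rfl ht.1 ht.2
        (Eventually.of_forall fun s => sq_nonneg _) ?_) hi1
      exact ContinuousOn.intervalIntegrable (by rw [Set.uIcc_of_le hT]; exact hτ₁c.pow 2)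
    have h5 : 2 * γ / n * ∫ s in (0 : ℝ)..t, τ₁ s ^ 2 ≤ 2 * γ / n * K := by gcongr
    have h6 := mul_le_mul_of_nonneg_left h3 (by positivity : 0 ≤ 2 * γ * (n : ℝ) ^ 2)
    have h7 : A / n = (K + B) / n + 2 * γ / n * K := by rw [hA, hB]; ring
    rw [h2] at h1
    linarith
  have hexp : Real.exp (2 * K) * Real.exp (-(2 * K)) = 1 := by rw [← Real.exp_add]; simp
  have hEK := Real.exp_pos (2 * K)
  constructor
  · intro t ht
    have h1 := hmain t ht
    have h2 : 0 ≤ 2 * γ * (n : ℝ) ^ 2 * (Real.exp (-(2 * K)) * ∫ s in (0 : ℝ)..t, H s) := by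
      have : 0 ≤ ∫ s in (0 : ℝ)..t, H s :=
        intervalIntegral.integral_nonneg ht.1 fun s _ => hH0 s
      positivity
    have h3 := hYD t ht
    have hD0' : 0 ≤ D t := normSq_nonneg _
    have h4 : 0 ≤ Y t := by
      have : (0 : ℝ) < 1 / n := by positivity
      linarith
    have h5 : Real.exp (-(2 * K)) * Y t ≤ A / n := by
      have := mul_le_mul_of_nonneg_right (hElow t ht) h4
      linarith
    have h6 : Y t ≤ Real.exp (2 * K) * (A / n) := by
      calc Y t = Real.exp (2 * K) * (Real.exp (-(2 * K)) * Y t) := by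
            rw [← mul_assoc, hexp, one_mul]
        _ ≤ _ := by gcongr
    have h7 : 2 * (Real.exp (2 * K) * A) / n = 2 * (Real.exp (2 * K) * (A / n)) := by ring
    have h8 : (0 : ℝ) < 1 / n := by positivity
    rw [h7]
    linarith
  · have h1 := hmain T ⟨hT, le_rfl⟩
    have h3 := hYD T ⟨hT, le_rfl⟩
    have hD0' : 0 ≤ D T := normSq_nonneg _
    have h4 : 0 ≤ Y T := by
      have : (0 : ℝ) < 1 / n := by positivity
      linarith
    have h5 := mul_nonneg (Real.exp_pos (-(2 * θ T))).le h4
    have h6 : 2 * γ * (n : ℝ) ^ 2 * (Real.exp (-(2 * K)) * ∫ s in (0 : ℝ)..T, H s) ≤ A / n := by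
      linarith
    calc ∫ s in (0 : ℝ)..T, H s = Real.exp (2 * K) / (2 * γ * (n : ℝ) ^ 2) *
          (2 * γ * (n : ℝ) ^ 2 * (Real.exp (-(2 * K)) * ∫ s in (0 : ℝ)..T, H s)) := by
          field_simp
          rw [mul_assoc, hexp, mul_one]
      _ ≤ Real.exp (2 * K) / (2 * γ * (n : ℝ) ^ 2) * (A / n) := by gcongr
      _ = _ := by field_simp

/-! ### The means of the chain -/

/-- The mean of a probability measure on the phase space. -/
def meanPhase (ν : Measure (Phase n)) : Phase n := (fun i => ∫ x, x.1 i ∂ν, fun i => ∫ x, x.2 i ∂ν)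

lemma pair_single_fst (i : Fin n) (x : Phase n) :
    pair ((Pi.single i 1, 0) : Phase n) x = x.1 i := by
  simp [pair, Pi.single_apply]

lemma pair_single_snd (i : Fin n) (x : Phase n) :
    pair ((0, Pi.single i 1) : Phase n) x = x.2 i := by
  simp [pair, Pi.single_apply]

lemma pair_meanPhase {ν : Measure (Phase n)} (hν : ∀ z, Integrable (pair z) ν) (z : Phase n) :
    pair z (meanPhase ν) = ∫ x, pair z x ∂ν := by
  have h1 : ∀ i, Integrable (fun x : Phase n => x.1 i) ν := fun i =>
    (hν (Pi.single i 1, 0)).congr (Eventually.of_forall fun x => pair_single_fst i x)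
  have h2 : ∀ i, Integrable (fun x : Phase n => x.2 i) ν := fun i =>
    (hν (0, Pi.single i 1)).congr (Eventually.of_forall fun x => pair_single_snd i x)
  have h3 : ∀ i ∈ Finset.univ, Integrable (fun x : Phase n => z.1 i * x.1 i + z.2 i * x.2 i) ν :=
    fun i _ => ((h1 i).const_mul _).add ((h2 i).const_mul _)
  simp only [pair, meanPhase]
  rw [integral_finsetSum _ h3]
  refine Finset.sum_congr rfl fun i _ => ?_
  rw [integral_add ((h1 i).const_mul _) ((h2 i).const_mul _), integral_const_mul,
    integral_const_mul]

lemma hasDerivAt_of_pair {m : ℝ → Phase n} {v : Phase n} {t : ℝ}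
    (h : ∀ z, HasDerivAt (fun s => pair z (m s)) (pair z v) t) : HasDerivAt m v t := by
  have h1 : HasDerivAt (fun s => (m s).1) v.1 t := by
    refine hasDerivAt_pi.2 fun i => ?_
    have := h (Pi.single i 1, 0)
    simpa only [pair_single_fst] using this
  have h2 : HasDerivAt (fun s => (m s).2) v.2 t := by
    refine hasDerivAt_pi.2 fun i => ?_
    have := h (0, Pi.single i 1)
    simpa only [pair_single_snd] using this
  exact h1.prodMk h2

lemma continuousOn_of_pair {m : ℝ → Phase n} {S : Set ℝ}
    (h : ∀ z, ContinuousOn (fun s => pair z (m s)) S) : ContinuousOn m S := by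
  have h1 : ContinuousOn (fun s => (m s).1) S := by
    refine continuousOn_pi.2 fun i => ?_
    have := h (Pi.single i 1, 0)
    simpa only [pair_single_fst] using this
  have h2 : ContinuousOn (fun s => (m s).2) S := by
    refine continuousOn_pi.2 fun i => ?_
    have := h (0, Pi.single i 1)
    simpa only [pair_single_snd] using this
  exact h1.prodMk h2

lemma continuous_meanDrift (γ : ℝ) : Continuous fun q : ℝ × Phase n => meanDrift γ q.1 q.2 := by
  unfold meanDrift
  have h1 : Continuous fun q : ℝ × Phase n => ((0, q.2.2) : Phase n) := by fun_prop
  exact (continuous_drift.const_smul ((n : ℝ) ^ 2)).add (h1.const_smul (-(2 * γ * (n : ℝ) ^ 2)))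

lemma pair_meanDrift (γ τ : ℝ) (z x : Phase n) :
    pair z (meanDrift γ τ x) = pair ((-(n : ℝ) ^ 2) • drift 0 z
      + (-(2 * γ * (n : ℝ) ^ 2)) • ((0, z.2) : Phase n)) x + (n : ℝ) ^ 2 * τ * pair endUnit z := by
  have h1 : pair z ((0, x.2) : Phase n) = pair ((0, z.2) : Phase n) x := by simp [pair]
  rw [meanDrift, pair_add_right, pair_smul_right, pair_smul_right, pair_drift, h1, pair_add_left,
    pair_smul_left, pair_smul_left]
  ring

/-- Flipping `pᵢ` changes it by `-2pᵢ`, so on linear functions the noise is a friction of strength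
`2γn²`. The equation for the means is therefore closed. -/
lemma generator_pair (γ τ : ℝ) (z x : Phase n) :
    generator n γ τ (pair z) x = pair z (meanDrift γ τ x) := by
  have h1 : ∑ i : Fin n, (pair z (flip i x) - pair z x) = -2 * pair z ((0, x.2) : Phase n) := by
    simp only [pair_flip]
    simp only [pair, Finset.mul_sum]
    exact Finset.sum_congr rfl fun i _ => by simp
  rw [generator_eq, (hasFDerivAt_pair z x).fderiv, h1, meanDrift, pair_add_right, pair_smul_right,
    pair_smul_right, pairL_apply]
  ring

lemma IsLawFlow.hasExpMoments (h : IsLawFlow n γ τ μ) (hτ : Continuous τ)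
    (h0 : HasExpMoments (μ 0)) {s : ℝ} (hs : 0 ≤ s) : HasExpMoments (μ s) := fun c hc => by
  obtain ⟨C, hC⟩ := h.exists_integral_weight_le hτ hc (h0 c hc) hs
  exact (hC s ⟨hs, le_rfl⟩).1

lemma IsLawFlow.continuousOn_meanPhase (h : IsLawFlow n γ τ μ) (hτ : Continuous τ)
    (h0 : HasExpMoments (μ 0)) {T : ℝ} (hT : 0 ≤ T) :
    ContinuousOn (fun s => meanPhase (μ s)) (Set.Icc 0 T) := by
  refine continuousOn_of_pair fun z => ?_
  refine ((IsTame.pair z).continuousOn_integral h hτ h0 hT).congr fun s hs => ?_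
  exact pair_meanPhase (fun z => (IsTame.pair z).integrable h hτ h0 hs.1) z

lemma IsLawFlow.hasDerivAt_meanPhase (h : IsLawFlow n γ τ μ) (hτ : Continuous τ)
    (h0 : HasExpMoments (μ 0)) {t : ℝ} (ht : 0 < t) :
    HasDerivAt (fun s => meanPhase (μ s)) (meanDrift γ (τ t) (meanPhase (μ t))) t := by
  have := h.prob
  have hT : (0 : ℝ) ≤ t + 1 := by linarith
  have hint : ∀ s, 0 ≤ s → ∀ z, Integrable (pair z) (μ s) := fun s hs z =>
    (IsTame.pair z).integrable h hτ h0 hs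
  refine hasDerivAt_of_pair fun z => ?_
  have hu : ContinuousOn (fun s => pair z (meanDrift γ (τ s) (meanPhase (μ s))))
      (Set.Icc 0 (t + 1)) := by
    have hq : ContinuousOn (fun s => (τ s, meanPhase (μ s))) (Set.Icc 0 (t + 1)) :=
      hτ.continuousOn.prodMk (h.continuousOn_meanPhase hτ h0 hT)
    have hd : ContinuousOn (fun s => meanDrift γ (τ s) (meanPhase (μ s))) (Set.Icc 0 (t + 1)) :=
      Continuous.comp_continuousOn (g := fun q : ℝ × Phase n => meanDrift γ q.1 q.2)
        (f := fun s => (τ s, meanPhase (μ s))) (continuous_meanDrift γ) hq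
    exact Continuous.comp_continuousOn (g := pair z)
      (f := fun s => meanDrift γ (τ s) (meanPhase (μ s))) (pairL z).continuous hd
  have hg : ∀ s ∈ Set.Icc 0 (t + 1), ∫ x, generator n γ (τ s) (pair z) x ∂μ s =
      pair z (meanDrift γ (τ s) (meanPhase (μ s))) := fun s hs => by
    simp only [generator_pair, pair_meanDrift]
    rw [integral_add (hint s hs.1 _) (integrable_const _), pair_meanPhase (hint s hs.1),
      integral_const]
    simp
  have h1 := (IsTame.pair z).hasDerivAt_integral h hτ h0 (T := t + 1) ⟨ht, by linarith⟩ hu hg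
  refine h1.congr_of_eventuallyEq ?_
  filter_upwards [Ioi_mem_nhds ht] with s hs
  exact pair_meanPhase (hint s (le_of_lt hs)) z

/-! ### Moment generating functions -/

/-- The moment generating function of a measure on the phase space. -/
def phaseMGF (ν : Measure (Phase n)) (z : Phase n) : ℝ := ∫ x, Real.exp (pair z x) ∂ν

lemma exp_pair_le_weight {z : Phase n} {R : ℝ} (hz : √(normSq z) ≤ R) (x : Phase n) :
    Real.exp (pair z x) ≤ weight R x := by
  refine Real.exp_le_exp.2 ((le_abs_self _).trans ((abs_pair_le_bracket z x).trans ?_))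
  have := (bracket_pos x).le
  gcongr

lemma HasExpMoments.integrable_exp_pair {ν : Measure (Phase n)} (hν : HasExpMoments ν)
    (z : Phase n) : Integrable (fun x => Real.exp (pair z x)) ν :=
  (hν _ (Real.sqrt_nonneg (normSq z))).mono'
    (IsTame.exp_pair z).continuous.aestronglyMeasurable
    (Eventually.of_forall fun x => by
      rw [Real.norm_eq_abs, abs_of_pos (Real.exp_pos _)]; exact exp_pair_le_weight le_rfl x)

/-- Differentiation of the moment generating function along a curve. -/
lemma HasExpMoments.hasDerivAt_phaseMGF {ν : Measure (Phase n)} (hν : HasExpMoments ν)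
    {c c' : ℝ → Phase n} (hc : ∀ s, HasDerivAt c (c' s) s) (hc' : Continuous c') :
    HasDerivAt (fun s => phaseMGF ν (c s)) (∫ x, pair (c' 0) x * Real.exp (pair (c 0) x) ∂ν) 0 := by
  have hcc : Continuous c := continuous_iff_continuousAt.2 fun s => (hc s).continuousAt
  have hsq : Continuous fun x : Phase n => √(normSq x) :=
    (contDiff_normSq (m := 0)).continuous.sqrt
  obtain ⟨R, hR⟩ : ∃ R, ∀ s ∈ Set.Icc (-1 : ℝ) 1, ‖√(normSq (c s))‖ ≤ R :=
    isCompact_Icc.exists_bound_of_continuousOn (hsq.comp hcc).continuousOn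
  obtain ⟨R', hR'⟩ : ∃ R', ∀ s ∈ Set.Icc (-1 : ℝ) 1, ‖√(normSq (c' s))‖ ≤ R' :=
    isCompact_Icc.exists_bound_of_continuousOn (hsq.comp hc').continuousOn
  have hR0 : 0 ≤ R := (norm_nonneg _).trans (hR 0 (by simp))
  have hR0' : 0 ≤ R' := (norm_nonneg _).trans (hR' 0 (by simp))
  -- The exponent `R + 1` in the dominating weight absorbs the linear factor `pair (c' s) x`
  -- produced by differentiation.
  refine (hasDerivAt_integral_of_dominated_loc_of_deriv_le
    (F := fun s x => Real.exp (pair (c s) x))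
    (F' := fun s x => pair (c' s) x * Real.exp (pair (c s) x)) (s := Set.Icc (-1 : ℝ) 1)
    (bound := fun x => R' * weight (R + 1) x) (Icc_mem_nhds (by norm_num) (by norm_num))
    (Eventually.of_forall fun s => (IsTame.exp_pair (c s)).continuous.aestronglyMeasurable)
    (hν.integrable_exp_pair (c 0))
    ((IsTame.pair (c' 0)).mul (IsTame.exp_pair (c 0))).continuous.aestronglyMeasurable
    (Eventually.of_forall fun x s hs => ?_) ((hν (R + 1) (by linarith)).const_mul R')
    (Eventually.of_forall fun x s hs => ?_)).2
  · have h1 := (le_abs_self _).trans (hR s hs)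
    have h2 := (le_abs_self _).trans (hR' s hs)
    rw [norm_mul, Real.norm_eq_abs, Real.norm_eq_abs, abs_of_pos (Real.exp_pos _)]
    have h3 := (bracket_pos x).le
    calc |pair (c' s) x| * Real.exp (pair (c s) x) ≤ (R' * bracket x) * weight R x := by
          gcongr
          · exact (abs_pair_le_bracket _ _).trans (by gcongr)
          · exact exp_pair_le_weight h1 x
      _ = R' * (weight R x * bracket x) := by ring
      _ ≤ R' * weight (R + 1) x := by gcongr; exact weight_mul_bracket_le R x
  · have h1 : HasDerivAt (fun s => pair (c s) x) (pair (c' s) x) s := by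
      simp only [pair_comm _ x]
      exact hasDerivAt_pair (hc s)
    have := h1.exp
    rwa [mul_comm] at this

/-- All operations are moved onto `z`: `pair (drift 0 z) x * exp (pair z x)` is the derivative of
the exponential in `z` along `drift 0 z`, and the jumps become jumps of `z`. After integration this
is a closed equation for the moment generating function. -/
lemma generator_exp_pair (γ τ : ℝ) (z x : Phase n) :
    generator n γ τ (fun x => Real.exp (pair z x)) x =
      (n : ℝ) ^ 2 * (-(pair (drift 0 z) x * Real.exp (pair z x))
          + τ * pair endUnit z * Real.exp (pair z x))
        + (n : ℝ) ^ 2 * γ * ∑ i : Fin n, (Real.exp (pair (flip i z) x) - Real.exp (pair z x)) := by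
  rw [generator_eq, (hasFDerivAt_pair z x).exp.fderiv]
  simp only [_root_.smul_apply, smul_eq_mul, pairL_apply, pair_drift, pair_flip_left]
  ring

/-- The evolution equation of the moment generating function. -/
lemma IsLawFlow.hasDerivAt_phaseMGF (h : IsLawFlow n γ τ μ) (hτ : Continuous τ)
    (h0 : HasExpMoments (μ 0)) {t : ℝ} (ht : 0 < t) (z : Phase n) :
    HasDerivAt (fun s => phaseMGF (μ s) z)
      ((n : ℝ) ^ 2 * (-(∫ x, pair (drift 0 z) x * Real.exp (pair z x) ∂μ t)
          + τ t * pair endUnit z * phaseMGF (μ t) z)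
        + (n : ℝ) ^ 2 * γ * ∑ i : Fin n, (phaseMGF (μ t) (flip i z) - phaseMGF (μ t) z)) t := by
  have hT : (0 : ℝ) ≤ t + 1 := by linarith
  have hP := (IsTame.pair (drift 0 z)).mul (IsTame.exp_pair z)
  have hcE : ∀ z : Phase n, ContinuousOn (fun s => phaseMGF (μ s) z) (Set.Icc 0 (t + 1)) :=
    fun z => (IsTame.exp_pair z).continuousOn_integral h hτ h0 hT
  have hcP := hP.continuousOn_integral h hτ h0 hT
  refine (IsTame.exp_pair z).hasDerivAt_integral h hτ h0 (T := t + 1) ⟨ht, by linarith⟩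
    (u := fun t => (n : ℝ) ^ 2 * (-(∫ x, pair (drift 0 z) x * Real.exp (pair z x) ∂μ t)
          + τ t * pair endUnit z * phaseMGF (μ t) z)
        + (n : ℝ) ^ 2 * γ * ∑ i : Fin n, (phaseMGF (μ t) (flip i z) - phaseMGF (μ t) z))
    ?_ fun s hs => ?_
  · refine (continuousOn_const.mul (hcP.neg.add ((hτ.continuousOn.mul continuousOn_const).mul
      (hcE z)))).add (continuousOn_const.mul (continuousOn_finsetSum _ fun i _ =>
        (hcE (flip i z)).sub (hcE z)))
  · have hE : ∀ z : Phase n, Integrable (fun x => Real.exp (pair z x)) (μ s) := fun z =>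
      (IsTame.exp_pair z).integrable h hτ h0 hs.1
    have hPi := hP.integrable h hτ h0 hs.1
    simp only [generator_exp_pair]
    have hA : Integrable (fun x => (n : ℝ) ^ 2 * (-(pair (drift 0 z) x * Real.exp (pair z x))
          + τ s * pair endUnit z * Real.exp (pair z x))) (μ s) :=
      (hPi.neg.add ((hE z).const_mul _)).const_mul _
    have hS : ∀ i ∈ Finset.univ, Integrable (fun x => Real.exp (pair (flip i z) x)
        - Real.exp (pair z x)) (μ s) := fun i _ => (hE _).sub (hE z)
    have hN : Integrable (fun x => -(pair (drift 0 z) x * Real.exp (pair z x))) (μ s) := hPi.neg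
    rw [integral_add hA ((integrable_finsetSum _ hS).const_mul _), integral_const_mul,
      integral_add hN ((hE z).const_mul _), integral_const_mul, integral_const_mul,
      integral_finsetSum _ hS, integral_neg]
    simp only [integral_sub (hE _) (hE z), phaseMGF]

lemma normSq_le_norm_sq (x : Phase n) : normSq x ≤ 2 * n * ‖x‖ ^ 2 := by
  rw [normSq_eq]
  calc ∑ i, (x.1 i ^ 2 + x.2 i ^ 2) ≤ ∑ _i : Fin n, (‖x‖ ^ 2 + ‖x‖ ^ 2) := by
        refine Finset.sum_le_sum fun i _ => add_le_add ?_ ?_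
        · rw [← sq_abs, ← Real.norm_eq_abs]
          gcongr
          exact (norm_le_pi_norm x.1 i).trans (norm_fst_le x)
        · rw [← sq_abs, ← Real.norm_eq_abs]
          gcongr
          exact (norm_le_pi_norm x.2 i).trans (norm_snd_le x)
    _ = 2 * n * ‖x‖ ^ 2 := by simp; ring

lemma abs_exp_sub_exp_le {a b c : ℝ} (ha : a ≤ c) (hb : b ≤ c) :
    |Real.exp a - Real.exp b| ≤ |a - b| * Real.exp c := by
  have key : ∀ a b : ℝ, a ≤ c → Real.exp a - Real.exp b ≤ |a - b| * Real.exp c := by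
    intro a b ha
    have h1 := Real.add_one_le_exp (b - a)
    have h2 : Real.exp b = Real.exp a * Real.exp (b - a) := by rw [← Real.exp_add]; ring_nf
    have h3 := Real.exp_pos a
    have h4 := Real.exp_le_exp.2 ha
    have h5 := le_abs_self (a - b)
    have h6 := abs_nonneg (a - b)
    rw [h2]
    nlinarith [mul_le_mul_of_nonneg_left h1 h3.le, mul_le_mul_of_nonneg_left h4 h6,
      mul_le_mul_of_nonneg_right h5 h3.le]
  refine abs_sub_le_iff.2 ⟨key a b ha, ?_⟩
  rw [abs_sub_comm]
  exact key b a hb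

/-- Joint continuity follows from continuity in time for each `z` and a Lipschitz bound in `z` that
is uniform in time. It is what lets the quotient with the Gaussian majorant attain its maximum. -/
lemma IsLawFlow.continuousOn_phaseMGF (h : IsLawFlow n γ τ μ) (hτ : Continuous τ)
    (h0 : HasExpMoments (μ 0)) {T : ℝ} (hT : 0 ≤ T) :
    ContinuousOn (fun q : ℝ × Phase n => phaseMGF (μ q.1) q.2)
      (Set.Icc 0 T ×ˢ {z | normSq z ≤ 1}) := by
  obtain ⟨C, hC⟩ := h.exists_integral_weight_le hτ zero_le_two (h0 2 zero_le_two) hT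
  have hC0 : 0 ≤ C := (integral_nonneg fun x => (weight_pos 2 x).le).trans
    (hC 0 ⟨le_rfl, hT⟩).2
  have hL : 0 ≤ √(2 * n) * C := by positivity
  refine continuousOn_prod_of_continuousOn_lipschitzOnWith' _ (Real.toNNReal (√(2 * n) * C))
    (fun s hs => ?_) fun z _ => (IsTame.exp_pair z).continuousOn_integral h hτ h0 hT
  refine LipschitzOnWith.of_dist_le_mul fun z hz z' hz' => ?_
  have hI := h.hasExpMoments hτ h0 hs.1
  rw [Real.coe_toNNReal _ hL, Real.dist_eq, phaseMGF, phaseMGF,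
    ← integral_sub (hI.integrable_exp_pair z) (hI.integrable_exp_pair z'), ← Real.norm_eq_abs]
  have hd : √(normSq (z + (-1 : ℝ) • z')) ≤ √(2 * n) * dist z z' := by
    rw [dist_eq_norm, Real.sqrt_le_left (by positivity), mul_pow, Real.sq_sqrt (by positivity)]
    have := normSq_le_norm_sq (z + (-1 : ℝ) • z')
    rwa [neg_one_smul, ← sub_eq_add_neg] at this ⊢
  have hone : ∀ z : Phase n, normSq z ≤ 1 → ∀ x, pair z x ≤ 1 * bracket x := fun z hz x => by
    refine (le_abs_self _).trans ((abs_pair_le_bracket z x).trans ?_)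
    have := (bracket_pos x).le
    gcongr
    rw [Real.sqrt_le_one]
    exact hz
  have hpt : ∀ x, ‖Real.exp (pair z x) - Real.exp (pair z' x)‖ ≤
      √(2 * n) * dist z z' * weight 2 x := by
    intro x
    have h1 := abs_exp_sub_exp_le (hone z hz x) (hone z' hz' x)
    have h2 : pair z x - pair z' x = pair (z + (-1 : ℝ) • z') x := by
      rw [pair_add_left, pair_smul_left]; ring
    rw [h2] at h1
    have h3 := (bracket_pos x).le
    calc _ ≤ |pair (z + (-1 : ℝ) • z') x| * weight 1 x := h1
      _ ≤ √(2 * n) * dist z z' * bracket x * weight 1 x := by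
        have := (weight_pos 1 x).le
        gcongr
        exact (abs_pair_le_bracket _ _).trans (by gcongr)
      _ = √(2 * n) * dist z z' * (weight 1 x * bracket x) := by ring
      _ ≤ √(2 * n) * dist z z' * weight 2 x := by
        gcongr
        have := weight_mul_bracket_le 1 x
        norm_num at this
        exact this
  refine (norm_integral_le_of_norm_le ((hI 2 zero_le_two).const_mul _)
    (Eventually.of_forall hpt)).trans ?_
  rw [integral_const_mul]
  have := (hC s hs).2
  calc √(2 * n) * dist z z' * ∫ x, weight 2 x ∂μ s ≤ √(2 * n) * dist z z' * C := by gcongr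
    _ = _ := by ring

/-! ### The maximum principle -/

/-- Only earlier times are compared, since the maximum may sit at the final time. -/
lemma HasDerivAt.nonneg_of_eventually_le {f : ℝ → ℝ} {d a : ℝ} (hf : HasDerivAt f d a)
    (h : ∀ᶠ s in 𝓝[<] a, f s ≤ f a) : 0 ≤ d := by
  refine ge_of_tendsto (hasDerivAt_iff_tendsto_slope_left_right.1 hf).1 ?_
  filter_upwards [h, self_mem_nhdsWithin] with s hs hsa
  rw [slope_def_field]
  exact div_nonneg_of_nonpos (by linarith) (by linarith [Set.mem_Iio.1 hsa])

/-- A curve in the unit ball through `z` with velocity `drift 0 z`. -/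
def ballCurve (z : Phase n) (s : ℝ) : Phase n :=
  (1 + s ^ 2 * normSq (drift 0 z))⁻¹ • (z + s • drift 0 z)

/-- By antisymmetry the first-order term vanishes: `|z + s • drift 0 z|² = |z|² + s²a ≤ (1 + s²a)²`.
The straight line would leave the ball at boundary points; the rescaled curve stays inside for both
signs of `s`, so a maximum yields a vanishing derivative. -/
lemma normSq_ballCurve_le {z : Phase n} (hz : normSq z ≤ 1) (s : ℝ) :
    normSq (ballCurve z s) ≤ 1 := by
  have ha := normSq_nonneg (drift 0 z)
  set a := normSq (drift 0 z)
  have h1 : 0 ≤ s ^ 2 * a := by positivity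
  rw [ballCurve, normSq_smul, normSq_add, normSq_smul, pair_smul_right, pair_drift_zero_self,
    inv_pow, inv_mul_le_iff₀ (by positivity)]
  nlinarith

lemma exists_hasDerivAt_ballCurve (z : Phase n) :
    ∃ c' : ℝ → Phase n, Continuous c' ∧ (∀ s, HasDerivAt (ballCurve z) (c' s) s) ∧
      c' 0 = drift 0 z := by
  have ha := normSq_nonneg (drift 0 z)
  set a := normSq (drift 0 z) with hA
  have hne : ∀ s : ℝ, 1 + s ^ 2 * a ≠ 0 := fun s => by positivity
  have h1 : ∀ s : ℝ, HasDerivAt (fun s : ℝ => (1 + s ^ 2 * a)⁻¹)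
      (-(2 * s * a) / (1 + s ^ 2 * a) ^ 2) s := fun s => by
    refine HasDerivAt.fun_inv ?_ (hne s)
    refine (((hasDerivAt_pow 2 s).mul_const a).const_add 1).congr_deriv (by simp)
  have h2 : ∀ s : ℝ, HasDerivAt (fun s : ℝ => z + s • drift 0 z) (drift 0 z) s := fun s => by
    simpa using ((hasDerivAt_id s).smul_const (drift 0 z)).const_add z
  refine ⟨fun s => (1 + s ^ 2 * a)⁻¹ • drift 0 z
    + (-(2 * s * a) / (1 + s ^ 2 * a) ^ 2) • (z + s • drift 0 z), ?_, fun s => ?_, by simp⟩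
  · refine Continuous.add ?_ ?_
    · exact (Continuous.inv₀ (by fun_prop) hne).smul continuous_const
    · exact (Continuous.div (by fun_prop) (by fun_prop) fun s => pow_ne_zero 2 (hne s)).smul
        (by fun_prop)
  · exact (h1 s).smul (h2 s)

lemma isCompact_normSq_le_one : IsCompact {z : Phase n | normSq z ≤ 1} := by
  refine Metric.isCompact_of_isClosed_isBounded
    (isClosed_le (contDiff_normSq (m := 0)).continuous continuous_const) ?_
  refine (Metric.isBounded_closedBall (x := (0 : Phase n)) (r := 1)).subset fun z hz => ?_
  rw [mem_closedBall_zero_iff]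
  have h1 := norm_sq_le_normSq z
  have h2 : normSq z ≤ 1 := hz
  nlinarith [norm_nonneg z]

/-- The logarithm of a supersolution of the equation of the moment generating function. -/
def logMajorant (m : ℝ → Phase n) (q : ℝ → ℝ) (ε s : ℝ) (z : Phase n) : ℝ :=
  pair z (m s) + q s * normSq z / 2 + ε * s

/-- At a maximum of the quotient of the moment generating function and the supersolution, the
drift and the flips cannot increase the quotient. -/
lemma IsLawFlow.no_interior_max (h : IsLawFlow n γ τ μ) (hγ : 0 < γ) (hτ : Continuous τ)
    (h0 : HasExpMoments (μ 0)) {q : ℝ → ℝ} {q' ε t : ℝ} (ht : 0 < t) (hε : 0 < ε)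
    (hq : HasDerivAt q q' t) {z : Phase n} (hz : normSq z ≤ 1)
    (hsuper : (n : ℝ) ^ 2 * γ * ∑ i, (Real.exp (-(2 * (z.2 i * (meanPhase (μ t)).2 i))) - 1
      + 2 * (z.2 i * (meanPhase (μ t)).2 i)) ≤ q' * normSq z / 2)
    (hpos : 0 < phaseMGF (μ t) z)
    (hmax : ∀ y : Phase n, normSq y ≤ 1 → phaseMGF (μ t) y *
      Real.exp (-logMajorant (fun s => meanPhase (μ s)) q ε t y) ≤ phaseMGF (μ t) z *
      Real.exp (-logMajorant (fun s => meanPhase (μ s)) q ε t z))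
    (hleft : ∀ s ∈ Set.Icc 0 t, phaseMGF (μ s) z *
      Real.exp (-logMajorant (fun s => meanPhase (μ s)) q ε s z) ≤ phaseMGF (μ t) z *
      Real.exp (-logMajorant (fun s => meanPhase (μ s)) q ε t z)) : False := by
  set m : ℝ → Phase n := fun s => meanPhase (μ s) with hm
  set E := Real.exp (-logMajorant m q ε t z) with hE
  have hE0 : 0 < E := Real.exp_pos _
  set φ := phaseMGF (μ t) z with hφ
  have hdm : HasDerivAt m (meanDrift γ (τ t) (m t)) t := h.hasDerivAt_meanPhase hτ h0 ht
  -- the derivative in time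
  have htime := (h.hasDerivAt_phaseMGF hτ h0 ht z).mul
    ((((hasDerivAt_pair (z := z) hdm).add ((hq.mul_const (normSq z)).div_const 2)).add
      ((hasDerivAt_id t).const_mul ε)).neg.exp)
  have htime0 := HasDerivAt.nonneg_of_eventually_le htime (by
    filter_upwards [Ioo_mem_nhdsLT ht] with s hs
    exact hleft s ⟨hs.1.le, hs.2.le⟩)
  -- the derivative along the drift
  obtain ⟨c', hc'c, hc', hc'0⟩ := exists_hasDerivAt_ballCurve z
  have hc0 : ballCurve z 0 = z := by simp [ballCurve]
  have hspace1 := (h.hasExpMoments hτ h0 ht.le).hasDerivAt_phaseMGF hc' hc'c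
  have hpm : HasDerivAt (fun s => pair (ballCurve z s) (m t)) (pair (drift 0 z) (m t)) 0 := by
    simp only [pair_comm _ (m t)]
    rw [← hc'0]
    exact hasDerivAt_pair (hc' 0)
  have hnm : HasDerivAt (fun s => normSq (ballCurve z s)) 0 0 := by
    refine (hasDerivAt_normSq (hc' 0)).congr_deriv ?_
    rw [hc0, hc'0, pair_drift_zero_self, mul_zero]
  have hspace := hspace1.mul
    (((hpm.add ((hnm.const_mul (q t)).div_const 2)).add_const (ε * t)).neg.exp)
  have hloc : IsLocalMax ((fun s => phaseMGF (μ t) (ballCurve z s)) * fun s =>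
      Real.exp ((-fun s => ((fun s => pair (ballCurve z s) (m t)) + fun s => q t *
        normSq (ballCurve z s) / 2) s + ε * t) s)) 0 := by
    refine Eventually.of_forall fun s => ?_
    have := hmax (ballCurve z s) (normSq_ballCurve_le hz s)
    simpa [logMajorant, hc0, hE, hφ] using this
  have hspace0 := hloc.hasDerivAt_eq_zero hspace
  -- the flips
  have hflip : ∀ i, phaseMGF (μ t) (flip i z) ≤
      φ * Real.exp (-(2 * (z.2 i * (m t).2 i))) := by
    intro i
    have h1 := hmax (flip i z) (by rw [normSq_flip]; exact hz)
    have h2 : Real.exp (-logMajorant m q ε t (flip i z)) =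
        E * Real.exp (2 * (z.2 i * (m t).2 i)) := by
      rw [hE, ← Real.exp_add]
      congr 1
      simp only [logMajorant, normSq_flip, pair_flip_left, pair_flip]
      ring
    rw [h2] at h1
    have h3 : phaseMGF (μ t) (flip i z) * Real.exp (2 * (z.2 i * (m t).2 i)) ≤ φ := by
      refine le_of_mul_le_mul_right ?_ hE0
      linarith
    rw [Real.exp_neg, ← div_eq_mul_inv, le_div_iff₀ (Real.exp_pos _)]
    exact h3
  have hsum : ∑ i, (phaseMGF (μ t) (flip i z) - φ) ≤
      φ * ∑ i, (Real.exp (-(2 * (z.2 i * (m t).2 i))) - 1) := by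
    rw [Finset.mul_sum]
    exact Finset.sum_le_sum fun i _ => by linarith [hflip i]
  have hpd : pair z (meanDrift γ (τ t) (m t)) = (n : ℝ) ^ 2 * (-pair (drift 0 z) (m t)
      + τ t * pair endUnit z) - 2 * γ * (n : ℝ) ^ 2 * ∑ i, z.2 i * (m t).2 i := by
    rw [meanDrift, pair_add_right, pair_smul_right, pair_smul_right, pair_drift]
    simp only [pair, Pi.zero_apply, mul_zero, zero_add]
    ring
  have hss : ∑ i, (Real.exp (-(2 * (z.2 i * (m t).2 i))) - 1 + 2 * (z.2 i * (m t).2 i)) =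
      ∑ i, (Real.exp (-(2 * (z.2 i * (m t).2 i))) - 1) + 2 * ∑ i, z.2 i * (m t).2 i := by
    rw [Finset.sum_add_distrib, Finset.mul_sum]
  rw [hss] at hsuper
  simp only [hc0, hc'0, Pi.add_apply, Pi.neg_apply, id] at hspace0 htime0
  rw [hpd] at htime0
  have hE' : Real.exp (-(pair z (m t) + q t * normSq z / 2 + ε * t)) = E := rfl
  rw [hE', ← hφ] at hspace0 htime0
  set I := ∫ x, pair (drift 0 z) x * Real.exp (pair z x) ∂μ t
  set S₁ := ∑ i, (Real.exp (-(2 * (z.2 i * (m t).2 i))) - 1)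
  set S₂ := ∑ i, (phaseMGF (μ t) (flip i z) - φ)
  set S₃ := ∑ i, z.2 i * (m t).2 i
  set p := pair (drift 0 z) (m t)
  -- Stationarity along the curve: the transport of the moment generating function equals that of
  -- the majorant, whose quadratic part is constant to first order.
  have hI : I = φ * p := by
    have : (I - φ * p) * E = 0 := by linear_combination hspace0
    rcases mul_eq_zero.1 this with h1 | h1
    · linarith
    · exact absurd h1 hE0.ne'
  -- The transport and tension terms cancel against the derivative of the mean. Only the flips, the
  -- friction part of the mean equation and `q' |z|²/2 + ε` remain; the supersolution condition then
  -- leaves `-φ ε ≥ 0`.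
  have h1 : 0 ≤ E * ((n : ℝ) ^ 2 * γ * S₂ + 2 * γ * (n : ℝ) ^ 2 * S₃ * φ
      - φ * (q' * normSq z / 2 + ε)) := by
    refine htime0.trans_eq ?_
    rw [hI]
    ring
  have h2 := (mul_nonneg_iff_of_pos_left hE0).1 h1
  have h3 : (n : ℝ) ^ 2 * γ * S₂ ≤ (n : ℝ) ^ 2 * γ * (φ * S₁) :=
    mul_le_mul_of_nonneg_left hsum (by positivity)
  have h4 := mul_le_mul_of_nonneg_left hsuper hpos.le
  have h5 := mul_pos hpos hε
  linarith

/-- Gaussian bounds for the moment generating function propagate in time. -/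
theorem IsLawFlow.phaseMGF_le (h : IsLawFlow n γ τ μ) (hγ : 0 < γ) (hτ : Continuous τ)
    (h0 : HasExpMoments (μ 0)) {q q' : ℝ → ℝ} {t : ℝ} (ht : 0 ≤ t)
    (hqc : ContinuousOn q (Set.Icc 0 t)) (hq : ∀ s ∈ Set.Ioc 0 t, HasDerivAt q (q' s) s)
    (hsuper : ∀ s ∈ Set.Ioc 0 t, ∀ z : Phase n, normSq z ≤ 1 →
      (n : ℝ) ^ 2 * γ * ∑ i, (Real.exp (-(2 * (z.2 i * (meanPhase (μ s)).2 i))) - 1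
        + 2 * (z.2 i * (meanPhase (μ s)).2 i)) ≤ q' s * normSq z / 2)
    (hinit : ∀ z : Phase n, normSq z ≤ 1 →
      phaseMGF (μ 0) z ≤ Real.exp (pair z (meanPhase (μ 0)) + q 0 * normSq z / 2))
    {z : Phase n} (hz : normSq z ≤ 1) :
    phaseMGF (μ t) z ≤ Real.exp (pair z (meanPhase (μ t)) + q t * normSq z / 2 + 1) := by
  have := h.prob
  set m : ℝ → Phase n := fun s => meanPhase (μ s) with hm
  -- The strictness parameter is chosen so that `ε t ≤ 1`, which is the additive `1` in the exponent
  -- of the conclusion.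
  set ε : ℝ := 1 / (t + 1) with hε
  have hε0 : 0 < ε := by positivity
  have hmc : ContinuousOn m (Set.Icc 0 t) := h.continuousOn_meanPhase hτ h0 ht
  set K : Set (ℝ × Phase n) := Set.Icc 0 t ×ˢ {z | normSq z ≤ 1} with hK
  have hKc : IsCompact K := isCompact_Icc.prod isCompact_normSq_le_one
  set Φ : ℝ × Phase n → ℝ := fun y => phaseMGF (μ y.1) y.2 *
    Real.exp (-logMajorant m q ε y.1 y.2) with hΦ
  have hfst : Set.MapsTo Prod.fst K (Set.Icc 0 t) := fun y hy => hy.1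
  have hΦc : ContinuousOn Φ K := by
    refine (h.continuousOn_phaseMGF hτ h0 ht).mul (ContinuousOn.rexp (ContinuousOn.neg ?_))
    have h1 : ContinuousOn (fun y : ℝ × Phase n => (y.2, m y.1)) K :=
      continuousOn_snd.prodMk (hmc.comp continuousOn_fst hfst)
    have h2 : ContinuousOn (fun y : ℝ × Phase n => pair y.2 (m y.1)) K :=
      Continuous.comp_continuousOn (g := fun y : Phase n × Phase n => pair y.1 y.2)
        (f := fun y : ℝ × Phase n => (y.2, m y.1)) continuous_pair h1
    have h3 : ContinuousOn (fun y : ℝ × Phase n => q y.1) K := hqc.comp continuousOn_fst hfst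
    have h4 : ContinuousOn (fun y : ℝ × Phase n => normSq y.2) K :=
      ((contDiff_normSq (m := 0)).continuous.comp continuous_snd).continuousOn
    exact (h2.add ((h3.mul h4).div_const 2)).add (continuousOn_const.mul continuousOn_fst)
  obtain ⟨y, hyK, hy⟩ := hKc.exists_isMaxOn ⟨(0, 0), ⟨le_rfl, ht⟩, by
    simp [normSq, pair]⟩ hΦc
  have hy' : ∀ x ∈ K, Φ x ≤ Φ y := fun x hx => hy hx
  have hle : Φ y ≤ 1 := by
    rcases hyK.1.1.eq_or_lt with hy0 | hy0
    · have h1 := hinit y.2 hyK.2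
      simp only [hΦ, ← hy0, logMajorant, mul_zero, add_zero]
      rw [Real.exp_neg, ← div_eq_mul_inv, div_le_one (Real.exp_pos _)]
      exact h1
    · exfalso
      have hyt : y.1 ∈ Set.Ioc 0 t := ⟨hy0, hyK.1.2⟩
      refine h.no_interior_max hγ hτ h0 hy0 hε0 (hq y.1 hyt) hyK.2 (hsuper y.1 hyt y.2 hyK.2) ?_
        (fun x hx => hy' (y.1, x) ⟨hyK.1, hx⟩)
        (fun s hs => hy' (s, y.2) ⟨⟨hs.1, hs.2.trans hyK.1.2⟩, hyK.2⟩)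
      exact integral_exp_pos ((h.hasExpMoments hτ h0 hyK.1.1).integrable_exp_pair y.2)
  have h1 : Φ (t, z) ≤ 1 := (hy' (t, z) ⟨⟨ht, le_rfl⟩, hz⟩).trans hle
  simp only [hΦ] at h1
  rw [Real.exp_neg, ← div_eq_mul_inv, div_le_one (Real.exp_pos _)] at h1
  refine h1.trans (Real.exp_le_exp.2 ?_)
  have h2 : ε * t ≤ 1 := by
    rw [hε, one_div, inv_mul_le_iff₀ (by positivity)]; linarith
  simp only [logMajorant]
  linarith

/-! ### Explicit constants in the Gaussian bound -/

lemma exp_sub_one_sub_le {v M : ℝ} (hv : |v| ≤ M) :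
    Real.exp v - 1 - v ≤ v ^ 2 * Real.exp M := by
  have h1 : Real.exp v - 1 ≤ v * Real.exp v := by
    have h2 := Real.add_one_le_exp (-v)
    have h3 : Real.exp (-v) * Real.exp v = 1 := by rw [← Real.exp_add]; simp
    nlinarith [Real.exp_pos v]
  have h4 := abs_exp_sub_exp_le (a := v) (b := 0) (c := M) ((le_abs_self v).trans hv)
    ((abs_nonneg v).trans hv)
  rw [Real.exp_zero, sub_zero] at h4
  have h5 : v * (Real.exp v - 1) ≤ |v| * (|v| * Real.exp M) := by
    refine (le_abs_self _).trans ?_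
    rw [abs_mul]
    gcongr
  have h6 : |v| * (|v| * Real.exp M) = v ^ 2 * Real.exp M := by
    rw [← mul_assoc, abs_mul_abs_self, sq]
  linarith

/-- Each summand is a second-order Taylor remainder and carries its own `zᵢ²`, so the sum costs the
largest squared mean momentum times `|z|²` and no factor `n`. -/
lemma sum_exp_sub_one_le {z m : Phase n} {M A : ℝ} (hz : normSq z ≤ 1)
    (hM : ∀ i, |m.2 i| ≤ M) (hA : ∀ i, m.2 i ^ 2 ≤ A) :
    ∑ i, (Real.exp (-(2 * (z.2 i * m.2 i))) - 1 + 2 * (z.2 i * m.2 i)) ≤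
      4 * Real.exp (2 * M) * A * normSq z := by
  have h1 : ∀ i, Real.exp (-(2 * (z.2 i * m.2 i))) - 1 + 2 * (z.2 i * m.2 i) ≤
      4 * Real.exp (2 * M) * A * z.2 i ^ 2 := by
    intro i
    have h2 : |z.2 i| ≤ 1 := by
      have := (sq_snd_le_normSq z i).trans hz
      rwa [sq_le_one_iff_abs_le_one] at this
    have h3 : |-(2 * (z.2 i * m.2 i))| ≤ 2 * M := by
      rw [abs_neg, abs_mul, abs_mul, abs_two]
      have := mul_le_mul h2 (hM i) (abs_nonneg _) zero_le_one
      linarith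
    have h4 := exp_sub_one_sub_le h3
    have h5 : (-(2 * (z.2 i * m.2 i))) ^ 2 * Real.exp (2 * M) =
        4 * Real.exp (2 * M) * m.2 i ^ 2 * z.2 i ^ 2 := by ring
    rw [h5] at h4
    have h6 : 4 * Real.exp (2 * M) * m.2 i ^ 2 * z.2 i ^ 2 ≤
        4 * Real.exp (2 * M) * A * z.2 i ^ 2 := by
      gcongr
      exact hA i
    linarith
  rcases isEmpty_or_nonempty (Fin n) with he | ⟨⟨i⟩⟩
  · simp [normSq_eq]
  have hA0 : 0 ≤ A := (sq_nonneg _).trans (hA i)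
  refine (Finset.sum_le_sum fun i _ => h1 i).trans ?_
  rw [← Finset.mul_sum]
  gcongr
  rw [normSq_eq]
  exact Finset.sum_le_sum fun i _ => by nlinarith [sq_nonneg (z.1 i)]

/-- The constant in the bound of the increments of the means. -/
def incrementConst (γ K : ℝ) : ℝ := Real.exp (2 * K) * (K + (2 * K ^ 2 + 1) + 2 * γ * K)

/-- The constant in the bound of the means. -/
def meanConst (γ K : ℝ) : ℝ := √(2 * incrementConst γ K)

/-- The constant in the bound of the logarithmic moment generating function. -/
def logMGFConst (γ K : ℝ) : ℝ := (K + meanConst γ K)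
  + (K + 8 * γ * Real.exp (2 * meanConst γ K) * (incrementConst γ K / (2 * γ))) / 2 + 1

/-- The moment generating function of the chain is bounded in terms of the mean at unit vectors,
uniformly in the number of particles. -/
theorem IsLawFlow.exp_moment_le (h : IsLawFlow n γ τ μ) (hγ : 0 < γ) (hn : 1 ≤ n)
    (hτ : Continuous τ) (h0 : HasExpMoments (μ 0)) {K T : ℝ} (hK : 1 ≤ K) {τ₁ τ₂ : ℝ → ℝ}
    (hτ₁c : ContinuousOn τ₁ (Set.Icc 0 T)) (hτ₂c : ContinuousOn τ₂ (Set.Icc 0 T))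
    (hτd : ∀ t ∈ Set.Ioo 0 T, HasDerivAt τ (τ₁ t) t)
    (hτ₁d : ∀ t ∈ Set.Ioo 0 T, HasDerivAt τ₁ (τ₂ t) t)
    (hτb : ∀ t ∈ Set.Icc 0 T, |τ t| ≤ K)
    (hb : ∀ t ∈ Set.Icc 0 T, |τ₁ t| ≤ K)
    (hi1 : ∫ s in (0 : ℝ)..T, τ₁ s ^ 2 ≤ K) (hi2 : ∫ s in (0 : ℝ)..T, |τ₂ s| ≤ K)
    (hm0 : (meanPhase (μ 0)).2 = 0) (hD0 : normSq (drift (τ 0) (meanPhase (μ 0))) ≤ K / n)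
    (hinit : ∀ z : Phase n, normSq z ≤ 1 →
      phaseMGF (μ 0) z ≤ Real.exp (pair z (meanPhase (μ 0)) + K * normSq z / 2))
    {t : ℝ} (ht : t ∈ Set.Ico 0 T) {z : Phase n} (hz : normSq z ≤ 1)
    (hzm : ∀ x M, (∀ i, |x.1 i| ≤ M) → (∀ i, |x.2 i| ≤ M) → pair z x ≤ M) :
    phaseMGF (μ t) z ≤ Real.exp (logMGFConst γ K) := by
  have hT : 0 ≤ T := ht.1.trans ht.2.le
  have hn' : (1 : ℝ) ≤ n := by exact_mod_cast hn
  have hn0 : (0 : ℝ) < n := by linarith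
  set m : ℝ → Phase n := fun s => meanPhase (μ s) with hm
  have hmc : ContinuousOn m (Set.Icc 0 T) := h.continuousOn_meanPhase hτ h0 hT
  obtain ⟨hD, hH⟩ := normSq_drift_le_of_hasDerivAt hγ hn hK hT hτ.continuousOn hτ₁c hτ₂c hτd
    hτ₁d hmc (fun s hs => h.hasDerivAt_meanPhase hτ h0 hs.1) hb hi1 hi2 hm0 hD0
  set M := meanConst γ K with hM
  set H : ℝ → ℝ := fun s => normSqFst (drift (τ s) (m s)) with hHdef
  have hH0 : ∀ s, 0 ≤ H s := fun s => normSqFst_nonneg _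
  have hnD : ∀ s ∈ Set.Icc 0 T, n * normSq (drift (τ s) (m s)) ≤ 2 * incrementConst γ K := by
    intro s hs
    have h1 := mul_le_mul_of_nonneg_left (hD s hs) hn0.le
    rwa [mul_div_cancel₀ _ hn0.ne'] at h1
  have hm2 : ∀ s ∈ Set.Icc 0 T, ∀ i, |(m s).2 i| ≤ M := fun s hs i => by
    refine Real.abs_le_sqrt ((sq_snd_le_normSqFst_drift (τ s) (m s) i).trans
      (le_trans ?_ (hnD s hs)))
    gcongr
    exact normSqFst_le _
  have hm1 : ∀ s ∈ Set.Icc 0 T, ∀ i, |(m s).1 i| ≤ K + M := fun s hs i => by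
    have h1 : |τ s - (m s).1 i| ≤ M :=
      Real.abs_le_sqrt ((sq_sub_fst_le_normSq_drift (τ s) (m s) i).trans (hnD s hs))
    have h2 := abs_sub_abs_le_abs_sub ((m s).1 i) (τ s)
    rw [abs_sub_comm] at h2
    linarith [hτb s hs]
  have hHc : ContinuousOn H (Set.Icc 0 T) := by
    have hq : ContinuousOn (fun s => (τ s, m s)) (Set.Icc 0 T) := hτ.continuousOn.prodMk hmc
    have hd : ContinuousOn (fun s => drift (τ s) (m s)) (Set.Icc 0 T) :=
      Continuous.comp_continuousOn (g := fun q : ℝ × Phase n => drift q.1 q.2)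
        (f := fun s => (τ s, m s)) continuous_drift hq
    exact Continuous.comp_continuousOn (g := normSqFst) (f := fun s => drift (τ s) (m s))
      continuous_normSqFst hd
  -- The `8` is the `4` of `sum_exp_sub_one_le` doubled, because `q` enters the majorant as `q
  -- |z|²/2`.
  set a : ℝ := 8 * γ * Real.exp (2 * M) with ha
  have ha0 : 0 ≤ a := by positivity
  -- Of the factor `n³`, two powers come from the time scale and one from bounding squared mean
  -- momenta by `n H`. The estimate `∫ H = O(1/n³)` compensates it exactly. The starting value `K`
  -- is the Gaussian constant of the initial bound.
  set q : ℝ → ℝ := fun s => K + a * n ^ 3 * ∫ r in (0 : ℝ)..s, H r with hq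
  have hsub : Set.Icc 0 t ⊆ Set.Icc 0 T := Set.Icc_subset_Icc le_rfl ht.2.le
  have hqc : ContinuousOn q (Set.Icc 0 t) := by
    have h1 := intervalIntegral.continuousOn_primitive_interval (μ := volume) (f := H) (a := 0)
      (b := T) (by rw [Set.uIcc_of_le hT]; exact hHc.integrableOn_Icc)
    rw [Set.uIcc_of_le hT] at h1
    exact continuousOn_const.add (continuousOn_const.mul (h1.mono hsub))
  have hqd : ∀ s ∈ Set.Ioc 0 t, HasDerivAt q (a * n ^ 3 * H s) s := fun s hs =>
    ((hasDerivAt_integral_of_continuousOn_Icc hHc ⟨hs.1, hs.2.trans_lt ht.2⟩).const_mul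
      _).const_add K
  have key := h.phaseMGF_le hγ hτ h0 ht.1 hqc hqd (fun s hs z hz => ?_) (fun z hz => ?_) hz
  · refine key.trans (Real.exp_le_exp.2 ?_)
    have hK0 : 0 ≤ K := by linarith
    have htT : t ∈ Set.Icc 0 T := ⟨ht.1, ht.2.le⟩
    -- Cauchy–Schwarz would cost `√n` here, as `m t` has order `n` bounded coordinates; `hzm`
    -- restricts to directions where the pairing is bounded by the largest coordinate.
    have h1 : pair z (m t) ≤ K + M := hzm _ _ (hm1 t htT) fun i => by
      linarith [hm2 t htT i]
    have h2 : q t ≤ K + a * (incrementConst γ K / (2 * γ)) := by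
      have h3 : ∫ r in (0 : ℝ)..t, H r ≤ ∫ r in (0 : ℝ)..T, H r :=
        intervalIntegral.integral_mono_interval le_rfl ht.1 ht.2.le
          (Eventually.of_forall fun s => hH0 s)
          (ContinuousOn.intervalIntegrable (by rwa [Set.uIcc_of_le hT]))
      have h4 : (n : ℝ) ^ 3 * ∫ r in (0 : ℝ)..t, H r ≤ incrementConst γ K / (2 * γ) := by
        have h5 := mul_le_mul_of_nonneg_left (h3.trans hH) (by positivity : 0 ≤ (n : ℝ) ^ 3)
        rwa [mul_div_cancel₀ _ (by positivity)] at h5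
      simp only [hq]
      rw [mul_assoc]
      gcongr
    have h3 : 0 ≤ q t := by
      have : 0 ≤ ∫ r in (0 : ℝ)..t, H r := intervalIntegral.integral_nonneg ht.1 fun s _ => hH0 s
      positivity
    have h4 : q t * normSq z ≤ K + a * (incrementConst γ K / (2 * γ)) :=
      (mul_le_of_le_one_right h3 hz).trans h2
    simp only [logMGFConst]
    linarith
  · have hsT : s ∈ Set.Icc 0 T := ⟨hs.1.le, hs.2.trans ht.2.le⟩
    have h1 := sum_exp_sub_one_le hz (hm2 s hsT) (sq_snd_le_normSqFst_drift (τ s) (m s))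
    calc _ ≤ (n : ℝ) ^ 2 * γ * (4 * Real.exp (2 * M) * (n * H s) * normSq z) := by
          gcongr
      _ = a * n ^ 3 * H s * normSq z / 2 := by rw [ha]; ring
  · simpa [hq] using hinit z hz

/-! ### From exponential moments to moments of the energies -/

lemma pow_two_mul_le_exp (y : ℝ) (k : ℕ) :
    y ^ (2 * k) ≤ (2 * k).factorial * (Real.exp y + Real.exp (-y)) := by
  have h1 := Real.pow_div_factorial_le_exp |y| (abs_nonneg y) (2 * k)
  rw [div_le_iff₀ (by positivity), pow_mul, sq_abs, ← pow_mul] at h1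
  have h2 : Real.exp |y| ≤ Real.exp y + Real.exp (-y) := by
    rcases abs_cases y with ⟨h, _⟩ | ⟨h, _⟩ <;> rw [h] <;>
      linarith [Real.exp_pos y, Real.exp_pos (-y)]
  calc y ^ (2 * k) ≤ Real.exp |y| * (2 * k).factorial := h1
    _ = (2 * k).factorial * Real.exp |y| := mul_comm _ _
    _ ≤ _ := by gcongr

lemma energy_nonneg (x : Phase n) (i : Fin n) : 0 ≤ energy x i := by
  unfold energy potential; positivity

lemma energy_pow_le (x : Phase n) (i : Fin n) (k : ℕ) :
    energy x i ^ k ≤ x.2 i ^ (2 * k) + x.1 i ^ (2 * k) := by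
  have h1 : energy x i ≤ max (x.2 i ^ 2) (x.1 i ^ 2) := by
    have := le_max_left (x.2 i ^ 2) (x.1 i ^ 2)
    have := le_max_right (x.2 i ^ 2) (x.1 i ^ 2)
    unfold energy potential
    linarith
  refine (pow_le_pow_left₀ (energy_nonneg x i) h1 k).trans ?_
  rw [pow_mul, pow_mul]
  have ha : (0 : ℝ) ≤ (x.2 i ^ 2) ^ k := by positivity
  have hb : (0 : ℝ) ≤ (x.1 i ^ 2) ^ k := by positivity
  rcases max_cases (x.2 i ^ 2) (x.1 i ^ 2) with ⟨h, _⟩ | ⟨h, _⟩ <;> rw [h] <;> linarith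

/-- Bounds for the exponential moments of the coordinates give bounds for the moments of the
energies. -/
theorem integral_energy_pow_le {ν : Measure (Phase n)} (hν : HasExpMoments ν) {B : ℝ}
    (hB : ∀ i : Fin n, ∀ σ : ℝ, |σ| = 1 →
      phaseMGF ν (σ • ((Pi.single i 1, 0) : Phase n)) ≤ B ∧
      phaseMGF ν (σ • ((0, Pi.single i 1) : Phase n)) ≤ B) (k : ℕ) :
    Integrable (fun x => ∑ i : Fin n, energy x i ^ k) ν ∧
      ∫ x, ∑ i : Fin n, energy x i ^ k ∂ν ≤ (2 * k).factorial * (4 * B) * n := by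
  set e : Fin n → ℝ → Phase n := fun i σ => σ • ((Pi.single i 1, 0) : Phase n) with he
  set e' : Fin n → ℝ → Phase n := fun i σ => σ • ((0, Pi.single i 1) : Phase n) with he'
  have hee : ∀ i σ x, pair (e i σ) x = σ * x.1 i := fun i σ x => by
    rw [he, pair_smul_left, pair_single_fst]
  have hee' : ∀ i σ x, pair (e' i σ) x = σ * x.2 i := fun i σ x => by
    rw [he', pair_smul_left, pair_single_snd]
  set g : Fin n → Phase n → ℝ := fun i x => (2 * k).factorial *
    ((Real.exp (pair (e i 1) x) + Real.exp (pair (e i (-1)) x))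
      + (Real.exp (pair (e' i 1) x) + Real.exp (pair (e' i (-1)) x))) with hg
  have hle : ∀ i x, energy x i ^ k ≤ g i x := by
    intro i x
    have h1 := energy_pow_le x i k
    have h2 := pow_two_mul_le_exp (x.1 i) k
    have h3 := pow_two_mul_le_exp (x.2 i) k
    simp only [hg, hee, hee', one_mul, neg_mul]
    linarith
  have hI := fun z => hν.integrable_exp_pair z
  have hgi : ∀ i ∈ Finset.univ, Integrable (g i) ν := fun i _ =>
    (((hI _).add (hI _)).add ((hI _).add (hI _))).const_mul _
  have hgI : ∀ i, ∫ x, g i x ∂ν ≤ (2 * k).factorial * (4 * B) := by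
    intro i
    have h1 : ∫ x, g i x ∂ν = (2 * k).factorial * ((phaseMGF ν (e i 1) + phaseMGF ν (e i (-1)))
        + (phaseMGF ν (e' i 1) + phaseMGF ν (e' i (-1)))) := by
      have h2 : Integrable (fun x => Real.exp (pair (e i 1) x) + Real.exp (pair (e i (-1)) x)) ν :=
        (hI _).add (hI _)
      have h3 : Integrable
          (fun x => Real.exp (pair (e' i 1) x) + Real.exp (pair (e' i (-1)) x)) ν :=
        (hI _).add (hI _)
      simp only [hg, phaseMGF]
      rw [integral_const_mul, integral_add h2 h3, integral_add (hI _) (hI _),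
        integral_add (hI _) (hI _)]
    rw [h1]
    gcongr
    have h4 := hB i 1 (by simp)
    have h5 := hB i (-1) (by simp)
    linarith [h4.1, h4.2, h5.1, h5.2]
  have hmeas : Continuous fun x : Phase n => ∑ i : Fin n, energy x i ^ k := by
    unfold energy potential; fun_prop
  have hdom : ∀ x, ∑ i : Fin n, energy x i ^ k ≤ ∑ i, g i x := fun x =>
    Finset.sum_le_sum fun i _ => hle i x
  have hInt : Integrable (fun x => ∑ i : Fin n, energy x i ^ k) ν := by
    refine (integrable_finsetSum _ hgi).mono' hmeas.aestronglyMeasurable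
      (Eventually.of_forall fun x => ?_)
    rw [Real.norm_eq_abs, abs_of_nonneg
      (Finset.sum_nonneg fun i _ => pow_nonneg (energy_nonneg x i) k)]
    exact hdom x
  refine ⟨hInt, ?_⟩
  calc ∫ x, ∑ i : Fin n, energy x i ^ k ∂ν ≤ ∫ x, ∑ i, g i x ∂ν :=
        integral_mono hInt (integrable_finsetSum _ hgi) hdom
    _ = ∑ i, ∫ x, g i x ∂ν := integral_finsetSum _ hgi
    _ ≤ ∑ _i : Fin n, ((2 * k).factorial * (4 * B) : ℝ) := Finset.sum_le_sum fun i _ => hgI i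
    _ = _ := by simp; ring

end

noncomputable section

variable {n : ℕ}

/-! ### The laws of the chain -/

/-- The unbounded drift only matters on the compact support of `f`. The bound justifies exchanging
expectation and time integral in the martingale identity. -/
lemma exists_abs_generator_le (γ B : ℝ) {f : Phase n → ℝ} (hf : ContDiff ℝ 1 f)
    (hfc : HasCompactSupport f) : ∃ C, ∀ τ ∈ Set.Icc (-B) B, ∀ x, |generator n γ τ f x| ≤ C := by
  obtain ⟨C₀, hC₀⟩ := hfc.exists_bound_of_continuous hf.continuous
  have h1 : Continuous fun q : ℝ × Phase n => fderiv ℝ f q.2 (drift q.1 q.2) :=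
    ((hf.continuous_fderiv one_ne_zero).comp continuous_snd).clm_apply continuous_drift
  obtain ⟨C₁, hC₁⟩ := ((isCompact_Icc (a := -B) (b := B)).prod hfc.isCompact).exists_bound_of_continuousOn
    h1.continuousOn
  refine ⟨(n : ℝ) ^ 2 * |C₁| + (n : ℝ) ^ 2 * |γ| * (n * (2 * C₀)), fun τ hτ x => ?_⟩
  rw [generator_eq]
  refine (abs_add_le _ _).trans ?_
  rw [abs_mul, abs_mul, abs_mul, abs_of_nonneg (by positivity : (0 : ℝ) ≤ (n : ℝ) ^ 2)]
  refine add_le_add (mul_le_mul_of_nonneg_left ?_ (by positivity))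
    (mul_le_mul_of_nonneg_left ?_ (by positivity))
  · by_cases hx : x ∈ tsupport f
    · exact (hC₁ (τ, x) ⟨hτ, hx⟩).trans (le_abs_self _)
    · have : fderiv ℝ f x = 0 := by
        by_contra hne
        exact hx (support_fderiv_subset ℝ (f := f) hne)
      simp [this]
  · refine (Finset.abs_sum_le_sum_abs _ _).trans ?_
    refine (Finset.sum_le_card_nsmul _ _ (2 * C₀) fun i _ => ?_).trans (by simp)
    have h2 := hC₀ (flip i x)
    have h3 := hC₀ x
    rw [Real.norm_eq_abs] at h2 h3
    linarith [abs_sub (f (flip i x)) (f x)]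

/-- The laws of a chain satisfy Dynkin's formula. -/
theorem IsChain.isLawFlow {γ : ℝ} {τbar τ₀ β₀ : ℝ → ℝ} (hτ : ContinuousOn τbar (Set.Ici 0))
    {Ω : Type*} [MeasurableSpace Ω] {P : Measure Ω} [IsProbabilityMeasure P]
    {ℱ : Filtration ℝ≥0 ‹MeasurableSpace Ω›} {X : ℝ≥0 → Ω → Phase n}
    (h : IsChain n γ τbar τ₀ β₀ P ℱ X) :
    IsLawFlow n γ (fun s => τbar (max s 0)) (fun s => P.map (X s.toNNReal)) := by
  have hXm : ∀ s, Measurable (X s) := fun s => h.measurable.comp measurable_prodMk_left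
  -- Freezing the tension at negative times makes it continuous on all of `ℝ` and changes nothing at
  -- times `s ≥ 0`.
  have hτc : Continuous fun s : ℝ => τbar (max s 0) :=
    hτ.comp_continuous (by fun_prop) fun s => Set.mem_Ici.2 (le_max_right _ _)
  refine ⟨fun s => Measure.isProbabilityMeasure_map (hXm _).aemeasurable, ?_, ?_⟩
  · refine Measure.measurable_of_measurable_coe _ fun A hA => ?_
    have h1 : Measurable fun q : ℝ × Ω => X q.1.toNNReal q.2 :=
      h.measurable.comp ((measurable_real_toNNReal.comp measurable_fst).prodMk measurable_snd)
    have h2 := measurable_measure_prodMk_left (ν := P) (h1 hA)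
    have h3 : (fun s : ℝ => P.map (X s.toNNReal) A) =
        fun s => P (Prod.mk s ⁻¹' ((fun q : ℝ × Ω => X q.1.toNNReal q.2) ⁻¹' A)) :=
      funext fun s => Measure.map_apply (hXm _) hA
    rw [h3]
    exact h2
  · intro f hf hfc t ht
    obtain ⟨B, hB⟩ : ∃ B, ∀ s ∈ Set.Icc 0 t, ‖τbar (max s 0)‖ ≤ B :=
      isCompact_Icc.exists_bound_of_continuousOn hτc.continuousOn
    obtain ⟨C, hC⟩ := exists_abs_generator_le γ B hf hfc
    obtain ⟨C₀, hC₀⟩ := hfc.exists_bound_of_continuous hf.continuous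
    have hfX : ∀ s, Integrable (fun ω => f (X s ω)) P := fun s =>
      Integrable.of_bound (hf.continuous.measurable.comp (hXm s)).aestronglyMeasurable C₀
        (Eventually.of_forall fun ω => hC₀ _)
    set M : ℝ≥0 → Ω → ℝ := fun t ω =>
      f (X t ω) - ∫ s in (0 : ℝ)..(t : ℝ), generator n γ (τbar s) f (X s.toNNReal ω) with hM
    have hmart : Martingale M ℱ P := h.martingale f hf hfc
    have hE : ∫ ω, M t.toNNReal ω ∂P = ∫ ω, M 0 ω ∂P := by
      have h1 := hmart.setIntegral_eq (zero_le (a := t.toNNReal)) (s := Set.univ)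
        MeasurableSet.univ
      simpa using h1.symm
    have hM0 : ∀ ω, M 0 ω = f (X 0 ω) := fun ω => by simp [hM]
    set G : Ω → ℝ := fun ω => ∫ s in (0 : ℝ)..t, generator n γ (τbar s) f (X s.toNNReal ω) with hG
    have hMt : ∀ ω, M t.toNNReal ω = f (X t.toNNReal ω) - G ω := fun ω => by
      simp [hM, hG, Real.coe_toNNReal t ht]
    have hGint : Integrable G P := by
      have := (hfX t.toNNReal).sub (hmart.integrable t.toNNReal)
      refine this.congr (Eventually.of_forall fun ω => ?_)
      simp [hMt]
    simp only [hMt, hM0] at hE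
    rw [integral_sub (hfX _) hGint] at hE
    have hmap : ∀ (s : ℝ≥0) (g : Phase n → ℝ), Continuous g →
        ∫ x, g x ∂P.map (X s) = ∫ ω, g (X s ω) ∂P := fun s g hg =>
      integral_map (hXm s).aemeasurable hg.aestronglyMeasurable
    have hgc : ∀ s : ℝ, Continuous (generator n γ (τbar (max s 0)) f) := fun s =>
      (continuous_generator γ hf).comp (Continuous.prodMk continuous_const continuous_id)
    have hswap : ∫ ω, G ω ∂P =
        ∫ s in (0 : ℝ)..t, ∫ ω, generator n γ (τbar (max s 0)) f (X s.toNNReal ω) ∂P := by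
      have h1 : ∀ ω, G ω = ∫ s in Set.Ioc 0 t,
          generator n γ (τbar (max s 0)) f (X s.toNNReal ω) := fun ω => by
        rw [hG]
        simp only
        rw [intervalIntegral.integral_of_le ht]
        refine setIntegral_congr_fun measurableSet_Ioc fun s hs => ?_
        rw [max_eq_left hs.1.le]
      simp only [h1]
      rw [intervalIntegral.integral_of_le ht]
      refine integral_integral_swap (f := fun ω s =>
        generator n γ (τbar (max s 0)) f (X s.toNNReal ω)) ?_
      have hmeas : Measurable fun q : Ω × ℝ =>
          generator n γ (τbar (max q.2 0)) f (X q.2.toNNReal q.1) := by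
        have h2 : Measurable fun q : Ω × ℝ => X q.2.toNNReal q.1 :=
          h.measurable.comp ((measurable_real_toNNReal.comp measurable_snd).prodMk measurable_fst)
        have h3 : Measurable fun q : Ω × ℝ => τbar (max q.2 0) :=
          hτc.measurable.comp measurable_snd
        exact Measurable.comp (g := fun q : ℝ × Phase n => generator n γ q.1 f q.2)
          (f := fun q : Ω × ℝ => (τbar (max q.2 0), X q.2.toNNReal q.1))
          (continuous_generator γ hf).measurable (h3.prodMk h2)
      refine Integrable.of_bound hmeas.aestronglyMeasurable C ?_
      refine (Measure.ae_prod_iff_ae_ae (measurableSet_le hmeas.norm measurable_const)).2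
        (Eventually.of_forall fun ω => ?_)
      refine (ae_restrict_iff' measurableSet_Ioc).2 (Eventually.of_forall fun s hs => ?_)
      exact hC _ (abs_le.1 (hB s ⟨hs.1.le, hs.2⟩)) _
    rw [hmap _ f hf.continuous, hmap _ f hf.continuous, Real.toNNReal_zero]
    simp only [hmap _ _ (hgc _)]
    rw [← hswap]
    linarith

/-! ### The initial law -/

lemma pi_gaussianReal_eq_withDensity {ι : Type*} [Fintype ι] (a : ι → ℝ) (v : ι → ℝ≥0)
    (hv : ∀ i, v i ≠ 0) :
    Measure.pi (fun i => gaussianReal (a i) (v i)) = (volume : Measure (ι → ℝ)).withDensity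
      fun x => ENNReal.ofReal (∏ i, gaussianPDFReal (a i) (v i) (x i)) := by
  refine (Measure.pi_eq fun s hs => ?_)
  have hpos : ∀ x : ι → ℝ, 0 ≤ ∏ i, gaussianPDFReal (a i) (v i) (x i) := fun x =>
    Finset.prod_nonneg fun i _ => gaussianPDFReal_nonneg _ _ _
  rw [withDensity_apply _ (MeasurableSet.univ_pi hs), volume_pi, Measure.restrict_pi_pi,
    ← ofReal_integral_eq_lintegral_ofReal _ (Eventually.of_forall hpos),
    integral_fintype_prod_eq_prod (fun i y => gaussianPDFReal (a i) (v i) y),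
    ENNReal.ofReal_prod_of_nonneg fun i _ =>
      integral_nonneg fun y => gaussianPDFReal_nonneg _ _ _]
  · refine Finset.prod_congr rfl fun i _ => ?_
    rw [gaussianReal_apply_eq_integral _ (hv i)]
  · exact Integrable.fintype_prod_dep fun i => (integrable_gaussianPDFReal _ _).restrict

lemma integral_exp_potential (τ : ℝ) {β : ℝ} (hβ : 0 < β) :
    ∫ r : ℝ, Real.exp (-β * (potential r - τ * r)) =
      Real.exp (β * τ ^ 2 / 2) * √(2 * Real.pi / β) := by
  have hv : (β⁻¹).toNNReal ≠ 0 := by simpa using hβ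
  have hc : (((β⁻¹).toNNReal : ℝ≥0) : ℝ) = β⁻¹ := Real.coe_toNNReal _ (by positivity)
  have h1 : ∀ r : ℝ, Real.exp (-β * (potential r - τ * r)) =
      Real.exp (β * τ ^ 2 / 2) * √(2 * Real.pi / β) *
        gaussianPDFReal τ (β⁻¹).toNNReal r := fun r => by
    have hs : √(2 * Real.pi / β) ≠ 0 := by positivity
    rw [gaussianPDFReal, hc, ← div_eq_mul_inv, mul_assoc, mul_inv_cancel_left₀ hs, ← Real.exp_add]
    congr 1
    unfold potential
    field_simp
    ring
  simp only [h1]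
  rw [integral_const_mul, integral_gaussianPDFReal_eq_one _ hv, mul_one]

/-- Completing the square: for the harmonic potential the one-site Gibbs density is Gaussian, with
stretch mean `τ`, momentum mean `0` and common variance `β⁻¹`. -/
lemma exp_sub_logPartition (τ : ℝ) {β : ℝ} (hβ : 0 < β) (r p : ℝ) :
    Real.exp (-β * (p ^ 2 / 2 + potential r - τ * r) - logPartition τ β) =
      gaussianPDFReal τ (β⁻¹).toNNReal r * gaussianPDFReal 0 (β⁻¹).toNNReal p := by
  have hc : (((β⁻¹).toNNReal : ℝ≥0) : ℝ) = β⁻¹ := Real.coe_toNNReal _ (by positivity)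
  have hs : 0 < √(2 * Real.pi / β) := by positivity
  rw [Real.exp_sub, logPartition, integral_exp_potential τ hβ, Real.exp_log (by positivity),
    gaussianPDFReal, gaussianPDFReal, hc, ← div_eq_mul_inv]
  rw [div_eq_iff (by positivity)]
  have h1 : Real.exp (-β * (p ^ 2 / 2 + potential r - τ * r)) =
      Real.exp (-(r - τ) ^ 2 / (2 * β⁻¹)) * Real.exp (-(p - 0) ^ 2 / (2 * β⁻¹)) *
        Real.exp (β * τ ^ 2 / 2) := by
    rw [← Real.exp_add, ← Real.exp_add]
    congr 1
    unfold potential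
    field_simp
    ring
  rw [h1]
  field_simp

/-- The product of Gaussian laws with stretch means `a i` and variances `v i`. -/
def gaussianPhase (a : Fin n → ℝ) (v : Fin n → ℝ≥0) : Measure (Phase n) :=
  (Measure.pi fun i => gaussianReal (a i) (v i)).prod (Measure.pi fun i => gaussianReal 0 (v i))

/-- The macroscopic position `i / n` of particle `i`. -/
def site (i : Fin n) : ℝ := ((i : ℕ) + 1 : ℝ) / n

lemma site_mem (i : Fin n) : site i ∈ Set.Icc (0 : ℝ) 1 := by
  have h1 : 0 < n := i.pos
  have h2 : (0 : ℝ) < n := by exact_mod_cast h1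
  refine ⟨by unfold site; positivity, ?_⟩
  rw [site, div_le_one h2]
  exact_mod_cast i.2

lemma localGibbs_eq_gaussianPhase {τ β : ℝ → ℝ} (hβ : ∀ x ∈ Set.Icc (0 : ℝ) 1, 0 < β x) :
    localGibbs n τ β =
      gaussianPhase (fun i => τ (site i)) fun i => ((β (site i))⁻¹).toNNReal := by
  have hv : ∀ i : Fin n, ((β (site i))⁻¹).toNNReal ≠ 0 := fun i => by
    simpa using hβ _ (site_mem i)
  have hm : ∀ (a : Fin n → ℝ) (v : Fin n → ℝ≥0), Measurable fun x : Fin n → ℝ =>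
      ENNReal.ofReal (∏ i, gaussianPDFReal (a i) (v i) (x i)) := fun a v =>
    (Finset.measurable_prod _ fun i _ =>
      (measurable_gaussianPDFReal _ _).comp (measurable_pi_apply i)).ennreal_ofReal
  rw [gaussianPhase, pi_gaussianReal_eq_withDensity _ _ hv, pi_gaussianReal_eq_withDensity _ _ hv,
    prod_withDensity (hm _ _) (hm _ _), localGibbs]
  congr 1
  funext x
  rw [← ENNReal.ofReal_mul (Finset.prod_nonneg fun i _ => gaussianPDFReal_nonneg _ _ _),
    ← Finset.prod_mul_distrib]
  congr 1
  refine Finset.prod_congr rfl fun i _ => ?_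
  exact exp_sub_logPartition (τ (site i)) (hβ _ (site_mem i)) (x.1 i) (x.2 i)

lemma phaseMGF_gaussianPhase (a : Fin n → ℝ) (v : Fin n → ℝ≥0) (z : Phase n) :
    phaseMGF (gaussianPhase a v) z = Real.exp (∑ i, a i * z.1 i
      + ∑ i, (v i : ℝ) * (z.1 i ^ 2 + z.2 i ^ 2) / 2) := by
  have hg : ∀ (b : ℝ) (w : ℝ≥0) (s : ℝ), ∫ y, Real.exp (s * y) ∂gaussianReal b w =
      Real.exp (b * s + w * s ^ 2 / 2) := fun b w s =>
    congrFun (mgf_id_gaussianReal (μ := b) (v := w)) s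
  have h1 : ∀ x : Phase n, Real.exp (pair z x) =
      (∏ i, Real.exp (z.1 i * x.1 i)) * ∏ i, Real.exp (z.2 i * x.2 i) := fun x => by
    rw [← Real.exp_sum, ← Real.exp_sum, ← Real.exp_add, pair, Finset.sum_add_distrib]
  simp only [phaseMGF, h1, gaussianPhase]
  rw [integral_prod_mul (fun r : Fin n → ℝ => ∏ i, Real.exp (z.1 i * r i))
      (fun p : Fin n → ℝ => ∏ i, Real.exp (z.2 i * p i)),
    integral_fintype_prod_eq_prod (fun i y => Real.exp (z.1 i * y)),
    integral_fintype_prod_eq_prod (fun i y => Real.exp (z.2 i * y))]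
  simp only [hg]
  rw [← Real.exp_sum, ← Real.exp_sum, ← Real.exp_add, ← Finset.sum_add_distrib,
    ← Finset.sum_add_distrib]
  congr 1
  exact Finset.sum_congr rfl fun i _ => by ring

lemma meanPhase_gaussianPhase (a : Fin n → ℝ) (v : Fin n → ℝ≥0) :
    meanPhase (gaussianPhase a v) = (a, 0) := by
  have h1 : ∀ i, (gaussianPhase a v).map (fun x => x.1 i) = gaussianReal (a i) (v i) := fun i =>
    ((measurePreserving_eval (fun i => gaussianReal (a i) (v i)) i).comp
      (measurePreserving_fst (μ := Measure.pi fun i => gaussianReal (a i) (v i))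
        (ν := Measure.pi fun i => gaussianReal 0 (v i)))).map_eq
  have h2 : ∀ i, (gaussianPhase a v).map (fun x => x.2 i) = gaussianReal 0 (v i) := fun i =>
    ((measurePreserving_eval (fun i => gaussianReal 0 (v i)) i).comp
      (measurePreserving_snd (μ := Measure.pi fun i => gaussianReal (a i) (v i))
        (ν := Measure.pi fun i => gaussianReal 0 (v i)))).map_eq
  refine Prod.ext (funext fun i => ?_) (funext fun i => ?_)
  · have h3 := integral_map (μ := gaussianPhase a v) (φ := fun x => x.1 i) (f := fun y : ℝ => y)
      (by fun_prop) (by fun_prop)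
    rw [h1, integral_id_gaussianReal] at h3
    exact h3.symm
  · have h3 := integral_map (μ := gaussianPhase a v) (φ := fun x => x.2 i) (f := fun y : ℝ => y)
      (by fun_prop) (by fun_prop)
    rw [h2, integral_id_gaussianReal] at h3
    exact h3.symm

/-- The `ℓ¹` bound makes the exponential weight subordinate to a product over coordinates, whose
integral against a product measure factorizes. -/
lemma bracket_le (x : Phase n) : bracket x ≤ 1 + (∑ i, |x.1 i| + ∑ i, |x.2 i|) := by
  have h1 : 0 ≤ ∑ i, |x.1 i| := Finset.sum_nonneg fun i _ => abs_nonneg _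
  have h2 : 0 ≤ ∑ i, |x.2 i| := Finset.sum_nonneg fun i _ => abs_nonneg _
  have key : ∀ f : Fin n → ℝ, ∑ i, f i ^ 2 ≤ (∑ i, |f i|) ^ 2 := fun f => by
    simpa using Finset.sum_sq_le_sq_sum_of_nonneg (s := Finset.univ) (f := fun i => |f i|)
      fun i _ => abs_nonneg _
  rw [bracket, Real.sqrt_le_left (by positivity), normSq_eq, Finset.sum_add_distrib]
  nlinarith [key x.1, key x.2, mul_nonneg h1 h2]

lemma hasExpMoments_gaussianPhase (a : Fin n → ℝ) (v : Fin n → ℝ≥0) :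
    HasExpMoments (gaussianPhase a v) := by
  intro c hc
  have hg : ∀ (b : ℝ) (w : ℝ≥0), Integrable (fun y => Real.exp (c * |y|)) (gaussianReal b w) :=
    fun b w => integrable_exp_mul_abs (X := fun y => y) (integrable_exp_mul_gaussianReal c)
      (integrable_exp_mul_gaussianReal (-c))
  have h1 : Integrable (fun x : Phase n => Real.exp c * ((∏ i, Real.exp (c * |x.1 i|)) *
      ∏ i, Real.exp (c * |x.2 i|))) (gaussianPhase a v) :=
    ((Integrable.fintype_prod_dep fun i => hg (a i) (v i)).mul_prod
      (Integrable.fintype_prod_dep fun i => hg 0 (v i))).const_mul _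
  refine h1.mono' (continuous_weight c).aestronglyMeasurable (Eventually.of_forall fun x => ?_)
  rw [Real.norm_eq_abs, abs_of_pos (weight_pos c x), ← Real.exp_sum, ← Real.exp_sum,
    ← Real.exp_add, ← Real.exp_add, ← Finset.mul_sum, ← Finset.mul_sum, weight]
  refine Real.exp_le_exp.2 ?_
  have := mul_le_mul_of_nonneg_left (bracket_le x) hc
  linarith

/-- Neighbouring sites are `1/n` apart, so each of the `n` stretch increments is at most `L/n`. At
the last particle the tension is the profile's own value at `1`, so there is no jump of order one at
the boundary. -/
lemma normSq_drift_profile_le (hn : 1 ≤ n) {τ₀ : ℝ → ℝ} {L : ℝ}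
    (hL : ∀ x ∈ Set.Icc (0 : ℝ) 1, ∀ y ∈ Set.Icc (0 : ℝ) 1, |τ₀ x - τ₀ y| ≤ L * |x - y|) :
    normSq (drift (τ₀ 1) ((fun i => τ₀ (site i), 0) : Phase n)) ≤ L ^ 2 / n := by
  have hn0 : (0 : ℝ) < n := by exact_mod_cast hn
  have hfst : ∀ i : Fin n, (drift (τ₀ 1) ((fun i => τ₀ (site i), 0) : Phase n)).1 i = 0 :=
    fun i => by simp [drift, prevMomentum]
  have hsnd : ∀ i : Fin n,
      |(drift (τ₀ 1) ((fun i => τ₀ (site i), 0) : Phase n)).2 i| ≤ L / n := by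
    intro i
    simp only [drift, rightForce]
    have hL0 : 0 ≤ L := by
      have := hL 0 (by simp) 1 (by simp)
      norm_num at this
      exact (abs_nonneg _).trans this
    by_cases h : (i : ℕ) + 1 < n
    · rw [dif_pos h]
      refine (hL _ (site_mem _) _ (site_mem _)).trans (le_of_eq ?_)
      have : site (⟨(i : ℕ) + 1, h⟩ : Fin n) - site i = 1 / n := by
        simp only [site]; push_cast; ring
      rw [this, abs_of_pos (by positivity)]
      ring
    · rw [dif_neg h]
      have hi : ((i : ℕ) + 1 : ℝ) = n := by
        have := i.2
        exact_mod_cast (by omega : (i : ℕ) + 1 = n)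
      have : site i = 1 := by rw [site, hi, div_self hn0.ne']
      rw [this, sub_self, abs_zero]
      positivity
  rw [normSq_eq]
  calc _ ≤ ∑ _i : Fin n, (L / n) ^ 2 := by
        refine Finset.sum_le_sum fun i _ => ?_
        rw [hfst]
        have h2 := pow_le_pow_left₀ (abs_nonneg _) (hsnd i) 2
        rw [sq_abs] at h2
        linarith
    _ = L ^ 2 / n := by
      simp
      field_simp

/-- The moment bound for one chain, with an explicit constant. -/
theorem IsChain.integral_energy_pow_le {γ K L T : ℝ} {τbar τ₀ β₀ τ₁ τ₂ : ℝ → ℝ} (hγ : 0 < γ)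
    (hn : 1 ≤ n) (hK : 1 ≤ K) (hτ : ContinuousOn τbar (Set.Ici 0))
    (hτ₁c : ContinuousOn τ₁ (Set.Icc 0 T)) (hτ₂c : ContinuousOn τ₂ (Set.Icc 0 T))
    (hτd : ∀ t ∈ Set.Ioo 0 T, HasDerivAt τbar (τ₁ t) t)
    (hτ₁d : ∀ t ∈ Set.Ioo 0 T, HasDerivAt τ₁ (τ₂ t) t)
    (hτb : ∀ t ∈ Set.Icc 0 T, |τbar t| ≤ K) (hb : ∀ t ∈ Set.Icc 0 T, |τ₁ t| ≤ K)
    (hi1 : ∫ s in (0 : ℝ)..T, τ₁ s ^ 2 ≤ K) (hi2 : ∫ s in (0 : ℝ)..T, |τ₂ s| ≤ K)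
    (hL : ∀ x ∈ Set.Icc (0 : ℝ) 1, ∀ y ∈ Set.Icc (0 : ℝ) 1, |τ₀ x - τ₀ y| ≤ L * |x - y|)
    (hLK : L ^ 2 ≤ K) (hβpos : ∀ x ∈ Set.Icc (0 : ℝ) 1, 0 < β₀ x)
    (hβ : ∀ x ∈ Set.Icc (0 : ℝ) 1, (β₀ x)⁻¹ ≤ K) (hboundary : τ₀ 1 = τbar 0)
    {Ω : Type*} [MeasurableSpace Ω] {P : Measure Ω} [IsProbabilityMeasure P]
    {ℱ : Filtration ℝ≥0 ‹MeasurableSpace Ω›} {X : ℝ≥0 → Ω → Phase n}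
    (h : IsChain n γ τbar τ₀ β₀ P ℱ X) {t : ℝ≥0} (ht : (t : ℝ) < T) (k : ℕ) :
    Integrable (fun x => ∑ i : Fin n, energy x i ^ k) (P.map (X t)) ∧
      ∫ x, ∑ i : Fin n, energy x i ^ k ∂(P.map (X t)) ≤
        (2 * k).factorial * (4 * Real.exp (logMGFConst γ K)) * n := by
  have hflow := h.isLawFlow hτ
  set μ : ℝ → Measure (Phase n) := fun s => P.map (X s.toNNReal) with hμ
  set a : Fin n → ℝ := fun i => τ₀ (site i) with ha
  set v : Fin n → ℝ≥0 := fun i => ((β₀ (site i))⁻¹).toNNReal with hv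
  have hμ0 : μ 0 = gaussianPhase a v := by
    simp only [hμ, Real.toNNReal_zero, h.initial]
    exact localGibbs_eq_gaussianPhase hβpos
  have hμt : μ t = P.map (X t) := by simp [hμ]
  have hτc : Continuous fun s : ℝ => τbar (max s 0) :=
    hτ.comp_continuous (by fun_prop) fun s => Set.mem_Ici.2 (le_max_right _ _)
  have h0 : HasExpMoments (μ 0) := hμ0 ▸ hasExpMoments_gaussianPhase a v
  have hmean : meanPhase (μ 0) = (a, 0) := by rw [hμ0, meanPhase_gaussianPhase]
  have hn0 : (0 : ℝ) < n := by exact_mod_cast hn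
  have hinit : ∀ z : Phase n, normSq z ≤ 1 →
      phaseMGF (μ 0) z ≤ Real.exp (pair z (meanPhase (μ 0)) + K * normSq z / 2) := by
    intro z _
    rw [hmean, hμ0, phaseMGF_gaussianPhase]
    refine Real.exp_le_exp.2 (add_le_add (le_of_eq ?_) ?_)
    · simp only [pair, Pi.zero_apply, mul_zero, add_zero]
      exact Finset.sum_congr rfl fun i _ => mul_comm _ _
    · rw [normSq_eq, Finset.mul_sum, Finset.sum_div]
      refine Finset.sum_le_sum fun i _ => ?_
      have h1 : (v i : ℝ) ≤ K := by
        rw [hv, Real.coe_toNNReal _ (inv_pos.2 (hβpos _ (site_mem i))).le]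
        exact hβ _ (site_mem i)
      gcongr
  have hD0 : normSq (drift (τbar (max 0 0)) (meanPhase (μ 0))) ≤ K / n := by
    rw [hmean, max_self, ← hboundary]
    exact (normSq_drift_profile_le hn hL).trans (by gcongr)
  have hmgf : ∀ z : Phase n, normSq z ≤ 1 →
      (∀ x M, (∀ i, |x.1 i| ≤ M) → (∀ i, |x.2 i| ≤ M) → pair z x ≤ M) →
      phaseMGF (μ t) z ≤ Real.exp (logMGFConst γ K) := by
    intro z hz hzm
    refine hflow.exp_moment_le hγ hn hτc h0 hK hτ₁c hτ₂c (fun s hs => ?_) hτ₁d (fun s hs => ?_)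
      hb hi1 hi2 (by rw [hmean]) hD0 hinit ⟨t.2, ht⟩ hz hzm
    · refine (hτd s hs).congr_of_eventuallyEq ?_
      filter_upwards [Ioi_mem_nhds hs.1] with r hr
      rw [max_eq_left (le_of_lt hr)]
    · simp only [max_eq_left hs.1]
      exact hτb s hs
  rw [← hμt]
  refine VelocityFlip.integral_energy_pow_le (hflow.hasExpMoments hτc h0 t.2)
    (fun i σ hσ => ⟨hmgf _ ?_ ?_, hmgf _ ?_ ?_⟩) k
  · rw [normSq_smul, ← sq_abs, hσ, normSq, pair_single_fst]; simp
  · intro x M h1 _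
    rw [pair_smul_left, pair_single_fst]
    refine (le_abs_self _).trans ?_
    rw [abs_mul, hσ, one_mul]
    exact h1 i
  · rw [normSq_smul, ← sq_abs, hσ, normSq, pair_single_snd]; simp
  · intro x M _ h2
    rw [pair_smul_left, pair_single_snd]
    refine (le_abs_self _).trans ?_
    rw [abs_mul, hσ, one_mul]
    exact h2 i

end

/-! ### Constants depending on the tension through total variations, and the conclusion -/

lemma abs_sub_le_integral_abs_deriv {f f' : ℝ → ℝ} {T t : ℝ} (ht : t ∈ Set.Icc 0 T)
    (hf : ContinuousOn f (Set.Icc 0 T)) (hf' : ContinuousOn f' (Set.Icc 0 T))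
    (hd : ∀ s ∈ Set.Ioo 0 T, HasDerivAt f (f' s) s) :
    |f t| ≤ |f 0| + ∫ s in (0 : ℝ)..T, |f' s| := by
  have hT : 0 ≤ T := ht.1.trans ht.2
  have hsub : Set.Icc 0 t ⊆ Set.Icc 0 T := Set.Icc_subset_Icc le_rfl ht.2
  have h1 := intervalIntegral.integral_eq_sub_of_hasDerivAt_of_le ht.1 (hf.mono hsub)
    (fun s hs => hd s ⟨hs.1, hs.2.trans_le ht.2⟩)
    (ContinuousOn.intervalIntegrable (by rw [Set.uIcc_of_le ht.1]; exact hf'.mono hsub))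
  have h2 := intervalIntegral.abs_integral_le_integral_abs (f := f') (μ := volume) ht.1
  have h3 : ∫ s in (0 : ℝ)..t, |f' s| ≤ ∫ s in (0 : ℝ)..T, |f' s| :=
    intervalIntegral.integral_mono_interval le_rfl ht.1 ht.2
      (Eventually.of_forall fun s => abs_nonneg _)
      (ContinuousOn.intervalIntegrable (by rw [Set.uIcc_of_le hT]; exact hf'.abs))
  rw [h1] at h2
  have h4 := abs_sub_abs_le_abs_sub (f t) (f 0)
  linarith

/-- The moment bound, with a constant that depends on the tension only through the integrals of
the absolute values of its first two derivatives. -/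
theorem exists_integral_energy_pow_le {γ : ℝ} (hγ : 0 < γ) {τbar τ₀ β₀ τ₁ τ₂ : ℝ → ℝ}
    (hτ : ContinuousOn τbar (Set.Ici 0)) (hτ₁ : ContinuousOn τ₁ (Set.Ici 0))
    (hτ₂ : ContinuousOn τ₂ (Set.Ici 0)) (hτd : ∀ t, 0 < t → HasDerivAt τbar (τ₁ t) t)
    (hτ₁d : ∀ t, 0 < t → HasDerivAt τ₁ (τ₂ t) t)
    (hτ₀ : ContDiffOn ℝ 1 τ₀ (Set.Icc 0 1)) (hβ₀ : ContinuousOn β₀ (Set.Icc 0 1))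
    (hβ₀pos : ∀ x ∈ Set.Icc (0 : ℝ) 1, 0 < β₀ x) (hboundary : τ₀ 1 = τbar 0) (k : ℕ)
    {I₁ I₂ : ℝ} (hI₁ : 0 ≤ I₁) (hI₂ : 0 ≤ I₂) :
    ∃ C : ℝ, 0 < C ∧ ∀ T : ℝ, ∫ s in (0 : ℝ)..T, |τ₁ s| ≤ I₁ → ∫ s in (0 : ℝ)..T, |τ₂ s| ≤ I₂ →
      ∀ n : ℕ, 1 ≤ n → ∀ t : ℝ≥0, (t : ℝ) < T →
      ∀ (Ω : Type*) [MeasurableSpace Ω] (P : Measure Ω) [IsProbabilityMeasure P]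
        (ℱ : Filtration ℝ≥0 ‹MeasurableSpace Ω›) (X : ℝ≥0 → Ω → Phase n),
        IsChain n γ τbar τ₀ β₀ P ℱ X →
        Integrable (fun x => ∑ i : Fin n, energy x i ^ k) (P.map (X t)) ∧
          ∫ x, ∑ i : Fin n, energy x i ^ k ∂(P.map (X t)) ≤ C * n := by
  obtain ⟨L, hL⟩ : ∃ L : ℝ, ∀ x ∈ Set.Icc (0 : ℝ) 1, ∀ y ∈ Set.Icc (0 : ℝ) 1,
      |τ₀ x - τ₀ y| ≤ L * |x - y| := by
    have hu : UniqueDiffOn ℝ (Set.Icc (0 : ℝ) 1) := uniqueDiffOn_Icc zero_lt_one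
    obtain ⟨L, hL⟩ := isCompact_Icc.exists_bound_of_continuousOn
      (hτ₀.continuousOn_derivWithin hu le_rfl)
    refine ⟨L, fun x hx y hy => ?_⟩
    exact (convex_Icc (0 : ℝ) 1).norm_image_sub_le_of_norm_derivWithin_le
      (hτ₀.differentiableOn one_ne_zero) hL hy hx
  obtain ⟨b, hb⟩ : ∃ b, ∀ x ∈ Set.Icc (0 : ℝ) 1, ‖(β₀ x)⁻¹‖ ≤ b :=
    isCompact_Icc.exists_bound_of_continuousOn (hβ₀.inv₀ fun x hx => (hβ₀pos x hx).ne')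
  have hb0 : 0 ≤ b := (norm_nonneg _).trans (hb 0 (by simp))
  set a₁ : ℝ := |τ₁ 0| + I₂ with ha₁
  -- One summand for each requirement on `K`: `1 ≤ K`, then bounds for `τ`, `τ'`, `∫ τ'²`, `∫
  -- |τ''|`, the squared Lipschitz constant of `τ₀`, and `β₀⁻¹`. None involves `T` or `n`.
  set K : ℝ := 1 + (|τbar 0| + I₁) + a₁ + a₁ * I₁ + I₂ + L ^ 2 + b with hK
  have ha₁0 : 0 ≤ a₁ := by positivity
  have hprod := mul_nonneg ha₁0 hI₁
  have habs := abs_nonneg (τbar 0)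
  have hL2 := sq_nonneg L
  refine ⟨(2 * k).factorial * (4 * Real.exp (logMGFConst γ K)), by positivity,
    fun T h1 h2 n hn t ht Ω _ P _ ℱ X hX => ?_⟩
  have hT : 0 ≤ T := t.2.trans ht.le
  have hsub : Set.Icc 0 T ⊆ Set.Ici 0 := fun s hs => hs.1
  have hbτ : ∀ s ∈ Set.Icc 0 T, |τbar s| ≤ |τbar 0| + I₁ := fun s hs =>
    (abs_sub_le_integral_abs_deriv hs (hτ.mono hsub) (hτ₁.mono hsub)
      fun r hr => hτd r hr.1).trans (by gcongr)
  have hbτ₁ : ∀ s ∈ Set.Icc 0 T, |τ₁ s| ≤ a₁ := fun s hs =>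
    (abs_sub_le_integral_abs_deriv hs (hτ₁.mono hsub) (hτ₂.mono hsub)
      fun r hr => hτ₁d r hr.1).trans (by rw [ha₁]; gcongr)
  -- Integrability of `τ''` bounds `τ'`, and a bounded integrable function is square integrable; no
  -- separate assumption on `∫ τ'²` is needed.
  have hsq : ∫ s in (0 : ℝ)..T, τ₁ s ^ 2 ≤ a₁ * I₁ := by
    calc ∫ s in (0 : ℝ)..T, τ₁ s ^ 2 ≤ ∫ s in (0 : ℝ)..T, a₁ * |τ₁ s| := by
          refine intervalIntegral.integral_mono_on hT
            (ContinuousOn.intervalIntegrable ?_) (ContinuousOn.intervalIntegrable ?_)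
            fun s hs => ?_
          · rw [Set.uIcc_of_le hT]; exact (hτ₁.mono hsub).pow 2
          · rw [Set.uIcc_of_le hT]; exact continuousOn_const.mul (hτ₁.mono hsub).abs
          · rw [← sq_abs, sq]
            exact mul_le_mul_of_nonneg_right (hbτ₁ s hs) (abs_nonneg _)
      _ = a₁ * ∫ s in (0 : ℝ)..T, |τ₁ s| := intervalIntegral.integral_const_mul _ _
      _ ≤ a₁ * I₁ := by gcongr
  refine hX.integral_energy_pow_le hγ hn (by linarith) hτ (hτ₁.mono hsub) (hτ₂.mono hsub)
    (fun s hs => hτd s hs.1) (fun s hs => hτ₁d s hs.1) (fun s hs => (hbτ s hs).trans ?_)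
    (fun s hs => (hbτ₁ s hs).trans ?_) (hsq.trans ?_) (h2.trans ?_) hL ?_ hβ₀pos
    (fun x hx => ((le_abs_self _).trans (hb x hx)).trans ?_) hboundary ht k <;> linarith

end VelocityFlip

theorem mainTheorem3 (γ : ℝ) (hγ : 0 < γ) (τbar τ₀ β₀ : ℝ → ℝ)
    (hτbar : ContDiffOn ℝ 2 τbar (Set.Ici 0))
    (hτ₀ : ContDiffOn ℝ 1 τ₀ (Set.Icc 0 1))
    (hβ₀ : ContinuousOn β₀ (Set.Icc 0 1))
    (hβ₀pos : ∀ x ∈ Set.Icc (0 : ℝ) 1, 0 < β₀ x)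
    (hboundary : τ₀ 1 = τbar 0)
    (k : ℕ) (hk : 1 ≤ k) :
    (∀ T : ℝ≥0, ∃ C : ℝ, 0 < C ∧ ∀ n : ℕ, 1 ≤ n → ∀ t : ℝ≥0, t ≤ T →
      ∀ (Ω : Type*) [MeasurableSpace Ω] (P : Measure Ω) [IsProbabilityMeasure P]
        (ℱ : Filtration ℝ≥0 ‹MeasurableSpace Ω›) (X : ℝ≥0 → Ω → VelocityFlip.Phase n),
        VelocityFlip.IsChain n γ τbar τ₀ β₀ P ℱ X →
        Integrable (fun x => ∑ i : Fin n, VelocityFlip.energy x i ^ k) (P.map (X t)) ∧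
          ∫ x, ∑ i : Fin n, VelocityFlip.energy x i ^ k ∂(P.map (X t)) ≤ C * n) ∧
    (IntegrableOn (deriv τbar) (Set.Ioi 0) → IntegrableOn (deriv (deriv τbar)) (Set.Ioi 0) →
      ∃ C : ℝ, 0 < C ∧ ∀ n : ℕ, 1 ≤ n → ∀ t : ℝ≥0,
      ∀ (Ω : Type*) [MeasurableSpace Ω] (P : Measure Ω) [IsProbabilityMeasure P]
        (ℱ : Filtration ℝ≥0 ‹MeasurableSpace Ω›) (X : ℝ≥0 → Ω → VelocityFlip.Phase n),
        VelocityFlip.IsChain n γ τbar τ₀ β₀ P ℱ X →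
        Integrable (fun x => ∑ i : Fin n, VelocityFlip.energy x i ^ k) (P.map (X t)) ∧
          ∫ x, ∑ i : Fin n, VelocityFlip.energy x i ^ k ∂(P.map (X t)) ≤ C * n) := by
  have hu : UniqueDiffOn ℝ (Set.Ici (0 : ℝ)) := uniqueDiffOn_Ici 0
  -- One-sided derivatives at `0` are used because the tension is only controlled on `[0, ∞)`; they
  -- are continuous up to the endpoint and agree with `deriv` at positive times.
  set τ₁ : ℝ → ℝ := derivWithin τbar (Set.Ici 0) with hτ₁
  set τ₂ : ℝ → ℝ := derivWithin τ₁ (Set.Ici 0) with hτ₂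
  have h1 : ContDiffOn ℝ 1 τ₁ (Set.Ici 0) := hτbar.derivWithin hu (by norm_num)
  have h2 : ContinuousOn τ₂ (Set.Ici 0) := h1.continuousOn_derivWithin hu le_rfl
  have hnhds : ∀ t : ℝ, 0 < t → Set.Ici (0 : ℝ) ∈ nhds t := fun t ht => Ici_mem_nhds ht
  have hd1 : ∀ t, 0 < t → HasDerivAt τbar (τ₁ t) t := fun t ht =>
    ((hτbar.differentiableOn two_ne_zero) t ht.le).hasDerivWithinAt.hasDerivAt (hnhds t ht)
  have hd2 : ∀ t, 0 < t → HasDerivAt τ₁ (τ₂ t) t := fun t ht =>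
    ((h1.differentiableOn one_ne_zero) t ht.le).hasDerivWithinAt.hasDerivAt (hnhds t ht)
  constructor
  · intro T
    -- The general bound needs `t` strictly inside the time interval, hence the margin `1`.
    have hT : (0 : ℝ) ≤ T + 1 := by positivity
    obtain ⟨C, hC, H⟩ := VelocityFlip.exists_integral_energy_pow_le hγ hτbar.continuousOn
      h1.continuousOn h2 hd1 hd2 hτ₀ hβ₀ hβ₀pos hboundary k
      (I₁ := ∫ s in (0 : ℝ)..(T + 1), |τ₁ s|) (I₂ := ∫ s in (0 : ℝ)..(T + 1), |τ₂ s|)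
      (intervalIntegral.integral_nonneg hT fun _ _ => abs_nonneg _)
      (intervalIntegral.integral_nonneg hT fun _ _ => abs_nonneg _)
    refine ⟨C, hC, fun n hn t ht Ω _ P _ ℱ X hX => ?_⟩
    have ht' : (t : ℝ) ≤ T := ht
    exact H (T + 1) le_rfl le_rfl n hn t (by linarith) Ω P ℱ X hX
  · intro hi1 hi2
    have he1 : ∀ s ∈ Set.Ioi (0 : ℝ), |deriv τbar s| = |τ₁ s| := fun s hs => by
      rw [(hd1 s hs).deriv]
    have he2 : ∀ s ∈ Set.Ioi (0 : ℝ), |deriv (deriv τbar) s| = |τ₂ s| := fun s hs => by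
      have h3 : deriv τbar =ᶠ[nhds s] τ₁ := by
        filter_upwards [Ioi_mem_nhds hs] with r hr using (hd1 r hr).deriv
      rw [h3.deriv_eq, (hd2 s hs).deriv]
    have hj1 : IntegrableOn (fun s => |τ₁ s|) (Set.Ioi 0) :=
      (integrableOn_congr_fun he1 measurableSet_Ioi).1 hi1.abs
    have hj2 : IntegrableOn (fun s => |τ₂ s|) (Set.Ioi 0) :=
      (integrableOn_congr_fun he2 measurableSet_Ioi).1 hi2.abs
    have hle : ∀ g : ℝ → ℝ, IntegrableOn (fun s => |g s|) (Set.Ioi 0) → ∀ T : ℝ, 0 ≤ T →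
        ∫ s in (0 : ℝ)..T, |g s| ≤ ∫ s in Set.Ioi 0, |g s| := fun g hg T hT => by
      rw [intervalIntegral.integral_of_le hT]
      exact setIntegral_mono_set hg (Filter.Eventually.of_forall fun s => abs_nonneg _)
        Set.Ioc_subset_Ioi_self.eventuallyLE
    obtain ⟨C, hC, H⟩ := VelocityFlip.exists_integral_energy_pow_le hγ hτbar.continuousOn
      h1.continuousOn h2 hd1 hd2 hτ₀ hβ₀ hβ₀pos hboundary k
      (I₁ := ∫ s in Set.Ioi 0, |τ₁ s|) (I₂ := ∫ s in Set.Ioi 0, |τ₂ s|)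
      (integral_nonneg fun _ => abs_nonneg _) (integral_nonneg fun _ => abs_nonneg _)
    refine ⟨C, hC, fun n hn t Ω _ P _ ℱ X hX => ?_⟩
    -- The horizon varies with `t`, but `C` was fixed beforehand from integrals over the whole
    -- half-line.
    have ht : (0 : ℝ) ≤ t + 1 := by positivity
    exact H (t + 1) (hle _ hj1 _ ht) (hle _ hj2 _ ht) n hn t (by linarith) Ω P ℱ X hX
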